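/- **Setting.** Let $2\le k<n$ be integers, $[n]=\{1,\dots,n\}$, and let $\mathcal S=\binom{[n]}{k}$ be the family of $k$-element subsets of $[n]$. For a probability distribution $\nu$ on $\{0,1\}^n$ and $X\sim\nu$, the expected reward of $S\in\mathcal S$ is $\mathbb E_\nu[\max_{i\in S}X_i]$. If the maximizer of the expected reward over $\mathcal S$ is unique, it is denoted $S^*$, and the gap of $\nu$ is $$\Delta=\mathbb E_\nu\Big[\max_{i\in S^*}X_i\Big]-\max_{S\in\mathcal S\setminus\{S^*\}}\mathbb E_\nu\Big[\max_{i\in S}X_i\Big].$$ A (possibly randomized) sequential algorithm chooses in each round $t$, on the basis of its past queries and observations, either to query a set $S_t\in\mathcal S$ or to stop and return a set $\widehat S\in\mathcal S$. If it queries $S_t$, a fresh vector $x_t\sim\nu$ is drawn, independently of the past, and the algorithm observes - (bandit feedback) $\max_{i\in S_t}x_{t,i}$; - (marked-bandit feedback) nothing ($\emptyset$) if $x_{t,i}=0$ for all $i\in S_t$, and otherwise an index drawn uniformly at random from $\{i\in S_t:x_{t,i}=1\}$; - (semi-bandit feedback) $x_{t,i}$ for every $i\in S_t$. For $\delta\in(0,1)$,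 an algorithm is $\delta$-correct if, for every distribution $\nu$ on $\{0,1\}^n$ with a unique best set $S^*$, it stops and returns $\widehat S=S^*$ with probability at least $1-\delta$ under $\nu$. **Theorem.** Fix $2\le k<n$. (a) For all $\epsilon\in(0,1]$ and $\mu\in(0,1/2]$ there is a distribution $\nu$ on $\{0,1\}^n$ with a unique best set and with gap $\Delta=\epsilon\mu^k$ such that, for every $\delta\in(0,1)$, the expected number of observations under $\nu$ of every $\delta$-correct algorithm is at least $$\frac{4\big(1-\epsilon(\frac{\mu}{1-\mu})^k\big)}{3}\,\big(1-(1-\mu)^k\big)(1-\mu)^k\binom nk\Delta^{-2}\log\tfrac1{2\delta}$$ for bandit feedback, and likewise for marked-bandit feedback, and at least $$\frac23\,\mu^{2k}(1-\epsilon)\binom nk\Delta^{-2}\log\tfrac1{2\delta}$$ for semi-bandit feedback. (b) For every $0<\xi\le(2k)^{-k}$ there is a distribution $\nu$ on $\{0,1\}^n$ with a unique best set and with gap $\Delta=\xi$ such that, for every $\delta\in(0,1)$, every $\delta$-correct algorithm with bandit feedback, and every $\delta$-correct algorithm with marked-bandit feedback, makes in expectation under $\nu$ at least $\frac13\binom nk\Delta^{-2}\log\frac1{2\delta}$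 observations. (c) For every $0<\xi\le2^{-k-1}$ there is a distribution $\nu$ on $\{0,1\}^n$ with a unique best set and with gap $\Delta=\xi$ such that, for every $\delta\in(0,1)$, every $\delta$-correct algorithm with semi-bandit feedback makes in expectation under $\nu$ at least $\frac13\,2^{-2k}\binom nk\Delta^{-2}\log\frac1{2\delta}$ observations. -/

import Mathlib

open MeasureTheory ProbabilityTheory
open scoped ENNReal

noncomputable section

namespace BestOfK

/-- The `k`-subsets of the `n` arms: the sets that may be queried and the possible answers. -/
abbrev KSet (n k : ℕ) : Type := {S : Finset (Fin n) // S.card = k}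

/-- A binary rewards vector `x ∈ {0,1}^n`. -/
abbrev Rewards (n : ℕ) : Type := Fin n → Bool

/-- The reward `max_{i ∈ S} x_i` of the set `S` on the rewards vector `x`. -/
def reward {n k : ℕ} (S : KSet n k) (x : Rewards n) : Bool := S.1.sup x

/-- The expected reward `E_ν[max_{i ∈ S} X_i]`. -/
def expReward {n k : ℕ} (ν : PMF (Rewards n)) (S : KSet n k) : ℝ :=
  ∑ x, (ν x).toReal * (if reward S x = true then 1 else 0)

/-- `S` is the unique `k`-set of largest expected reward, i.e. `S = S^*`. -/
def IsBest {n k : ℕ} (ν : PMF (Rewards n)) (S : KSet n k) : Prop :=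
  ∀ S' : KSet n k, S' ≠ S → expReward ν S' < expReward ν S

/-- The difference between the expected reward of `S` and the largest expected reward of the other
`k`-sets; for `S = S^*` this is the gap `Δ` of `ν`. (The supremum is over a finite family, which is
nonempty as soon as `0 < k < n`.) -/
def gap {n k : ℕ} (ν : PMF (Rewards n)) (S : KSet n k) : ℝ :=
  expReward ν S - ⨆ S' : {S' : KSet n k // S' ≠ S}, expReward ν S'.1

/-- A feedback model: the type of observations, and the law of the observation made when `S` is
queried and the rewards vector is `x`. -/
structure Feedback (n k : ℕ) where
  Obs : Type
  channel : KSet n k → Rewards n → PMF Obs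

/-- Bandit feedback: the player observes `max_{i ∈ S} x_i`. -/
def bandit (n k : ℕ) : Feedback n k where
  Obs := Bool
  channel S x := PMF.pure (reward S x)

/-- The arms of `S` whose reward is `1`; if there are any, this is `argmax_{i ∈ S} x_i`. -/
def ones {n k : ℕ} (S : KSet n k) (x : Rewards n) : Finset (Fin n) :=
  S.1.filter fun i => x i = true

open Classical in
/-- Marked-bandit feedback: the player observes an arm drawn uniformly from `argmax_{i ∈ S} x_i`
if some arm of `S` has reward `1`, and otherwise nothing (`none`). -/
def markedBandit (n k : ℕ) : Feedback n k where
  Obs := Option (Fin n)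
  channel S x :=
    if h : (ones S x).Nonempty then (PMF.uniformOfFinset (ones S x) h).map some
    else PMF.pure none

/-- Semi-bandit feedback: the player observes `x_i` for every `i ∈ S`. -/
def semiBandit (n k : ℕ) : Feedback n k where
  Obs := Fin n → Option Bool
  channel S x := PMF.pure fun i => if i ∈ S.1 then some (x i) else none

/-- The past queries with the observations that they returned, most recent first. -/
abbrev History {n k : ℕ} (F : Feedback n k) : Type := List (KSet n k × F.Obs)

/-- What the player does next: query a `k`-set, or stop and return a `k`-set. -/
inductive Action (n k : ℕ) : Type
  | query (S : KSet n k)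
  | answer (S : KSet n k)

/-- A (possibly randomized) sequential algorithm: the law of the next action given the history. -/
abbrev Algorithm {n k : ℕ} (F : Feedback n k) : Type := History F → PMF (Action n k)

/-- The state of the game: still running, or stopped with an answer. -/
inductive GameState {n k : ℕ} (F : Feedback n k) : Type
  | running (h : History F)
  | stopped (h : History F) (S : KSet n k)

instance {n k : ℕ} (F : Feedback n k) : MeasurableSpace (GameState F) := ⊤

instance {n k : ℕ} (F : Feedback n k) : DiscreteMeasurableSpace (GameState F) :=
  ⟨fun _ => trivial⟩

/-- The history of a state of the game. -/
def GameState.history {n k : ℕ} {F : Feedback n k} : GameState F → History F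
  | .running h => h
  | .stopped h _ => h

/-- The law of the observation when `S` is queried: a fresh rewards vector is drawn from `ν`. -/
def obsLaw {n k : ℕ} (F : Feedback n k) (ν : PMF (Rewards n)) (S : KSet n k) : PMF F.Obs :=
  ν.bind fun x => F.channel S x

/-- One round of the game: the player acts, and if the action is a query, observes the feedback. -/
def step {n k : ℕ} {F : Feedback n k} (ν : PMF (Rewards n)) (A : Algorithm F) :
    GameState F → PMF (GameState F)
  | .running h => (A h).bind fun a =>
      match a with
      | .query S => (obsLaw F ν S).map fun o => .running ((S, o) :: h)
      | .answer S => PMF.pure (.stopped h S)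
  | .stopped h S => PMF.pure (.stopped h S)

/-- The transition kernel of one round. -/
def stepKernel {n k : ℕ} {F : Feedback n k} (ν : PMF (Rewards n)) (A : Algorithm F) :
    Kernel (GameState F) (GameState F) where
  toFun s := (step ν A s).toMeasure
  measurable' := measurable_from_top

instance {n k : ℕ} {F : Feedback n k} (ν : PMF (Rewards n)) (A : Algorithm F) :
    IsMarkovKernel (stepKernel ν A) :=
  ⟨fun s => inferInstanceAs (IsProbabilityMeasure (step ν A s).toMeasure)⟩

/-- The transition kernel from the trajectory up to time `t` to the state at time `t + 1`. -/
def trajKernel {n k : ℕ} {F : Feedback n k} (ν : PMF (Rewards n)) (A : Algorithm F) (t : ℕ) :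
    Kernel ((_ : Finset.Iic t) → GameState F) (GameState F) :=
  (stepKernel ν A).comap (fun s => s ⟨t, Finset.mem_Iic.2 le_rfl⟩) (measurable_pi_apply _)

instance {n k : ℕ} {F : Feedback n k} (ν : PMF (Rewards n)) (A : Algorithm F) (t : ℕ) :
    IsMarkovKernel (trajKernel ν A t) :=
  inferInstanceAs (IsMarkovKernel ((stepKernel ν A).comap _ _))

/-- The law of the whole (infinite) game in which `A` plays against i.i.d. rewards from `ν`, with
the empty history at time `0`. -/
def gameLaw {n k : ℕ} {F : Feedback n k} (ν : PMF (Rewards n)) (A : Algorithm F) :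
    Measure (ℕ → GameState F) :=
  Kernel.trajMeasure (X := fun _ => GameState F) (Measure.dirac (.running [])) (trajKernel ν A)

/-- The event that the algorithm stops and returns `S`. -/
def returns {n k : ℕ} {F : Feedback n k} (S : KSet n k) : Set (ℕ → GameState F) :=
  {ω | ∃ t h, ω t = .stopped h S}

/-- The total number of observations made in the course of the game, `∞` if the algorithm queries
forever. -/
def numObs {n k : ℕ} {F : Feedback n k} (ω : ℕ → GameState F) : ℝ≥0∞ :=
  ⨆ t, ((ω t).history.length : ℝ≥0∞)

/-- The expected number of observations that `A` makes under `ν`. -/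
def expObs {n k : ℕ} {F : Feedback n k} (ν : PMF (Rewards n)) (A : Algorithm F) : ℝ≥0∞ :=
  ∫⁻ ω, numObs ω ∂(gameLaw ν A)

/-- `A` identifies the best `k`-set with probability at least `1 - δ`, under every distribution on
`{0,1}^n` that has a unique best `k`-set. -/
def Identifies {n k : ℕ} {F : Feedback n k} (A : Algorithm F) (δ : ℝ) : Prop :=
  ∀ (ν : PMF (Rewards n)) (S : KSet n k), IsBest ν S →
    ENNReal.ofReal (1 - δ) ≤ gameLaw ν A (returns S)

/-- Under `ν`, every algorithm with feedback `F` that identifies the best `k`-set with probability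
at least `1 - δ` makes at least `N` observations in expectation. -/
def RequiresObs {n k : ℕ} (F : Feedback n k) (ν : PMF (Rewards n)) (δ N : ℝ) : Prop :=
  ∀ A : Algorithm F, Identifies A δ → ENNReal.ofReal N ≤ expObs ν A

end BestOfK

end

noncomputable section

namespace BestOfK

/-! ### The transition operator of the game, acting on real functions of the state -/

section Operators

/-! The proof is a change of measure against alternatives in which two sets tie for the best. Such
an alternative is a limit of distributions in which either of the tied sets is the unique best one.
So, at any fixed time, a `δ`-correct algorithm has given an answer other than the first set with
probability at most `δ`, and likewise for the second; hence it has stopped with probability at most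
`2 * δ` (`evolve_stoppedInd_le`). Under the hard distribution an algorithm with finitely many
expected observations stops almost surely. The difference costs relative entropy `log (1 / (2 *
δ))`, and by the chain rule (`evolve_iterate_log_le`) this is paid by the one-query relative
entropies. Averaging over a weighted family of alternatives gives `requiresObs_of_alternatives`: if
the weighted relative entropies of every single query sum to at most `K`, the expected number of
observations is at least the total weight over `K`, times the logarithm.

The hard distributions hide the best set in a parity. The density of fair bits is multiplied by `1 -
e * chi A`, where `A` is the best set. A query that misses an arm of `A` averages the character to
zero, while on the vectors that vanish on `A` the character is `1`, so the reward of `A` alone goes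
up. The alternative for another set `S` also subtracts `e * chi S`; the alternative for the best set
itself removes its character. The query `S` is then the main source of information on the
alternative for `S`, whence the factor `n.choose k`. If `2 * e > 1`, the density would be negative
where both characters are `1`; a term with coefficient `c ≥ 2 * e - 1` on the character of the
symmetric difference repairs this, but is visible to every query that contains that difference.

Relative entropies are bounded by a sum of chi-square type (`klBound_of_sum_le`). For marked
feedback, writing the reciprocal number of ones as the integral of a power turns the law of the mark
into integrals of products (`obsSum_markedBandit_some`). Bandit feedback is a function of the mark
and inherits the bound (`KLBound.of_map`).

What remains is the choice of parameters in terms of `D`, the gap times `2 ^ k`. For `D ≤ 9 / 20`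
one can take `e ≤ 1 / 2` and `c = 0`. For larger `D` there are three regimes. If `k ≤ 3`, only
differences on two arms matter, and few alternatives have one inside a given query. If `k ≥ 4` and
`2 * k ≤ n`, the weight `farWeight` keeps the alternatives that share at most half of their arms
with the best set, so a query contains at most one difference. If `k ≥ 4` and `n < 2 * k`, one or
two arms `G` are forced into all the best sets by mass on vectors with a single one; for given `w`
and `e` each such arm doubles the gap, so that `e ≤ 1 / 2` and `c = 0` are possible again
(`banditHardFor_of_partial`), and the semi-bandit bound follows from a single alternative
(`hardFor_of_mix`). -/

instance (n k : ℕ) : Fintype (Action n k) :=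
  Fintype.ofEquiv (KSet n k ⊕ KSet n k)
    { toFun := fun x => x.elim .query .answer
      invFun := fun a => match a with
        | .query S => .inl S
        | .answer S => .inr S
      left_inv := by rintro (S | S) <;> rfl
      right_inv := by rintro (S | S) <;> rfl }

instance {n k : ℕ} (F : Feedback n k) [Finite F.Obs] : Countable (GameState F) := by
  let f : GameState F → History F ⊕ (History F × KSet n k) := fun s => match s with
    | .running h => .inl h
    | .stopped h S => .inr (h, S)
  have hf : Function.Injective f := by
    rintro (h | ⟨h, S⟩) (h' | ⟨h', S'⟩) H <;> simp_all [f]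
  exact hf.countable

lemma sum_toReal_pmf {α : Type*} [Fintype α] (p : PMF α) : ∑ a, (p a).toReal = 1 := by
  have h := p.tsum_coe
  rw [tsum_fintype] at h
  rw [← ENNReal.toReal_sum (fun a _ => p.apply_ne_top a), h, ENNReal.toReal_one]

lemma tsum_pmf_bind_mul {α β : Type*} (p : PMF α) (f : α → PMF β) (g : β → ℝ≥0∞) :
    ∑' b, p.bind f b * g b = ∑' a, p a * ∑' b, f a b * g b := by
  simp_rw [PMF.bind_apply, ← ENNReal.tsum_mul_right, ← ENNReal.tsum_mul_left]
  rw [ENNReal.tsum_comm]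
  simp_rw [mul_assoc]

lemma tsum_pmf_pure_mul {β : Type*} (b : β) (g : β → ℝ≥0∞) :
    ∑' b', PMF.pure b b' * g b' = g b := by
  rw [tsum_eq_single b]
  · simp
  · intro b' hb'
    simp [PMF.pure_apply_of_ne _ _ hb']

lemma tsum_pmf_map_mul {α β : Type*} (p : PMF α) (f : α → β) (g : β → ℝ≥0∞) :
    ∑' b, p.map f b * g b = ∑' a, p a * g (f a) := by
  rw [← PMF.bind_pure_comp, tsum_pmf_bind_mul]
  simp

variable {n k : ℕ} {F : Feedback n k}

/-- The probability, as a real number, of the observation `o` when `S` is queried. -/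
def obsProb (F : Feedback n k) (ν : PMF (Rewards n)) (S : KSet n k) (o : F.Obs) : ℝ :=
  ∑ x, (ν x).toReal * (F.channel S x o).toReal

lemma toReal_obsLaw (ν : PMF (Rewards n)) (S : KSet n k) (o : F.Obs) :
    (obsLaw F ν S o).toReal = obsProb F ν S o := by
  rw [obsLaw, PMF.bind_apply, tsum_fintype, ENNReal.toReal_sum]
  · simp [obsProb, ENNReal.toReal_mul]
  · exact fun x _ => ENNReal.mul_ne_top (PMF.apply_ne_top _ _) (PMF.apply_ne_top _ _)

lemma obsProb_nonneg (ν : PMF (Rewards n)) (S : KSet n k) (o : F.Obs) : 0 ≤ obsProb F ν S o :=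
  Finset.sum_nonneg fun _ _ => by positivity

lemma sum_obsProb [Fintype F.Obs] (ν : PMF (Rewards n)) (S : KSet n k) :
    ∑ o, obsProb F ν S o = 1 := by
  simp_rw [← toReal_obsLaw]
  exact sum_toReal_pmf _

variable [Fintype F.Obs]

/-- The expectation of `φ` after the given action in a running game with history `h`. -/
def actionValue (ν : PMF (Rewards n)) (φ : GameState F → ℝ) (h : History F) : Action n k → ℝ
  | .query S => ∑ o, obsProb F ν S o * φ (.running ((S, o) :: h))
  | .answer S => φ (.stopped h S)

/-- The expectation of `φ` after one round. -/
def evolve (ν : PMF (Rewards n)) (A : Algorithm F) (φ : GameState F → ℝ) : GameState F → ℝ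
  | .running h => ∑ a, (A h a).toReal * actionValue ν φ h a
  | .stopped h S => φ (.stopped h S)

variable (ν : PMF (Rewards n)) (A : Algorithm F)

lemma actionValue_mono {φ ψ : GameState F → ℝ} (h : ∀ s, φ s ≤ ψ s) (l : History F)
    (a : Action n k) : actionValue ν φ l a ≤ actionValue ν ψ l a := by
  cases a with
  | query S => exact Finset.sum_le_sum fun o _ => mul_le_mul_of_nonneg_left (h _) (obsProb_nonneg _ _ _)
  | answer S => exact h _

lemma evolve_mono {φ ψ : GameState F → ℝ} (h : ∀ s, φ s ≤ ψ s) (s : GameState F) :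
    evolve ν A φ s ≤ evolve ν A ψ s := by
  cases s with
  | running l =>
    exact Finset.sum_le_sum fun a _ =>
      mul_le_mul_of_nonneg_left (actionValue_mono ν h l a) ENNReal.toReal_nonneg
  | stopped l S => exact h _

lemma actionValue_const (c : ℝ) (l : History F) (a : Action n k) :
    actionValue ν (fun _ : GameState F => c) l a = c := by
  cases a with
  | query S => simp [actionValue, ← Finset.sum_mul, sum_obsProb]
  | answer S => rfl

lemma evolve_const (c : ℝ) : evolve ν A (fun _ => c) = fun _ => c := by
  ext s
  cases s with
  | running l => simp [evolve, actionValue_const, ← Finset.sum_mul, sum_toReal_pmf]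
  | stopped l S => rfl

lemma actionValue_add (φ ψ : GameState F → ℝ) (l : History F) (a : Action n k) :
    actionValue ν (fun s => φ s + ψ s) l a = actionValue ν φ l a + actionValue ν ψ l a := by
  cases a with
  | query S => simp [actionValue, mul_add, Finset.sum_add_distrib]
  | answer S => rfl

lemma actionValue_mul (c : ℝ) (φ : GameState F → ℝ) (l : History F) (a : Action n k) :
    actionValue ν (fun s => c * φ s) l a = c * actionValue ν φ l a := by
  cases a with
  | query S =>
    simp only [actionValue, Finset.mul_sum]
    exact Finset.sum_congr rfl fun _ _ => by ring
  | answer S => rfl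

lemma evolve_add (φ ψ : GameState F → ℝ) :
    evolve ν A (fun s => φ s + ψ s) = fun s => evolve ν A φ s + evolve ν A ψ s := by
  ext s
  cases s with
  | running l => simp [evolve, actionValue_add, mul_add, Finset.sum_add_distrib]
  | stopped l S => rfl

lemma evolve_mul (c : ℝ) (φ : GameState F → ℝ) :
    evolve ν A (fun s => c * φ s) = fun s => c * evolve ν A φ s := by
  ext s
  cases s with
  | running l =>
    simp only [evolve, actionValue_mul, Finset.mul_sum]
    exact Finset.sum_congr rfl fun _ _ => by ring
  | stopped l S => rfl

lemma evolve_iterate_mono {φ ψ : GameState F → ℝ} (h : ∀ s, φ s ≤ ψ s) (T : ℕ) (s : GameState F) :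
    (evolve ν A)^[T] φ s ≤ (evolve ν A)^[T] ψ s := by
  induction T generalizing s with
  | zero => exact h s
  | succ T ih =>
    rw [Function.iterate_succ_apply', Function.iterate_succ_apply']
    exact evolve_mono ν A ih s

lemma evolve_iterate_const (c : ℝ) (T : ℕ) : (evolve ν A)^[T] (fun _ => c) = fun _ => c := by
  induction T with
  | zero => rfl
  | succ T ih => rw [Function.iterate_succ_apply', ih, evolve_const]

lemma evolve_iterate_add (φ ψ : GameState F → ℝ) (T : ℕ) :
    (evolve ν A)^[T] (fun s => φ s + ψ s) =
      fun s => (evolve ν A)^[T] φ s + (evolve ν A)^[T] ψ s := by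
  induction T with
  | zero => rfl
  | succ T ih => simp only [Function.iterate_succ_apply', ih, evolve_add]

lemma evolve_iterate_mul (c : ℝ) (φ : GameState F → ℝ) (T : ℕ) :
    (evolve ν A)^[T] (fun s => c * φ s) = fun s => c * (evolve ν A)^[T] φ s := by
  induction T with
  | zero => rfl
  | succ T ih => simp only [Function.iterate_succ_apply', ih, evolve_mul]

lemma evolve_iterate_nonneg {φ : GameState F → ℝ} (h : ∀ s, 0 ≤ φ s) (T : ℕ) (s : GameState F) :
    0 ≤ (evolve ν A)^[T] φ s := by
  simpa [evolve_iterate_const] using evolve_iterate_mono ν A h T s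

lemma evolve_nonneg {φ : GameState F → ℝ} (h : ∀ s, 0 ≤ φ s) (s : GameState F) :
    0 ≤ evolve ν A φ s := evolve_iterate_nonneg ν A h 1 s

lemma evolve_iterate_pos {φ : GameState F → ℝ} (h : ∀ s, 1 ≤ φ s) (T : ℕ) (s : GameState F) :
    0 < (evolve ν A)^[T] φ s :=
  zero_lt_one.trans_le (by simpa [evolve_iterate_const] using evolve_iterate_mono ν A h T s)

lemma evolve_iterate_sum {ι : Type*} (I : Finset ι) (φ : ι → GameState F → ℝ) (T : ℕ) :
    (evolve ν A)^[T] (fun s => ∑ i ∈ I, φ i s) = fun s => ∑ i ∈ I, (evolve ν A)^[T] (φ i) s := by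
  classical
  induction I using Finset.induction_on with
  | empty => simpa using evolve_iterate_const ν A 0 T
  | insert i I hi ih => simp only [Finset.sum_insert hi, evolve_iterate_add, ih]

end Operators

/-! ### The law of the game in terms of the transition operator -/

section Law

variable {n k : ℕ} {F : Feedback n k} [Fintype F.Obs] (ν : PMF (Rewards n)) (A : Algorithm F)

lemma lintegral_step {φ : GameState F → ℝ} (hφ : ∀ s, 0 ≤ φ s) (s : GameState F) :
    ∫⁻ s', ENNReal.ofReal (φ s') ∂(stepKernel ν A s) = ENNReal.ofReal (evolve ν A φ s) := by
  change ∫⁻ s', ENNReal.ofReal (φ s') ∂(step ν A s).toMeasure = _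
  rw [lintegral_countable']
  simp_rw [PMF.toMeasure_apply_singleton _ _ (measurableSet_singleton _), mul_comm (ENNReal.ofReal _)]
  cases s with
  | stopped l S => exact tsum_pmf_pure_mul _ _
  | running l =>
    rw [step, tsum_pmf_bind_mul, tsum_fintype, evolve, ENNReal.ofReal_sum_of_nonneg]
    · refine Finset.sum_congr rfl fun a _ => ?_
      rw [ENNReal.ofReal_mul ENNReal.toReal_nonneg, ENNReal.ofReal_toReal (PMF.apply_ne_top _ _)]
      congr 1
      cases a with
      | answer S => exact tsum_pmf_pure_mul _ _
      | query S =>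
        simp only [tsum_pmf_map_mul, tsum_fintype, actionValue]
        rw [ENNReal.ofReal_sum_of_nonneg fun o _ => mul_nonneg (obsProb_nonneg _ _ _) (hφ _)]
        refine Finset.sum_congr rfl fun o _ => ?_
        rw [ENNReal.ofReal_mul (obsProb_nonneg _ _ _), ← toReal_obsLaw,
          ENNReal.ofReal_toReal (PMF.apply_ne_top _ _)]
    · intro a _
      have h := actionValue_mono ν hφ l a
      rw [actionValue_const] at h
      exact mul_nonneg ENNReal.toReal_nonneg h

instance : IsProbabilityMeasure (gameLaw ν A) := by
  unfold gameLaw; infer_instance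

/-- The Markov property: the trajectory up to time `t`, composed with `trajKernel`, has the law of
the trajectory up to `t + 1`, and this kernel reads only the last coordinate. -/
lemma lintegral_gameLaw_succ {f : GameState F × GameState F → ℝ≥0∞} (t : ℕ) :
    ∫⁻ ω, f (ω t, ω (t + 1)) ∂(gameLaw ν A) =
      ∫⁻ ω, ∫⁻ s, f (ω t, s) ∂(stepKernel ν A (ω t)) ∂(gameLaw ν A) := by
  have key := Kernel.map_frestrictLe_trajMeasure_compProd_eq_map_trajMeasure
    (X := fun _ => GameState F) (μ₀ := Measure.dirac (.running [])) (κ := trajKernel ν A) (a := t)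
  set g : ((_ : Finset.Iic t) → GameState F) × GameState F → ℝ≥0∞ :=
    fun p => f (p.1 ⟨t, Finset.mem_Iic.2 le_rfl⟩, p.2) with hg
  have hgm : Measurable g := by
    have hf : Measurable f := measurable_from_prod_countable_right fun _ => measurable_from_top
    exact hf.comp (((measurable_pi_apply _).comp measurable_fst).prodMk measurable_snd)
  have h1 := congrArg (fun m => ∫⁻ p, g p ∂m) key
  rw [Measure.lintegral_compProd hgm, lintegral_map hgm (by fun_prop),
    lintegral_map (hgm.lintegral_kernel_prod_right' ) (by fun_prop)] at h1
  exact h1.symm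

lemma gameLaw_zero : ∀ᵐ ω ∂(gameLaw ν A), ω 0 = .running [] := by
  let X : ℕ → Type := fun _ => GameState F
  let e := (MeasurableEquiv.piUnique fun i : Finset.Iic 0 => X i).symm
  have key : (gameLaw ν A).map (Preorder.frestrictLe (π := X) 0) =
      (Measure.dirac (.running [])).map e := by
    rw [gameLaw, Kernel.trajMeasure, Measure.map_comp _ _ (by fun_prop),
      Kernel.traj_map_frestrictLe, Kernel.partialTraj_self, Measure.id_comp]
  have h : ∀ᵐ x ∂((gameLaw ν A).map (Preorder.frestrictLe (π := X) 0)),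
      x ⟨0, Finset.mem_Iic.2 le_rfl⟩ = .running [] := by
    rw [key]
    refine (ae_map_iff e.measurable.aemeasurable
      ((measurable_pi_apply _) (measurableSet_singleton _))).2 ?_
    exact (ae_dirac_iff (α := GameState F) (MeasurableSet.of_discrete)).2 rfl
  exact ae_of_ae_map (by fun_prop) h

/-- The bridge to the finite sums: afterwards the trajectory measure is needed only to interpret
`returns` and `expObs`, and everything else is about iterates of `evolve` at the initial state. -/
lemma lintegral_gameLaw {φ : GameState F → ℝ} (hφ : ∀ s, 0 ≤ φ s) (t : ℕ) :
    ∫⁻ ω, ENNReal.ofReal (φ (ω t)) ∂(gameLaw ν A) =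
      ENNReal.ofReal ((evolve ν A)^[t] φ (.running [])) := by
  induction t generalizing φ with
  | zero =>
    rw [lintegral_congr_ae (g := fun _ => ENNReal.ofReal (φ (.running [])))]
    · simp
    · filter_upwards [gameLaw_zero ν A] with ω h
      rw [h]
  | succ t ih =>
    rw [lintegral_gameLaw_succ ν A (f := fun p => ENNReal.ofReal (φ p.2)), Function.iterate_succ_apply,
      ← ih (evolve_nonneg ν A hφ)]
    simp_rw [lintegral_step ν A hφ]

/-- At each time the indicator of leaving a stopped state has integral zero, and there are countably
many times. -/
lemma gameLaw_stopped : ∀ᵐ ω ∂(gameLaw ν A), ∀ t h S, ω t = .stopped h S →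
    ∀ t', t ≤ t' → ω t' = .stopped h S := by
  classical
  have h1 : ∀ t, ∀ᵐ ω ∂(gameLaw ν A), ∀ h S, ω t = .stopped h S → ω (t + 1) = .stopped h S := by
    intro t
    set f : GameState F × GameState F → ℝ≥0∞ :=
      fun p => if ∃ h S, p.1 = .stopped h S ∧ p.2 ≠ .stopped h S then 1 else 0 with hf
    have hfm : Measurable f := measurable_from_prod_countable_right fun _ => measurable_from_top
    have h0 : ∫⁻ ω, f (ω t, ω (t + 1)) ∂(gameLaw ν A) = 0 := by
      rw [lintegral_gameLaw_succ]
      refine (lintegral_congr fun ω => ?_).trans lintegral_zero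
      change ∫⁻ s, f (ω t, s) ∂(step ν A (ω t)).toMeasure = 0
      rw [lintegral_countable']
      refine ENNReal.tsum_eq_zero.2 fun s => ?_
      rw [PMF.toMeasure_apply_singleton _ _ (measurableSet_singleton _)]
      rcases hω : ω t with l | ⟨l, S⟩
      · simp [hf]
      · rw [step]
        by_cases hs : s = .stopped l S
        · subst hs; simp [hf]
        · rw [PMF.pure_apply_of_ne _ _ hs, mul_zero]
    have hm : Measurable fun ω : ℕ → GameState F => f (ω t, ω (t + 1)) :=
      hfm.comp ((measurable_pi_apply t).prodMk (measurable_pi_apply (t + 1)))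
    rw [lintegral_eq_zero_iff hm] at h0
    filter_upwards [h0] with ω hω l S hl
    by_contra hne
    have : f (ω t, ω (t + 1)) = 1 := if_pos ⟨l, S, hl, hne⟩
    simp [this] at hω
  rw [← ae_all_iff] at h1
  filter_upwards [h1] with ω hω t l S hl t' ht'
  induction t', ht' using Nat.le_induction with
  | base => exact hl
  | succ t' _ ih => exact hω t' l S ih

end Law

/-- An upper bound `κ` on the relative entropy of `p` with respect to `q`, in the variational form
of Donsker and Varadhan. -/
def KLBound {α : Type*} [Fintype α] (p q : α → ℝ) (κ : ℝ) : Prop :=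
  ∀ g : α → ℝ, (∀ a, 0 < g a) → ∑ a, p a * Real.log (g a) ≤ κ + Real.log (∑ a, q a * g a)

/-! ### Distributions with real weights and their mixtures -/

section Mixture

/-- The distribution with the given real weights. -/
def pmfOfReal {α : Type*} [Fintype α] (f : α → ℝ) (h0 : ∀ a, 0 ≤ f a) (h1 : ∑ a, f a = 1) : PMF α :=
  PMF.ofFintype (fun a => ENNReal.ofReal (f a)) (by
    rw [← ENNReal.ofReal_sum_of_nonneg fun a _ => h0 a, h1, ENNReal.ofReal_one])

lemma toReal_pmfOfReal {α : Type*} [Fintype α] (f : α → ℝ) (h0 : ∀ a, 0 ≤ f a)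
    (h1 : ∑ a, f a = 1) (a : α) : (pmfOfReal f h0 h1 a).toReal = f a := by
  rw [pmfOfReal, PMF.ofFintype_apply, ENNReal.toReal_ofReal (h0 a)]

/-- The mixture `(1 - η) p + η q`. -/
def mix {α : Type*} [Fintype α] (η : ℝ) (h0 : 0 ≤ η) (h1 : η ≤ 1) (p q : PMF α) : PMF α :=
  pmfOfReal (fun a => (1 - η) * (p a).toReal + η * (q a).toReal)
    (fun a => by
      have := sub_nonneg.2 h1
      positivity)
    (by simp [Finset.sum_add_distrib, ← Finset.mul_sum, sum_toReal_pmf])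

lemma toReal_mix {α : Type*} [Fintype α] (η : ℝ) (h0 : 0 ≤ η) (h1 : η ≤ 1) (p q : PMF α) (a : α) :
    (mix η h0 h1 p q a).toReal = (1 - η) * (p a).toReal + η * (q a).toReal :=
  toReal_pmfOfReal _ _ _ _

end Mixture

/-! ### Rewards under mixtures and under vectors with a single one -/

section Rewards

variable {n k : ℕ}

lemma reward_eq_true {S : KSet n k} {x : Rewards n} : reward S x = true ↔ ∃ i ∈ S.1, x i = true := by
  rw [reward]
  constructor
  · intro h
    by_contra! hc
    have : S.1.sup x ≤ false := Finset.sup_le fun i hi => by simp [Bool.eq_false_iff.2 (hc i hi)]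
    rw [h] at this
    exact absurd this (by decide)
  · rintro ⟨i, hi, hx⟩
    have : x i ≤ S.1.sup x := Finset.le_sup hi
    rw [hx] at this
    exact top_le_iff.1 this

/-- The rewards vector whose only `1` is at `i`. -/
def single (i : Fin n) : Rewards n := fun j => decide (j = i)

lemma reward_single {S : KSet n k} {i : Fin n} : reward S (single i) = true ↔ i ∈ S.1 := by
  simp [reward_eq_true, single]

lemma expReward_mix (η : ℝ) (h0 : 0 ≤ η) (h1 : η ≤ 1) (p q : PMF (Rewards n)) (S : KSet n k) :
    expReward (mix η h0 h1 p q) S = (1 - η) * expReward p S + η * expReward q S := by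
  simp only [expReward, toReal_mix, add_mul, Finset.sum_add_distrib, Finset.mul_sum, mul_assoc]

lemma obsProb_mix (F : Feedback n k) (η : ℝ) (h0 : 0 ≤ η) (h1 : η ≤ 1) (p q : PMF (Rewards n))
    (S : KSet n k) (o : F.Obs) :
    obsProb F (mix η h0 h1 p q) S o = (1 - η) * obsProb F p S o + η * obsProb F q S o := by
  simp only [obsProb, toReal_mix, add_mul, Finset.sum_add_distrib, Finset.mul_sum, mul_assoc]

/-- Every `k`-set is the unique best one for some distribution. -/
lemma exists_isBest (hk : 0 < k) (S : KSet n k) : ∃ ρ : PMF (Rewards n), IsBest ρ S := by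
  classical
  have hc : (k : ℝ) ≠ 0 := by positivity
  have hs : ∀ φ : Rewards n → ℝ,
      ∑ x, (∑ i ∈ S.1, if x = single i then (k : ℝ)⁻¹ else 0) * φ x
        = (k : ℝ)⁻¹ * ∑ i ∈ S.1, φ (single i) := by
    intro φ
    simp_rw [Finset.sum_mul, Finset.mul_sum]
    rw [Finset.sum_comm]
    simp
  -- Uniform on the vectors whose single one lies in `S`: the reward of `S'` is then the proportion
  -- of `S` inside `S'`.
  refine ⟨pmfOfReal (fun x => ∑ i ∈ S.1, if x = single i then (k : ℝ)⁻¹ else 0)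
    (fun x => Finset.sum_nonneg fun i _ => by positivity) ?_, ?_⟩
  · have := hs fun _ => 1
    simp only [mul_one] at this
    rw [this]
    simp [S.2, hc]
  · have hr : ∀ S' : KSet n k, expReward (pmfOfReal (fun x => ∑ i ∈ S.1, if x = single i then
        (k : ℝ)⁻¹ else 0) (fun x => Finset.sum_nonneg fun i _ => by positivity) (by
          have := hs fun _ => 1
          simp only [mul_one] at this
          rw [this]
          simp [S.2, hc])) S' = (k : ℝ)⁻¹ * ((S.1 ∩ S'.1).card : ℝ) := by
      intro S'
      simp only [expReward, toReal_pmfOfReal]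
      rw [hs, ← Finset.filter_mem_eq_inter, Finset.card_filter]
      simp only [reward_single]
      push_cast
      rfl
    intro S' hS'
    rw [hr, hr]
    have hlt : (S.1 ∩ S'.1).card < (S.1 ∩ S.1).card := by
      rw [Finset.inter_self]
      refine Finset.card_lt_card ⟨Finset.inter_subset_left, fun h => hS' ?_⟩
      have h2 : S.1 ⊆ S'.1 := h.trans Finset.inter_subset_right
      exact (Subtype.ext (Finset.eq_of_subset_of_card_le h2 (by rw [S.2, S'.2]))).symm
    have : (0 : ℝ) < (k : ℝ)⁻¹ := by positivity
    exact mul_lt_mul_of_pos_left (by exact_mod_cast hlt) this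

end Rewards

/-! ### Change of measure and the general lower bound -/

section Game

open Filter Topology

variable {n k : ℕ} {F : Feedback n k}

/-- The sum of `κ` over the queries made so far. -/
def cost (κ : KSet n k → ℝ) (s : GameState F) : ℝ := (s.history.map fun p => κ p.1).sum

/-- The indicator of having stopped. -/
def stoppedInd : GameState F → ℝ
  | .running _ => 0
  | .stopped _ _ => 1

open Classical in
/-- The indicator of having stopped with an answer other than `S`. -/
def wrongInd (S : KSet n k) : GameState F → ℝ
  | .running _ => 0
  | .stopped _ S' => if S' = S then 0 else 1

lemma wrongInd_nonneg (S : KSet n k) (s : GameState F) : 0 ≤ wrongInd S s := by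
  cases s with
  | running l => exact le_rfl
  | stopped l S' => simp only [wrongInd]; split_ifs <;> norm_num

lemma stoppedInd_nonneg (s : GameState F) : 0 ≤ stoppedInd s := by
  cases s <;> simp [stoppedInd]

variable [Fintype F.Obs] (ν : PMF (Rewards n)) (A : Algorithm F)

/-- One round of the chain rule. The action has the same law under `ν` and `ν'`, so concavity of the
logarithm carries the estimate through it; a query then pays its `κ S` by the variational
inequality, with `f` at the next state as test function. -/
lemma evolve_log_le {ν' : PMF (Rewards n)} {κ : KSet n k → ℝ}
    (h : ∀ S, KLBound (obsProb F ν S) (obsProb F ν' S) (κ S)) {f : GameState F → ℝ}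
    (hf : ∀ s, 0 < f s) (s : GameState F) :
    evolve ν A (fun s => Real.log (f s)) s ≤
      Real.log (evolve ν' A f s) + (evolve ν A (cost κ) s - cost κ s) := by
  cases s with
  | stopped l S => simp [evolve]
  | running l =>
    have h1 : ∀ a, actionValue ν (fun s => Real.log (f s)) l a ≤
        Real.log (actionValue ν' f l a) + (actionValue ν (cost κ) l a - cost κ (.running l : GameState F)) := by
      intro a
      cases a with
      | answer S => simp [actionValue, cost, GameState.history]
      | query S =>
        have := h S (fun o => f (.running ((S, o) :: l))) fun o => hf _
        have e : actionValue ν (cost κ : GameState F → ℝ) l (.query S) = κ S + cost κ (.running l : GameState F) := by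
          simp only [actionValue, cost, GameState.history, List.map_cons, List.sum_cons, ← Finset.sum_mul, sum_obsProb, one_mul]
        rw [e]
        simp only [actionValue]
        linarith
    have hpos : ∀ a, 0 < actionValue ν' f l a := by
      intro a
      cases a with
      | answer S => exact hf _
      | query S =>
        refine (Finset.sum_nonneg fun o _ => mul_nonneg (obsProb_nonneg _ _ _) (hf _).le).lt_of_ne' ?_
        intro h0
        rw [Finset.sum_eq_zero_iff_of_nonneg fun o _ => mul_nonneg (obsProb_nonneg _ _ _) (hf _).le] at h0
        have : ∑ o, obsProb F ν' S o = 0 := Finset.sum_eq_zero fun o ho =>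
          (mul_eq_zero.1 (h0 o ho)).resolve_right (hf _).ne'
        rw [sum_obsProb] at this
        exact one_ne_zero this
    have hJ := strictConcaveOn_log_Ioi.concaveOn.le_map_sum (t := Finset.univ)
      (w := fun a => (A l a).toReal) (p := fun a => actionValue ν' f l a)
      (fun _ _ => ENNReal.toReal_nonneg) (sum_toReal_pmf _) (fun a _ => hpos a)
    simp only [smul_eq_mul] at hJ
    have e : evolve ν A (cost κ : GameState F → ℝ) (.running l) - cost κ (.running l : GameState F) =
        ∑ a, (A l a).toReal * (actionValue ν (cost κ) l a - cost κ (.running l : GameState F)) := by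
      simp only [mul_sub, Finset.sum_sub_distrib, ← Finset.sum_mul, sum_toReal_pmf, one_mul]
      rfl
    rw [e]
    refine le_trans ?_ (add_le_add_left hJ _)
    rw [← Finset.sum_add_distrib]
    refine Finset.sum_le_sum fun a _ => ?_
    rw [← mul_add]
    exact mul_le_mul_of_nonneg_left (h1 a) ENNReal.toReal_nonneg

/-- The chain rule for `T` rounds in variational form. Subtracting the cost already present in `s`
makes the one-round inequalities telescope. -/
lemma evolve_iterate_log_le {ν' : PMF (Rewards n)} {κ : KSet n k → ℝ}
    (h : ∀ S, KLBound (obsProb F ν S) (obsProb F ν' S) (κ S)) {f : GameState F → ℝ}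
    (hf : ∀ s, 1 ≤ f s) (T : ℕ) (s : GameState F) :
    (evolve ν A)^[T] (fun s => Real.log (f s)) s ≤
      Real.log ((evolve ν' A)^[T] f s) + ((evolve ν A)^[T] (cost κ) s - cost κ s) := by
  induction T generalizing s with
  | zero => simp
  | succ T ih =>
    rw [Function.iterate_succ_apply', Function.iterate_succ_apply', Function.iterate_succ_apply']
    have h1 := evolve_mono ν A ih s
    have e : (fun s => Real.log ((evolve ν' A)^[T] f s) + ((evolve ν A)^[T] (cost κ) s - cost κ s))
        = fun s => Real.log ((evolve ν' A)^[T] f s) +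
          ((evolve ν A)^[T] (cost κ) s + (-1) * cost κ s) := by
      ext; ring
    rw [e, evolve_add, evolve_add, evolve_mul] at h1
    have h2 := evolve_log_le ν A h (evolve_iterate_pos ν' A hf T) s
    linarith

/-- The mixture keeps at least the proportion `1 - η` of each observation probability of `ν`, and in
a round at most one observation is made. -/
lemma mul_evolve_le {η : ℝ} (h0 : 0 ≤ η) (h1 : η ≤ 1) (ρ : PMF (Rewards n))
    {φ : GameState F → ℝ} (hφ : ∀ s, 0 ≤ φ s) (s : GameState F) :
    (1 - η) * evolve ν A φ s ≤ evolve (mix η h0 h1 ν ρ) A φ s := by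
  have h1' : 1 - η ≤ 1 := by linarith
  cases s with
  | stopped l S => exact mul_le_of_le_one_left (hφ _) h1'
  | running l =>
    simp only [evolve, Finset.mul_sum]
    refine Finset.sum_le_sum fun a _ => ?_
    rw [mul_left_comm]
    refine mul_le_mul_of_nonneg_left ?_ ENNReal.toReal_nonneg
    cases a with
    | answer S => exact mul_le_of_le_one_left (hφ _) h1'
    | query S =>
      simp only [actionValue, Finset.mul_sum]
      refine Finset.sum_le_sum fun o _ => ?_
      rw [← mul_assoc]
      refine mul_le_mul_of_nonneg_right ?_ (hφ _)
      rw [obsProb_mix]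
      have := mul_nonneg h0 (obsProb_nonneg ρ S o)
      linarith

lemma pow_mul_evolve_iterate_le {η : ℝ} (h0 : 0 ≤ η) (h1 : η ≤ 1) (ρ : PMF (Rewards n))
    {φ : GameState F → ℝ} (hφ : ∀ s, 0 ≤ φ s) (T : ℕ) (s : GameState F) :
    (1 - η) ^ T * (evolve ν A)^[T] φ s ≤ (evolve (mix η h0 h1 ν ρ) A)^[T] φ s := by
  induction T generalizing s with
  | zero => simp
  | succ T ih =>
    rw [Function.iterate_succ_apply', Function.iterate_succ_apply']
    have h2 := evolve_mono (mix η h0 h1 ν ρ) A ih s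
    rw [evolve_mul] at h2
    have h3 := mul_evolve_le ν A h0 h1 ρ (evolve_iterate_nonneg ν A hφ T) s
    refine le_trans ?_ h2
    rw [pow_succ, mul_assoc]
    exact mul_le_mul_of_nonneg_left h3 (pow_nonneg (sub_nonneg.2 h1) _)

/-- Stopped states are absorbing, so up to a null set the event of having stopped with another
answer at time `T` is disjoint from `returns S`. -/
lemma evolve_wrongInd_le {S : KSet n k} (hS : IsBest ν S) {δ : ℝ}
    (hA : Identifies A δ) (T : ℕ) : (evolve ν A)^[T] (wrongInd S) (.running []) ≤ δ := by
  classical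
  set E : Set (ℕ → GameState F) := {ω | ∃ h S', ω T = .stopped h S' ∧ S' ≠ S} with hE
  have hEm : MeasurableSet E :=
    (measurable_pi_apply (X := fun _ : ℕ => GameState F) T)
      (MeasurableSet.of_discrete (s := {s : GameState F | ∃ h S', s = .stopped h S' ∧ S' ≠ S}))
  have h1 := lintegral_gameLaw ν A (wrongInd_nonneg (F := F) S) T
  have h2 : ∀ ω : ℕ → GameState F, ENNReal.ofReal (wrongInd S (ω T)) = E.indicator 1 ω := by
    intro ω
    rcases hω : ω T with l | ⟨l, S'⟩
    · simp [wrongInd, hE, hω, Set.indicator]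
    · have hiff : ω ∈ E ↔ S' ≠ S := by
        refine ⟨?_, fun h => ⟨l, S', hω, h⟩⟩
        rintro ⟨l', S'', h, hne⟩
        rw [hω] at h
        rwa [(GameState.stopped.inj h).2]
      by_cases hs : S' = S <;> simp [wrongInd, Set.indicator, hiff, hs]
  simp_rw [h2] at h1
  rw [lintegral_indicator_one hEm] at h1
  have hd : AEDisjoint (gameLaw ν A) (returns S) E := by
    refine measure_mono_null (t := {ω | ¬ ∀ t h S, ω t = .stopped h S →
      ∀ t', t ≤ t' → ω t' = .stopped h S}) ?_ (gameLaw_stopped ν A)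
    rintro ω ⟨⟨t, h, ht⟩, h', S', hT, hne⟩ hc
    rcases le_total t T with hle | hle
    · have := hc t h S ht T hle
      rw [hT] at this
      exact hne (GameState.stopped.inj this).2
    · have := hc T h' S' hT t hle
      rw [ht] at this
      exact hne (GameState.stopped.inj this).2.symm
  have h3 := measure_union₀ hEm.nullMeasurableSet hd
  have h4 : gameLaw ν A (returns S) + gameLaw ν A E ≤ 1 := h3 ▸ prob_le_one
  have h5 := (add_le_add_left (hA ν S hS) (gameLaw ν A E)).trans h4
  rw [h1] at h5
  have hx := evolve_iterate_nonneg ν A (wrongInd_nonneg (F := F) S) T (.running [])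
  -- `ENNReal.ofReal` truncates `1 - δ` at zero; for `δ > 1` the claim is only that a probability is
  -- at most `1`.
  by_cases h1δ : δ ≤ 1
  · rw [← ENNReal.ofReal_add (by linarith) hx, ← ENNReal.ofReal_one,
      ENNReal.ofReal_le_ofReal_iff zero_le_one] at h5
    linarith
  · have h6 := le_trans (le_add_self) h5
    rw [← ENNReal.ofReal_one, ENNReal.ofReal_le_ofReal_iff zero_le_one] at h6
    linarith

/-- A small admixture of a distribution with unique best set `S` breaks every tie in favour of `S`,
and changes the probability at the fixed time `T` by a factor not below `(1 - η) ^ T`, which tends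
to `1` with `η → 0`. -/
lemma evolve_wrongInd_le_of_forall_le (hk : 0 < k) {S : KSet n k}
    (hS : ∀ S' : KSet n k, expReward ν S' ≤ expReward ν S) {δ : ℝ} (hA : Identifies A δ) (T : ℕ) :
    (evolve ν A)^[T] (wrongInd S) (.running []) ≤ δ := by
  obtain ⟨ρ, hρ⟩ := exists_isBest hk S
  have h1 : ∀ η ∈ Set.Ioo (0 : ℝ) 1,
      (1 - η) ^ T * (evolve ν A)^[T] (wrongInd S) (.running []) ≤ δ := by
    rintro η ⟨h0, h1⟩
    refine (pow_mul_evolve_iterate_le ν A h0.le h1.le ρ (wrongInd_nonneg S) T _).trans ?_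
    refine evolve_wrongInd_le _ A (fun S' hne => ?_) hA T
    rw [expReward_mix, expReward_mix]
    exact add_lt_add_of_le_of_lt (mul_le_mul_of_nonneg_left (hS S') (by linarith))
      (mul_lt_mul_of_pos_left (hρ S' hne) h0)
  have h2 : Tendsto (fun η : ℝ => (1 - η) ^ T * (evolve ν A)^[T] (wrongInd S) (.running []))
      (𝓝[>] 0) (𝓝 ((1 - 0) ^ T * (evolve ν A)^[T] (wrongInd S) (.running []))) :=
    (Continuous.tendsto (by fun_prop) _).mono_left nhdsWithin_le_nhds
  have h3 := le_of_tendsto h2 (by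
    filter_upwards [Ioo_mem_nhdsGT zero_lt_one] with η hη using h1 η hη)
  simpa using h3

/-- Every answer differs from at least one of the two tied sets. This is the source of `2 * δ` in
the theorem. -/
lemma evolve_stoppedInd_le (hk : 0 < k) {S₁ S₂ : KSet n k} (hne : S₁ ≠ S₂)
    (h₁ : ∀ S' : KSet n k, expReward ν S' ≤ expReward ν S₁)
    (h₂ : ∀ S' : KSet n k, expReward ν S' ≤ expReward ν S₂)
    {δ : ℝ} (hA : Identifies A δ) (T : ℕ) :
    (evolve ν A)^[T] stoppedInd (.running []) ≤ 2 * δ := by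
  have h : ∀ s : GameState F, stoppedInd s ≤ wrongInd S₁ s + wrongInd S₂ s := by
    intro s
    cases s with
    | running l => simp [stoppedInd, wrongInd]
    | stopped l S =>
      by_cases h1 : S = S₁
      · have : S ≠ S₂ := h1 ▸ hne
        simp [stoppedInd, wrongInd, h1, hne]
      · simp only [stoppedInd, wrongInd, h1, if_false]
        split_ifs <;> norm_num
  have h3 := evolve_iterate_mono ν A h T (.running [])
  rw [evolve_iterate_add] at h3
  have := evolve_wrongInd_le_of_forall_le ν A hk h₁ hA T
  have := evolve_wrongInd_le_of_forall_le ν A hk h₂ hA T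
  linarith

/-- Every round in which the game is still running adds an observation. -/
lemma mul_one_sub_evolve_stoppedInd_le (T : ℕ) (s : GameState F) :
    cost (fun _ => 1) s + T * (1 - (evolve ν A)^[T] stoppedInd s) ≤
      (evolve ν A)^[T] (cost fun _ => 1) s := by
  have hstep : ∀ s : GameState F, cost (fun _ => 1) s + (1 - evolve ν A stoppedInd s) ≤
      evolve ν A (cost fun _ => 1) s := by
    intro s
    cases s with
    | stopped l S => simp [evolve, stoppedInd]
    | running l =>
      have e1 : ∀ a, cost (fun _ => 1) (.running l : GameState F) + (1 - actionValue ν stoppedInd l a)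
          = actionValue ν (cost fun _ => 1 : GameState F → ℝ) l a := by
        intro a
        cases a with
        | answer S => simp [actionValue, stoppedInd, cost, GameState.history]
        | query S =>
          simp [actionValue, stoppedInd, cost, GameState.history, ← Finset.sum_mul, sum_obsProb,
            add_comm]
      have e2 : evolve ν A (cost fun _ => 1 : GameState F → ℝ) (.running l) =
          cost (fun _ => 1) (.running l : GameState F) + (1 - evolve ν A stoppedInd (.running l)) := by
        simp only [evolve, ← e1, mul_add, mul_sub, Finset.sum_add_distrib, Finset.sum_sub_distrib,
          ← Finset.sum_mul, sum_toReal_pmf, one_mul, mul_one]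
      exact e2.ge
  have hmono : ∀ s : GameState F, stoppedInd s ≤ evolve ν A stoppedInd s := by
    intro s
    cases s with
    | stopped l S => exact le_rfl
    | running l => exact evolve_nonneg ν A stoppedInd_nonneg _
  have hle : ∀ s : GameState F, stoppedInd s ≤ 1 := by
    intro s
    cases s <;> simp [stoppedInd]
  induction T generalizing s with
  | zero => simp
  | succ T ih =>
    have h1 := evolve_iterate_mono ν A hstep T s
    rw [evolve_iterate_add] at h1
    have e : (fun s : GameState F => 1 - evolve ν A stoppedInd s) =
      fun s => 1 + (-1) * evolve ν A stoppedInd s := by ext; ring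
    rw [e, evolve_iterate_add, evolve_iterate_mul, evolve_iterate_const,
      ← Function.iterate_succ_apply, ← Function.iterate_succ_apply] at h1
    have h2 := evolve_iterate_mono ν A hmono T s
    rw [← Function.iterate_succ_apply] at h2
    have h3 := ih s
    have hT : (0 : ℝ) ≤ T := Nat.cast_nonneg T
    push_cast
    have h4 := mul_le_mul_of_nonneg_left h2 hT
    linarith

lemma evolve_cost_one_le (T : ℕ) :
    ENNReal.ofReal ((evolve ν A)^[T] (cost fun _ => 1) (.running [])) ≤ expObs ν A := by
  have hc : ∀ s : GameState F, cost (fun _ => 1) s = s.history.length := by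
    intro s
    simp [cost]
  rw [← lintegral_gameLaw ν A (fun s => by rw [hc]; positivity)]
  refine lintegral_mono fun ω => ?_
  rw [hc, ENNReal.ofReal_natCast]
  exact le_iSup (fun t => ((ω t).history.length : ℝ≥0∞)) T

/-- The lower bound from a family of alternatives which an algorithm must tell apart from `ν`. -/
theorem requiresObs_of_alternatives {ι : Type*} (I : Finset ι) (hk : 0 < k)
    (ν' : ι → PMF (Rewards n)) (w : ι → ℝ) (κ : ι → KSet n k → ℝ) {K δ N : ℝ} (hδ : 0 < δ) (hK : 0 < K)
    (hw : ∀ i ∈ I, 0 ≤ w i)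
    (hκ : ∀ i ∈ I, ∀ S, KLBound (obsProb F ν S) (obsProb F (ν' i) S) (κ i S))
    (htie : ∀ i ∈ I, ∃ S₁ S₂ : KSet n k, S₁ ≠ S₂ ∧
      (∀ S' : KSet n k, expReward (ν' i) S' ≤ expReward (ν' i) S₁) ∧
      ∀ S' : KSet n k, expReward (ν' i) S' ≤ expReward (ν' i) S₂)
    (hsum : ∀ S, ∑ i ∈ I, w i * κ i S ≤ K)
    (hN : N ≤ (∑ i ∈ I, w i) / K * Real.log (1 / (2 * δ))) : RequiresObs F ν δ N := by
  intro A hA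
  by_cases htop : expObs ν A = ⊤
  · rw [htop]; exact le_top
  set M := (expObs ν A).toReal with hM
  set W := ∑ i ∈ I, w i with hW
  have hW0 : 0 ≤ W := Finset.sum_nonneg hw
  have hlen : ∀ T, (evolve ν A)^[T] (cost fun _ => 1) (.running []) ≤ M := fun T =>
    (ENNReal.ofReal_le_iff_le_toReal htop).1 (evolve_cost_one_le ν A T)
  set p := fun T : ℕ => (evolve ν A)^[T] stoppedInd (.running []) with hp
  have hp1 : ∀ T : ℕ, (T : ℝ) * (1 - p T) ≤ M := by
    intro T
    have := (mul_one_sub_evolve_stoppedInd_le ν A T (.running [])).trans (hlen T)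
    simpa [cost, GameState.history] using this
  have hcost : ∀ T, ∑ i ∈ I, w i * (evolve ν A)^[T] (cost (κ i)) (.running []) ≤ K * M := by
    intro T
    have h1 : ∀ s : GameState F, ∑ i ∈ I, w i * cost (κ i) s ≤ K * cost (fun _ => 1) s := by
      intro s
      simp only [cost]
      induction s.history with
      | nil => simp
      | cons a l ih =>
        simp only [List.map_cons, List.sum_cons, mul_add, Finset.sum_add_distrib, mul_one]
        exact add_le_add (hsum _) ih
    have h2 := evolve_iterate_mono ν A h1 T (.running [])
    rw [evolve_iterate_sum ν A I (fun i s => w i * cost (κ i) s), evolve_iterate_mul] at h2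
    simp only [evolve_iterate_mul] at h2
    exact h2.trans (mul_le_mul_of_nonneg_left (hlen T) hK.le)
  -- The test function is `1` while the game runs and `exp l` once it has stopped: its logarithm is
  -- `l * stoppedInd`, and the tie bounds its expectation under each alternative.
  have hmain : ∀ l : ℝ, 0 ≤ l → ∀ T, W * (l * p T - Real.log (1 + (Real.exp l - 1) * (2 * δ))) ≤ K * M := by
    intro l hl T
    have hexp : 1 ≤ Real.exp l := Real.one_le_exp hl
    set f : GameState F → ℝ := fun s => 1 + (Real.exp l - 1) * stoppedInd s with hf
    have hf1 : ∀ s, 1 ≤ f s := fun s =>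
      le_add_of_nonneg_right (mul_nonneg (by linarith) (stoppedInd_nonneg s))
    have hlog : (fun s => Real.log (f s)) = fun s => l * stoppedInd s := by
      ext s
      cases s <;> simp [hf, stoppedInd]
    refine le_trans ?_ (hcost T)
    rw [hW, Finset.sum_mul]
    refine Finset.sum_le_sum fun i hi => mul_le_mul_of_nonneg_left ?_ (hw i hi)
    have h1 := evolve_iterate_log_le ν A (hκ i hi) hf1 T (.running [])
    rw [hlog, evolve_iterate_mul] at h1
    have hpos := evolve_iterate_pos (ν' i) A hf1 T (.running [])
    have e : (evolve (ν' i) A)^[T] f (.running []) =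
        1 + (Real.exp l - 1) * (evolve (ν' i) A)^[T] stoppedInd (.running []) := by
      rw [hf, evolve_iterate_add, evolve_iterate_const, evolve_iterate_mul]
    obtain ⟨S₁, S₂, hne, ht₁, ht₂⟩ := htie i hi
    have h2 := evolve_stoppedInd_le (ν' i) A hk hne ht₁ ht₂ hA T
    have h3 : Real.log ((evolve (ν' i) A)^[T] f (.running [])) ≤
        Real.log (1 + (Real.exp l - 1) * (2 * δ)) := by
      refine Real.log_le_log hpos ?_
      rw [e]
      have := mul_le_mul_of_nonneg_left h2 (sub_nonneg.2 hexp)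
      linarith
    have h4 : cost (κ i) (.running [] : GameState F) = 0 := by simp [cost, GameState.history]
    rw [h4] at h1
    simp only [hp]
    linarith
  -- Let `T` tend to infinity: finitely many expected observations force `p T ≥ 1 - M / T`.
  have hlim : ∀ l : ℝ, 0 ≤ l → W * (l - Real.log (1 + (Real.exp l - 1) * (2 * δ))) ≤ K * M := by
    intro l hl
    have h1 : Tendsto (fun T : ℕ => W * (l * (1 - M / T) - Real.log (1 + (Real.exp l - 1) * (2 * δ))))
        atTop (𝓝 (W * (l * (1 - 0) - Real.log (1 + (Real.exp l - 1) * (2 * δ))))) :=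
      ((((tendsto_const_div_atTop_nhds_zero_nat M).const_sub 1).const_mul l).sub_const _).const_mul W
    rw [sub_zero, mul_one] at h1
    refine le_of_tendsto h1 ?_
    filter_upwards [eventually_gt_atTop 0] with T hT
    refine le_trans ?_ (hmain l hl T)
    refine mul_le_mul_of_nonneg_left (sub_le_sub_right (mul_le_mul_of_nonneg_left ?_ hl) _) hW0
    have hT' : (0 : ℝ) < T := by exact_mod_cast hT
    have : 1 - p T ≤ M / T := by
      rw [le_div_iff₀ hT', mul_comm]
      exact hp1 T
    linarith
  -- Let `l` tend to infinity in `l - log (1 + exp l * (2 * δ)) = -log (exp (-l) + 2 * δ)`.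
  have hfin : W * Real.log (1 / (2 * δ)) ≤ K * M := by
    have h1 : Tendsto (fun l : ℝ => W * (- Real.log (Real.exp (-l) + 2 * δ))) atTop
        (𝓝 (W * (- Real.log (0 + 2 * δ)))) := by
      refine ((Tendsto.log ?_ (by positivity)).neg).const_mul W
      exact (Real.tendsto_exp_neg_atTop_nhds_zero).add_const _
    rw [zero_add, ← Real.log_inv, inv_eq_one_div] at h1
    refine le_of_tendsto h1 ?_
    filter_upwards [eventually_ge_atTop 0] with l hl
    refine le_trans (mul_le_mul_of_nonneg_left ?_ hW0) (hlim l hl)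
    have hexp : 1 ≤ Real.exp l := Real.one_le_exp hl
    have e : l + - Real.log (1 + Real.exp l * (2 * δ)) = - Real.log (Real.exp (-l) + 2 * δ) := by
      have : Real.exp (-l) + 2 * δ = Real.exp (-l) * (1 + Real.exp l * (2 * δ)) := by
        rw [mul_add, ← mul_assoc, ← Real.exp_add]; simp
      rw [this, Real.log_mul (Real.exp_pos _).ne' (by positivity), Real.log_exp]
      ring
    rw [← e, sub_eq_add_neg]
    refine add_le_add_right (neg_le_neg (Real.log_le_log ?_ ?_)) _
    · have := mul_nonneg (sub_nonneg.2 hexp) (by positivity : 0 ≤ 2 * δ)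
      linarith
    · nlinarith
  rw [ENNReal.ofReal_le_iff_le_toReal htop]
  refine hN.trans ?_
  rw [div_mul_eq_mul_div, div_le_iff₀ hK, mul_comm _ K]
  exact hfin

end Game

/-! ### Bounds on relative entropy -/

section KL

/-- For `q ≤ p` this is `log x ≤ (x - x⁻¹) / 2` at `x = p / q`, that is `u ≤ sinh u` at `u = log x`.
For `p ≤ q` it is `log (1 + y) ≥ y - y ^ 2 / 2` at `y = q / p - 1`. The linear part `p - q` will
cancel in a sum over two probability vectors. -/
lemma mul_log_div_le {p q : ℝ} (hp : 0 < p) (hq : 0 < q) :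
    p * Real.log (p / q) ≤ p - q + (p - q) ^ 2 / (2 * min p q) := by
  rcases le_total q p with h | h
  · rw [min_eq_right h]
    have h1 : 1 ≤ p / q := (one_le_div hq).2 h
    have h2 : Real.log (p / q) ≤ (p / q - (p / q)⁻¹) / 2 := by
      have h3 := Real.self_le_sinh_iff.2 (Real.log_nonneg h1)
      rwa [Real.sinh_eq, Real.exp_neg, Real.exp_log (by positivity)] at h3
    refine (mul_le_mul_of_nonneg_left h2 hp.le).trans (le_of_eq ?_)
    field_simp
    ring
  · rw [min_eq_left h]
    set y := q / p - 1 with hy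
    have hy0 : 0 ≤ y := sub_nonneg.2 ((one_le_div hp).2 h)
    have h1 := Real.le_log_one_add_of_nonneg hy0
    have h2 : y - y ^ 2 / 2 ≤ 2 * y / (y + 2) := by
      rw [le_div_iff₀ (by linarith)]
      nlinarith [pow_nonneg hy0 3]
    have h3 : Real.log (p / q) = - Real.log (1 + y) := by
      rw [hy, add_sub_cancel, ← Real.log_inv, inv_div]
    have h4 : p * Real.log (p / q) ≤ p * (y ^ 2 / 2 - y) :=
      mul_le_mul_of_nonneg_left (by rw [h3]; linarith) hp.le
    refine h4.trans (le_of_eq ?_)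
    rw [hy]
    field_simp
    ring

/-- Split `log (g / G)` into `log ((g / G) * q / p) + log (p / q)`. By `log x ≤ x - 1` the first
part contributes only linear terms, which cancel in the sum; the second leaves the quadratic terms.
The common minorant `m` has to be positive only where `p` and `q` differ; elsewhere the quotient
vanishes. -/
lemma klBound_of_sum_le {α : Type*} [Fintype α] {p q m : α → ℝ} {κ : ℝ}
    (hq : ∀ a, 0 ≤ q a) (hp1 : ∑ a, p a = 1) (hq1 : ∑ a, q a = 1)
    (hmp : ∀ a, m a ≤ p a) (hmq : ∀ a, m a ≤ q a) (hm : ∀ a, p a ≠ q a → 0 < m a)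
    (hsum : ∑ a, (p a - q a) ^ 2 / m a ≤ 2 * κ) : KLBound p q κ := by
  intro g hg
  set G := ∑ a, q a * g a with hG
  have hGpos : 0 < G := by
    refine (Finset.sum_nonneg fun a _ => mul_nonneg (hq a) (hg a).le).lt_of_ne' fun h0 => ?_
    rw [Finset.sum_eq_zero_iff_of_nonneg fun a _ => mul_nonneg (hq a) (hg a).le] at h0
    have : ∑ a, q a = 0 := Finset.sum_eq_zero fun a ha =>
      (mul_eq_zero.1 (h0 a ha)).resolve_right (hg a).ne'
    linarith
  have h1 : ∀ a, p a * Real.log (g a) - p a * Real.log G ≤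
      q a * (g a / G) - q a + (p a - q a) ^ 2 / m a / 2 := by
    intro a
    have hh : 0 < g a / G := div_pos (hg a) hGpos
    rw [← mul_sub, ← Real.log_div (hg a).ne' hGpos.ne']
    by_cases hpq : p a = q a
    · rw [hpq]
      have := mul_le_mul_of_nonneg_left (Real.log_le_sub_one_of_pos hh) (hq a)
      simp only [sub_self, ne_eq, OfNat.ofNat_ne_zero, not_false_eq_true, zero_pow, zero_div, add_zero]
      linarith
    · have hm0 := hm a hpq
      have hp0 := hm0.trans_le (hmp a)
      have hq0 := hm0.trans_le (hmq a)
      have e : Real.log (g a / G) = Real.log (g a / G * q a / p a) + Real.log (p a / q a) := by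
        rw [← Real.log_mul (by positivity) (by positivity)]
        congr 1
        field_simp
      have h2 := mul_le_mul_of_nonneg_left
        (Real.log_le_sub_one_of_pos (show 0 < g a / G * q a / p a by positivity)) hp0.le
      have h3 := mul_log_div_le hp0 hq0
      have h4 : (p a - q a) ^ 2 / (2 * min (p a) (q a)) ≤ (p a - q a) ^ 2 / m a / 2 := by
        rw [div_div, mul_comm (m a)]
        have := le_min (hmp a) (hmq a)
        gcongr
      have e2 : p a * (g a / G * q a / p a - 1) = q a * (g a / G) - p a := by
        field_simp
      rw [e, mul_add]
      linarith
  have h2 := Finset.sum_le_sum fun a (_ : a ∈ Finset.univ) => h1 a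
  simp only [Finset.sum_add_distrib, Finset.sum_sub_distrib, ← Finset.sum_mul, ← Finset.sum_div,
    hp1, hq1, ← mul_div_assoc] at h2
  rw [← hG, div_self hGpos.ne'] at h2
  linarith

lemma KLBound.mono {α : Type*} [Fintype α] {p q : α → ℝ} {κ κ' : ℝ} (h : KLBound p q κ)
    (hκ : κ ≤ κ') : KLBound p q κ' := fun g hg => (h g hg).trans (by linarith)

lemma klBound_self {α : Type*} [Fintype α] {p : α → ℝ} (h0 : ∀ a, 0 ≤ p a) (h1 : ∑ a, p a = 1) :
    KLBound p p 0 :=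
  klBound_of_sum_le (m := p) h0 h1 h1 (fun _ => le_rfl) (fun _ => le_rfl) (fun _ h => (h rfl).elim)
    (by simp)

variable {n k : ℕ}

/-- Feedback that is a function of the feedback `F` carries no more information. -/
lemma KLBound.of_map {F F' : Feedback n k} [Fintype F.Obs] [Fintype F'.Obs] (f : F.Obs → F'.Obs)
    (hf : ∀ S x, F'.channel S x = (F.channel S x).map f) {ν ν' : PMF (Rewards n)} {S : KSet n k}
    {κ : ℝ} (h : KLBound (obsProb F ν S) (obsProb F ν' S) κ) :
    KLBound (obsProb F' ν S) (obsProb F' ν' S) κ := by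
  classical
  have hs : ∀ (ν : PMF (Rewards n)) (φ : F'.Obs → ℝ),
      ∑ o, obsProb F' ν S o * φ o = ∑ o, obsProb F ν S o * φ (f o) := by
    intro ν φ
    simp only [obsProb, Finset.sum_mul]
    rw [Finset.sum_comm, Finset.sum_comm (s := (Finset.univ : Finset F.Obs))]
    refine Finset.sum_congr rfl fun x _ => ?_
    simp only [mul_assoc, ← Finset.mul_sum]
    congr 1
    have e : ∀ o, (F'.channel S x o).toReal = ∑ o', if o = f o' then (F.channel S x o').toReal else 0 := by
      intro o
      rw [hf, PMF.map_apply, tsum_fintype, ENNReal.toReal_sum]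
      · refine Finset.sum_congr rfl fun o' _ => ?_
        split_ifs <;> simp
      · intro o' _
        split_ifs
        · exact PMF.apply_ne_top _ _
        · exact ENNReal.zero_ne_top
    simp only [e, Finset.sum_mul]
    rw [Finset.sum_comm]
    simp
  intro g hg
  rw [hs, hs ν']
  exact h _ fun o => hg _

instance : Fintype (markedBandit n k).Obs := inferInstanceAs (Fintype (Option (Fin n)))
instance : Fintype (bandit n k).Obs := inferInstanceAs (Fintype Bool)
instance : Fintype (semiBandit n k).Obs := inferInstanceAs (Fintype (Fin n → Option Bool))

/-- The maximum is `1` exactly when there is an arm to mark. -/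
lemma bandit_channel_eq_map (S : KSet n k) (x : Rewards n) :
    (bandit n k).channel S x = ((markedBandit n k).channel S x).map (Option.isSome (α := Fin n)) := by
  simp only [bandit, markedBandit]
  split_ifs with h
  · rw [PMF.map_comp]
    have e : Option.isSome ∘ (some : Fin n → Option (Fin n)) = Function.const _ true := rfl
    obtain ⟨i, hi⟩ := h
    rw [e, PMF.map_const, reward_eq_true.2 ⟨i, by simpa [ones] using hi⟩]
  · rw [PMF.pure_map]
    congr 1
    by_contra hc
    simp only [Option.isSome_none, Bool.not_eq_false] at hc
    obtain ⟨i, hi, hx⟩ := reward_eq_true.1 hc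
    exact h ⟨i, by simp [ones, hi, hx]⟩

end KL

/-! ### Parity characters on the cube -/

section Cube

variable {n k : ℕ}

/-- The density under which the rewards in `G` vanish and the others are independent fair bits. -/
def unifOff (G : Finset (Fin n)) (x : Rewards n) : ℝ :=
  ∏ i, if i ∈ G then (if x i = true then 0 else 1) else 1 / 2

/-- The parity character of `A`. -/
def chi (A : Finset (Fin n)) (x : Rewards n) : ℝ := ∏ i ∈ A, if x i = true then -1 else 1

lemma unifOff_nonneg (G : Finset (Fin n)) (x : Rewards n) : 0 ≤ unifOff G x :=
  Finset.prod_nonneg fun i _ => by split_ifs <;> norm_num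

lemma chi_empty (x : Rewards n) : chi ∅ x = 1 := rfl

lemma chi_eq (A : Finset (Fin n)) (x : Rewards n) : chi A x = 1 ∨ chi A x = -1 := by
  induction A using Finset.induction_on with
  | empty => exact Or.inl rfl
  | insert i A hi ih =>
    rw [chi, Finset.prod_insert hi, ← chi]
    split_ifs <;> rcases ih with h | h <;> simp [h]

lemma chi_mul_chi (A B : Finset (Fin n)) (x : Rewards n) :
    chi A x * chi B x = chi (symmDiff A B) x := by
  classical
  have h : ∀ A : Finset (Fin n), chi A x = ∏ i, if i ∈ A then (if x i = true then -1 else 1) else 1 := by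
    intro A
    rw [chi, Finset.prod_ite_mem, Finset.univ_inter]
  rw [h, h, h, ← Finset.prod_mul_distrib]
  refine Finset.prod_congr rfl fun i _ => ?_
  by_cases hA : i ∈ A <;> by_cases hB : i ∈ B <;> simp [Finset.mem_symmDiff, hA, hB]
  split_ifs <;> norm_num

lemma sum_prod_eq_prod_add (φ : Fin n → Bool → ℝ) :
    ∑ x : Rewards n, ∏ i, φ i (x i) = ∏ i, (φ i true + φ i false) := by
  have h := Finset.prod_univ_sum (fun _ : Fin n => (Finset.univ : Finset Bool)) φ
  rw [Fintype.piFinset_univ] at h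
  rw [← h]
  simp

lemma sum_unifOff_mul_chi_mul_prod (G A : Finset (Fin n)) (ω : Fin n → Bool → ℝ) :
    ∑ x, unifOff G x * chi A x * ∏ i, ω i (x i) =
      ∏ i, ((if i ∈ G then 0 else 1 / 2) * (if i ∈ A then -1 else 1) * ω i true +
        (if i ∈ G then 1 else 1 / 2) * ω i false) := by
  have h : ∀ x : Rewards n, unifOff G x * chi A x * ∏ i, ω i (x i) = ∏ i,
      ((if i ∈ G then (if x i = true then 0 else 1) else 1 / 2) *
        (if i ∈ A then (if x i = true then -1 else 1) else 1) * ω i (x i)) := by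
    intro x
    rw [Finset.prod_mul_distrib, Finset.prod_mul_distrib, unifOff, chi, Finset.prod_ite_mem,
      Finset.univ_inter]
  simp_rw [h]
  rw [sum_prod_eq_prod_add (fun i b => (if i ∈ G then (if b = true then 0 else 1) else 1 / 2) *
        (if i ∈ A then (if b = true then -1 else 1) else 1) * ω i b)]
  simp

/-- The bit of `i` is fair and does not influence the test function, so the two signs of the
character cancel. This is why a query is blind to the characters of sets that it does not contain.
-/
lemma sum_unifOff_mul_chi_of_eq {G A : Finset (Fin n)} {ω : Fin n → Bool → ℝ} {i : Fin n}
    (hA : i ∈ A) (hG : i ∉ G) (hω : ω i true = ω i false) :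
    ∑ x, unifOff G x * chi A x * ∏ i, ω i (x i) = 0 := by
  rw [sum_unifOff_mul_chi_mul_prod]
  exact Finset.prod_eq_zero (Finset.mem_univ i) (by simp [hA, hG, hω])

lemma sum_unifOff (G : Finset (Fin n)) : ∑ x, unifOff G x = 1 := by
  have h := sum_unifOff_mul_chi_mul_prod G ∅ (fun _ _ => 1)
  simp only [chi_empty, mul_one, Finset.prod_const_one] at h
  rw [h]
  refine Finset.prod_eq_one fun i _ => ?_
  by_cases hG : i ∈ G <;> norm_num [hG]

lemma sum_unifOff_mul_chi {G A : Finset (Fin n)} (hA : ∃ i ∈ A, i ∉ G) :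
    ∑ x, unifOff G x * chi A x = 0 := by
  obtain ⟨i, hi, hG⟩ := hA
  simpa using sum_unifOff_mul_chi_of_eq (ω := fun _ _ => 1) hi hG rfl

/-- The signed mass of the observation `o` when `S` is queried and the rewards have the signed
density `f`. -/
def obsSum (F : Feedback n k) (f : Rewards n → ℝ) (S : KSet n k) (o : F.Obs) : ℝ :=
  ∑ x, f x * (F.channel S x o).toReal

lemma obsProb_pmfOfReal (F : Feedback n k) (f : Rewards n → ℝ) (h0 : ∀ x, 0 ≤ f x)
    (h1 : ∑ x, f x = 1) (S : KSet n k) (o : F.Obs) :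
    obsProb F (pmfOfReal f h0 h1) S o = obsSum F f S o := by
  simp only [obsProb, toReal_pmfOfReal, obsSum]

lemma obsSum_nonneg (F : Feedback n k) {f : Rewards n → ℝ} (hf : ∀ x, 0 ≤ f x) (S : KSet n k)
    (o : F.Obs) : 0 ≤ obsSum F f S o :=
  Finset.sum_nonneg fun x _ => mul_nonneg (hf x) ENNReal.toReal_nonneg

lemma sum_obsSum (F : Feedback n k) [Fintype F.Obs] (f : Rewards n → ℝ) (S : KSet n k) :
    ∑ o, obsSum F f S o = ∑ x, f x := by
  simp only [obsSum]
  rw [Finset.sum_comm]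
  simp [← Finset.mul_sum, sum_toReal_pmf]

end Cube

/-! ### Marked-bandit observations of a character -/

section Marked

variable {n k : ℕ}

open Classical in
/-- The law of the marked-bandit observation for given rewards. -/
def markedLaw (S : KSet n k) (x : Rewards n) : PMF (Option (Fin n)) :=
  if h : (ones S x).Nonempty then (PMF.uniformOfFinset (ones S x) h).map some
  else PMF.pure none

lemma toReal_markedBandit_none (S : KSet n k) (x : Rewards n) :
    ((markedBandit n k).channel S x (none : Option (Fin n))).toReal =
      ∏ i, if i ∈ S.1 then (if x i = true then (0 : ℝ) else 1) else 1 := by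
  classical
  rw [Finset.prod_ite_mem, Finset.univ_inter]
  change (markedLaw S x none).toReal = _
  rw [markedLaw]
  split_ifs with h
  · obtain ⟨i, hi⟩ := h
    obtain ⟨hS, hx⟩ : i ∈ S.1 ∧ x i = true := by simpa [ones] using hi
    rw [Finset.prod_eq_zero hS (by simp [hx]), PMF.map_apply]
    simp
  · rw [Finset.prod_eq_one, PMF.pure_apply_self]
    · simp
    · intro i hi
      rw [if_neg]
      exact fun hx => h ⟨i, by simp [ones, hi, hx]⟩

lemma toReal_markedBandit_some (S : KSet n k) (x : Rewards n) (l : Fin n) :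
    ((markedBandit n k).channel S x (some l : Option (Fin n))).toReal =
      if l ∈ S.1 ∧ x l = true then ((ones S x).card : ℝ)⁻¹ else 0 := by
  classical
  have hl : l ∈ ones S x ↔ l ∈ S.1 ∧ x l = true := by simp [ones]
  change (markedLaw S x (some l)).toReal = _
  rw [markedLaw]
  split_ifs with h h' h'
  · rw [PMF.map_apply, tsum_eq_single l]
    · simp [hl.2 h']
    · intro b hb
      simp [Ne.symm hb]
  · rw [PMF.map_apply, tsum_eq_single l]
    · simp [mt hl.1 h']
    · intro b hb
      simp [Ne.symm hb]
  · exact (h ⟨l, hl.2 h'⟩).elim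
  · rw [PMF.pure_apply_of_ne _ _ (by simp)]
    simp

/-- The reciprocal number of ones, as an integral of a product. -/
lemma toReal_markedBandit_some_eq_integral {S : KSet n k} {l : Fin n} (hl : l ∈ S.1) (x : Rewards n) :
    ((markedBandit n k).channel S x (some l : Option (Fin n))).toReal =
      ∫ t in (0 : ℝ)..1, ∏ i, if i = l then (if x i = true then 1 else 0) else
        (if i ∈ S.1 then (if x i = true then t else 1) else 1) := by
  classical
  rw [toReal_markedBandit_some]
  have h : ∀ t : ℝ, (∏ i, if i = l then (if x i = true then 1 else 0) else
        (if i ∈ S.1 then (if x i = true then t else 1) else 1)) =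
      (if x l = true then 1 else 0) * t ^ ((ones S x).erase l).card := by
    intro t
    rw [Fintype.prod_eq_mul_prod_compl l, if_pos rfl]
    congr 1
    rw [← Finset.prod_const, ← Finset.prod_subset (s₁ := (ones S x).erase l)]
    · refine Finset.prod_congr rfl fun i hi => ?_
      simp only [ones, Finset.mem_erase, Finset.mem_filter] at hi
      simp [hi]
    · intro i hi
      simp only [Finset.mem_erase] at hi
      simpa using hi.1
    · intro i hi hi'
      have hne : i ≠ l := by simpa using hi
      simp only [ones, Finset.mem_erase, Finset.mem_filter, not_and] at hi'
      by_cases hS : i ∈ S.1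
      · simp [hne, hi' hne hS]
      · simp [hne, hS]
  simp_rw [h]
  by_cases hx : x l = true
  · have hmem : l ∈ ones S x := by simp [ones, hl, hx]
    have hpos : 0 < (ones S x).card := Finset.card_pos.2 ⟨l, hmem⟩
    have hc : (((ones S x).card - 1 : ℕ) : ℝ) + 1 = (ones S x).card := by
      exact_mod_cast Nat.sub_add_cancel hpos
    simp [hx, hl, integral_pow, Finset.card_erase_of_mem hmem, hc]
  · simp [hx]

/-- Where all rewards in `S` vanish, the character of a subset of `S` equals `1`, so only the
probability of this event is left. -/
lemma obsSum_markedBandit_none {G A : Finset (Fin n)} (hGA : Disjoint A G) (S : KSet n k) :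
    obsSum (markedBandit n k) (fun x => unifOff G x * chi A x) S (none : Option (Fin n)) =
      if A ⊆ S.1 then (1 / 2) ^ (S.1 \ G).card else 0 := by
  classical
  simp only [obsSum, toReal_markedBandit_none]
  split_ifs with h
  · rw [sum_unifOff_mul_chi_mul_prod G A (fun i b => if i ∈ S.1 then (if b = true then 0 else 1) else 1),
      ← Finset.prod_const, ← Finset.prod_subset (Finset.subset_univ (S.1 \ G))]
    · refine Finset.prod_congr rfl fun i hi => ?_
      rw [Finset.mem_sdiff] at hi
      simp [hi]
    · intro i _ hi
      rw [Finset.mem_sdiff, not_and_not_right] at hi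
      by_cases hG : i ∈ G
      · simp [hG]
      · have hS : i ∉ S.1 := mt hi hG
        have hA : i ∉ A := fun hA => hS (h hA)
        norm_num [hG, hS, hA]
  · obtain ⟨i, hi, hS⟩ := Finset.not_subset.1 h
    exact sum_unifOff_mul_chi_of_eq (ω := fun i b => if i ∈ S.1 then (if b = true then 0 else 1) else 1)
      hi (Finset.disjoint_left.1 hGA hi) (by simp [hS])

/-- The integrals that give the laws of the observed index. -/
def markInt (a b : ℕ) : ℝ := ∫ t in (0 : ℝ)..1, (1 - t) ^ a * (1 + t) ^ b

lemma obsSum_markedBandit_some_of_notMem {f : Rewards n → ℝ} {S : KSet n k} {l : Fin n} (hl : l ∉ S.1) :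
    obsSum (markedBandit n k) f S (some l : Option (Fin n)) = 0 := by
  simp [obsSum, toReal_markedBandit_some, hl]

lemma obsSum_markedBandit_some_eq_integral (f : Rewards n → ℝ) {S : KSet n k} {l : Fin n}
    (hl : l ∈ S.1) :
    obsSum (markedBandit n k) f S (some l : Option (Fin n)) = ∫ t in (0 : ℝ)..1, ∑ x, f x *
      ∏ i, if i = l then (if x i = true then 1 else 0) else
        (if i ∈ S.1 then (if x i = true then t else 1) else 1) := by
  simp only [obsSum, toReal_markedBandit_some_eq_integral hl, ← intervalIntegral.integral_const_mul]
  rw [intervalIntegral.integral_finsetSum]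
  intro x _
  refine Continuous.intervalIntegrable ?_ _ _
  refine continuous_const.mul (continuous_finsetProd _ fun i _ => ?_)
  split_ifs <;> fun_prop

/-- Under the integral over `t` the sum factors over the arms: `l` gives half its sign, each other
arm of `A` gives `(1 - t) / 2`, each remaining arm of `S \ G` gives `(1 + t) / 2`, and all other
arms give `1`. -/
lemma obsSum_markedBandit_some {G A : Finset (Fin n)} (hGA : Disjoint A G) {S : KSet n k} {l : Fin n}
    (hl : l ∈ S.1 \ G) (hAS : A ⊆ S.1) :
    obsSum (markedBandit n k) (fun x => unifOff G x * chi A x) S (some l : Option (Fin n)) =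
      (if l ∈ A then -1 else 1) * (1 / 2) ^ (S.1 \ G).card *
        markInt (A.erase l).card ((S.1 \ G).card - 1 - (A.erase l).card) := by
  classical
  obtain ⟨hlS, hlG⟩ := Finset.mem_sdiff.1 hl
  rw [obsSum_markedBandit_some_eq_integral _ hlS, markInt, ← intervalIntegral.integral_const_mul]
  refine intervalIntegral.integral_congr fun t _ => ?_
  rw [sum_unifOff_mul_chi_mul_prod G A (fun i b => if i = l then (if b = true then 1 else 0) else
        (if i ∈ S.1 then (if b = true then t else 1) else 1)),
    ← Finset.prod_subset (Finset.subset_univ (S.1 \ G))]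
  · have hsub : A.erase l ⊆ (S.1 \ G).erase l := by
      intro i hi
      obtain ⟨h1, h2⟩ := Finset.mem_erase.1 hi
      exact Finset.mem_erase.2 ⟨h1, Finset.mem_sdiff.2 ⟨hAS h2, Finset.disjoint_left.1 hGA h2⟩⟩
    have hcard : (S.1 \ G).card = (A.erase l).card + ((S.1 \ G).card - 1 - (A.erase l).card) + 1 := by
      have h1 := Finset.card_le_card hsub
      rw [Finset.card_erase_of_mem hl] at h1
      have h2 : 0 < (S.1 \ G).card := Finset.card_pos.2 ⟨l, hl⟩
      omega
    have hcard2 : ((S.1 \ G).erase l \ A.erase l).card = (S.1 \ G).card - 1 - (A.erase l).card := by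
      rw [Finset.card_sdiff_of_subset hsub, Finset.card_erase_of_mem hl]
    rw [← Finset.mul_prod_erase _ _ hl, ← Finset.prod_sdiff hsub,
      Finset.prod_congr rfl (g := fun _ => (1 + t) / 2), Finset.prod_const,
      Finset.prod_congr rfl (g := fun _ => (1 - t) / 2), Finset.prod_const, hcard2]
    · generalize (S.1 \ G).card - 1 - (A.erase l).card = b at *
      generalize (A.erase l).card = a at *
      rw [hcard]
      simp only [hlG, ↓reduceIte, Bool.false_eq_true, div_pow, pow_succ, pow_add, one_pow]
      split_ifs <;> field_simp <;> ring
    · intro i hi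
      obtain ⟨h1, h2⟩ := Finset.mem_erase.1 hi
      simp [h1, h2, Finset.disjoint_left.1 hGA h2, hAS h2]
      ring
    · intro i hi
      simp only [Finset.mem_sdiff, Finset.mem_erase, not_and] at hi
      simp [hi.1.1, hi.1.2, hi.2 hi.1.1]
      ring
  · intro i _ hi
    rw [Finset.mem_sdiff, not_and_not_right] at hi
    by_cases hG : i ∈ G
    · have hne : i ≠ l := fun h => hlG (h ▸ hG)
      simp [hG, hne]
    · have hS : i ∉ S.1 := mt hi hG
      have hA : i ∉ A := fun hA => hS (hAS hA)
      have hne : i ≠ l := fun h => hS (h ▸ hlS)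
      norm_num [hG, hS, hA, hne]

lemma obsSum_markedBandit_some_of_mem {G A : Finset (Fin n)} {S : KSet n k} {l : Fin n} (hl : l ∈ G) :
    obsSum (markedBandit n k) (fun x => unifOff G x * chi A x) S (some l : Option (Fin n)) = 0 := by
  refine Finset.sum_eq_zero fun x _ => ?_
  rw [toReal_markedBandit_some]
  split_ifs with h
  · have : unifOff G x = 0 := Finset.prod_eq_zero (Finset.mem_univ l) (by simp [hl, h.2])
    simp [this]
  · simp

lemma obsSum_markedBandit_eq_zero {G A : Finset (Fin n)} {S : KSet n k} (hGA : Disjoint A G)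
    (hAS : ¬ A ⊆ S.1) (o : Option (Fin n)) :
    obsSum (markedBandit n k) (fun x => unifOff G x * chi A x) S o = 0 := by
  cases o with
  | none => rw [obsSum_markedBandit_none hGA, if_neg hAS]
  | some l =>
    by_cases hl : l ∈ S.1
    · rw [obsSum_markedBandit_some_eq_integral _ hl]
      obtain ⟨i, hi, hS⟩ := Finset.not_subset.1 hAS
      have h : ∀ t : ℝ, (∑ x, unifOff G x * chi A x *
          ∏ i, if i = l then (if x i = true then 1 else 0) else
            (if i ∈ S.1 then (if x i = true then t else 1) else 1)) = 0 := by
        intro t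
        have hne : i ≠ l := fun h => hS (h ▸ hl)
        exact sum_unifOff_mul_chi_of_eq (ω := fun i b => if i = l then (if b = true then 1 else 0) else
            (if i ∈ S.1 then (if b = true then t else 1) else 1))
          hi (Finset.disjoint_left.1 hGA hi) (by simp [hS, hne])
      simp [h]
    · exact obsSum_markedBandit_some_of_notMem hl

end Marked

/-! ### Semi-bandit observations of a character -/

section SemiBandit

variable {n k : ℕ}

open Classical in
lemma toReal_semiBandit (S : KSet n k) (x : Rewards n) (y : Fin n → Option Bool) :
    ((semiBandit n k).channel S x y).toReal =
      ∏ i, if y i = (if i ∈ S.1 then some (x i) else none) then (1 : ℝ) else 0 := by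
  rw [Finset.prod_ite_zero]
  change ((PMF.pure fun i => if i ∈ S.1 then some (x i) else none :
    PMF (Fin n → Option Bool)) y).toReal = _
  simp only [PMF.pure_apply]
  by_cases h : y = fun i => if i ∈ S.1 then some (x i) else none
  · rw [if_pos h, if_pos fun i _ => congrFun h i]
    simp
  · rw [if_neg h, if_neg fun h' => h (funext fun i => h' i (Finset.mem_univ i))]
    simp

/-- The value of the character of `A` on a semi-bandit observation that reveals it. -/
def obsChi (A : Finset (Fin n)) (y : Fin n → Option Bool) : ℝ :=
  ∏ i ∈ A, if y i = some true then -1 else 1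

lemma obsChi_eq (A : Finset (Fin n)) (y : Fin n → Option Bool) : obsChi A y = 1 ∨ obsChi A y = -1 := by
  induction A using Finset.induction_on with
  | empty => exact Or.inl rfl
  | insert i A hi ih =>
    rw [obsChi, Finset.prod_insert hi, ← obsChi]
    split_ifs <;> rcases ih with h | h <;> simp [h]

/-- The observation reveals all the arms of `A`, so the character is constant on the vectors
compatible with it. -/
lemma obsSum_semiBandit {G A : Finset (Fin n)} {S : KSet n k} (hAS : A ⊆ S.1) (y : Fin n → Option Bool) :
    obsSum (semiBandit n k) (fun x => unifOff G x * chi A x) S y =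
      obsChi A y * obsSum (semiBandit n k) (unifOff G) S y := by
  simp only [obsSum, Finset.mul_sum]
  refine Finset.sum_congr rfl fun x _ => ?_
  by_cases h : ((semiBandit n k).channel S x y).toReal = 0
  · simp [h]
  · have hy : y = fun i => if i ∈ S.1 then some (x i) else none := by
      by_contra hne
      refine h ?_
      change ((PMF.pure fun i => if i ∈ S.1 then some (x i) else none :
        PMF (Fin n → Option Bool)) y).toReal = 0
      rw [PMF.pure_apply_of_ne _ _ hne, ENNReal.toReal_zero]
    have : obsChi A y = chi A x := by
      refine Finset.prod_congr rfl fun i hi => ?_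
      rw [hy]
      simp [hAS hi]
    rw [this]
    ring

lemma obsSum_semiBandit_eq_zero {G A : Finset (Fin n)} {S : KSet n k} (hGA : Disjoint A G)
    (hAS : ¬ A ⊆ S.1) (y : Fin n → Option Bool) :
    obsSum (semiBandit n k) (fun x => unifOff G x * chi A x) S y = 0 := by
  classical
  obtain ⟨i, hi, hS⟩ := Finset.not_subset.1 hAS
  simp only [obsSum, toReal_semiBandit]
  exact sum_unifOff_mul_chi_of_eq
    (ω := fun i b => if y i = (if i ∈ S.1 then some b else none) then (1 : ℝ) else 0)
    hi (Finset.disjoint_left.1 hGA hi) (by simp [hS])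

end SemiBandit

/-! ### Values of the mark integrals -/

section MarkInt

/-- After the substitution `s = 1 - t`, a small exponent `b` leaves a short sum of monomials. -/
lemma markInt_eq (a b : ℕ) : markInt a b = ∫ s in (0 : ℝ)..1, s ^ a * (2 - s) ^ b := by
  have h := intervalIntegral.integral_comp_sub_left (a := 0) (b := 1)
    (fun s : ℝ => s ^ a * (2 - s) ^ b) 1
  simp only [sub_zero, sub_self] at h
  rw [← h, markInt]
  refine intervalIntegral.integral_congr fun t _ => ?_
  ring

lemma markInt_zero_right (a : ℕ) : markInt a 0 = 1 / (a + 1) := by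
  simp [markInt_eq, integral_pow]

lemma markInt_one_right (a : ℕ) : markInt a 1 = 2 / (a + 1) - 1 / (a + 2) := by
  have h : ∀ s : ℝ, s ^ a * (2 - s) ^ 1 = 2 * s ^ a - s ^ (a + 1) := fun s => by ring
  simp_rw [markInt_eq, h]
  rw [intervalIntegral.integral_sub (Continuous.intervalIntegrable (by fun_prop) _ _)
    (Continuous.intervalIntegrable (by fun_prop) _ _), intervalIntegral.integral_const_mul,
    integral_pow, integral_pow]
  push_cast
  norm_num
  ring

lemma markInt_two_right (a : ℕ) : markInt a 2 = 4 / (a + 1) - 4 / (a + 2) + 1 / (a + 3) := by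
  have h : ∀ s : ℝ, s ^ a * (2 - s) ^ 2 = 4 * s ^ a - 4 * s ^ (a + 1) + s ^ (a + 2) := fun s => by ring
  simp_rw [markInt_eq, h]
  rw [intervalIntegral.integral_add (Continuous.intervalIntegrable (by fun_prop) _ _)
    (Continuous.intervalIntegrable (by fun_prop) _ _),
    intervalIntegral.integral_sub (Continuous.intervalIntegrable (by fun_prop) _ _)
    (Continuous.intervalIntegrable (by fun_prop) _ _), intervalIntegral.integral_const_mul,
    intervalIntegral.integral_const_mul,
    integral_pow, integral_pow, integral_pow]
  push_cast
  norm_num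
  ring

lemma markInt_zero_left (b : ℕ) : markInt 0 b = (2 ^ (b + 1) - 1) / (b + 1) := by
  have h := intervalIntegral.integral_comp_add_left (a := 0) (b := 1) (fun s : ℝ => s ^ b) 1
  simp only [markInt, pow_zero, one_mul]
  rw [h, integral_pow]
  norm_num

end MarkInt

/-! ### Relative entropy of marked-bandit laws -/

section Bounds

variable {n k : ℕ}

lemma expReward_eq (ν : PMF (Rewards n)) (S : KSet n k) :
    expReward ν S = 1 - obsProb (markedBandit n k) ν S (none : Option (Fin n)) := by
  have h := sum_toReal_pmf ν
  simp only [expReward, obsProb]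
  rw [eq_sub_iff_add_eq, ← Finset.sum_add_distrib]
  refine Eq.trans (Finset.sum_congr rfl fun x _ => ?_) h
  rw [toReal_markedBandit_none, Finset.prod_ite_mem, Finset.univ_inter]
  by_cases hx : reward S x = true
  · obtain ⟨i, hi, hx'⟩ := reward_eq_true.1 hx
    rw [Finset.prod_eq_zero hi (by simp [hx']), if_pos hx]
    simp
  · rw [Finset.prod_eq_one, if_neg hx]
    · simp
    · intro i hi
      rw [if_neg fun h' => hx (reward_eq_true.2 ⟨i, hi, h'⟩)]

lemma obsSum_markedBandit_unifOff_none (G : Finset (Fin n)) (S : KSet n k) :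
    obsSum (markedBandit n k) (unifOff G) S (none : Option (Fin n)) = (1 / 2) ^ (S.1 \ G).card := by
  have h := obsSum_markedBandit_none (Finset.disjoint_empty_left G) S
  simpa [chi_empty] using h

lemma obsSum_markedBandit_unifOff_some {G : Finset (Fin n)} {S : KSet n k} {l : Fin n}
    (hl : l ∈ S.1 \ G) :
    obsSum (markedBandit n k) (unifOff G) S (some l : Option (Fin n)) =
      (1 - (1 / 2) ^ (S.1 \ G).card) / (S.1 \ G).card := by
  have h := obsSum_markedBandit_some (Finset.disjoint_empty_left G) hl (Finset.empty_subset _)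
  simp only [chi_empty, mul_one, Finset.notMem_empty, if_false, one_mul, Finset.erase_empty,
    Finset.card_empty, Nat.sub_zero] at h
  rw [h, markInt_zero_left]
  have hpos : 0 < (S.1 \ G).card := Finset.card_pos.2 ⟨l, hl⟩
  obtain ⟨K, hK⟩ := Nat.exists_eq_succ_of_ne_zero hpos.ne'
  rw [hK]
  simp only [Nat.succ_eq_add_one, Nat.add_sub_cancel]
  push_cast
  have h2 : ((1 : ℝ) / 2) ^ (K + 1) * 2 ^ (K + 1) = 1 := by rw [← mul_pow]; norm_num
  rw [← mul_div_assoc, mul_sub, h2, mul_one]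

/-- The relative entropy of two laws of the marked-bandit observation that differ by a multiple of
a character. -/
lemma klBound_markedBandit {G A : Finset (Fin n)} (hGA : Disjoint A G) {S : KSet n k} (hAS : A ⊆ S.1)
    {ν ν' : PMF (Rewards n)} {β m₀ mA mB : ℝ} (h0 : 0 < m₀) (hA : 0 < mA) (hB : 0 < mB)
    (h : ∀ o : Option (Fin n), obsProb (markedBandit n k) ν' S o = obsProb (markedBandit n k) ν S o +
      β * obsSum (markedBandit n k) (fun x => unifOff G x * chi A x) S o)
    (h0p : m₀ ≤ obsProb (markedBandit n k) ν S (none : Option (Fin n)))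
    (h0q : m₀ ≤ obsProb (markedBandit n k) ν' S (none : Option (Fin n)))
    (hAp : ∀ l ∈ A, mA ≤ obsProb (markedBandit n k) ν S (some l : Option (Fin n)))
    (hAq : ∀ l ∈ A, mA ≤ obsProb (markedBandit n k) ν' S (some l : Option (Fin n)))
    (hBp : ∀ l ∈ (S.1 \ G) \ A, mB ≤ obsProb (markedBandit n k) ν S (some l : Option (Fin n)))
    (hBq : ∀ l ∈ (S.1 \ G) \ A, mB ≤ obsProb (markedBandit n k) ν' S (some l : Option (Fin n))) :
    KLBound (obsProb (markedBandit n k) ν S) (obsProb (markedBandit n k) ν' S)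
      (1 / 2 * (β * (1 / 2) ^ (S.1 \ G).card) ^ 2 * (1 / m₀ +
        A.card * markInt (A.card - 1) ((S.1 \ G).card - A.card) ^ 2 / mA +
        ((S.1 \ G).card - A.card : ℕ) * markInt A.card ((S.1 \ G).card - A.card - 1) ^ 2 / mB)) := by
  classical
  set p : Option (Fin n) → ℝ := obsProb (markedBandit n k) ν S with hp
  set q : Option (Fin n) → ℝ := obsProb (markedBandit n k) ν' S with hq
  have hAK : A ⊆ S.1 \ G := fun i hi => Finset.mem_sdiff.2 ⟨hAS hi, Finset.disjoint_left.1 hGA hi⟩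
  have hrest : ∀ l, l ∉ S.1 \ G → q (some l) = p (some l) := by
    intro l hl
    rw [h]
    by_cases hlG : l ∈ G
    · rw [obsSum_markedBandit_some_of_mem hlG, mul_zero, add_zero]
    · rw [obsSum_markedBandit_some_of_notMem (fun hS => hl (Finset.mem_sdiff.2 ⟨hS, hlG⟩)), mul_zero,
        add_zero]
  -- The minorant is constant on each kind of observation: no mark, a mark in `A`, a mark in the
  -- rest of `S \ G`. On the other marks the two laws agree.
  set m : Option (Fin n) → ℝ := fun o => match o with
    | none => m₀
    | some l => if l ∈ A then mA else if l ∈ S.1 \ G then mB else p (some l) with hm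
  have hnn : ∀ o, 0 ≤ q o := fun o => obsProb_nonneg _ _ _
  have hs1 : ∑ o, p o = 1 := sum_obsProb (F := markedBandit n k) ν S
  have hs2 : ∑ o, q o = 1 := sum_obsProb (F := markedBandit n k) ν' S
  refine klBound_of_sum_le (α := Option (Fin n)) (m := m) hnn hs1 hs2 ?_ ?_ ?_ ?_
  · rintro (_ | l)
    · exact h0p
    · simp only [hm]
      split_ifs with h1 h2
      · exact hAp l h1
      · exact hBp l (Finset.mem_sdiff.2 ⟨h2, h1⟩)
      · exact le_rfl
  · rintro (_ | l)
    · exact h0q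
    · simp only [hm]
      split_ifs with h1 h2
      · exact hAq l h1
      · exact hBq l (Finset.mem_sdiff.2 ⟨h2, h1⟩)
      · exact (hrest l h2).ge
  · rintro (_ | l) hne
    · exact h0
    · simp only [hm]
      split_ifs with h1 h2
      · exact hA
      · exact hB
      · exact (hne (hrest l h2).symm).elim
  · rw [Fintype.sum_option]
    have hd : ∀ o, (p o - q o) ^ 2 =
        (β * obsSum (markedBandit n k) (fun x => unifOff G x * chi A x) S o) ^ 2 := by
      intro o
      rw [h o]
      ring
    have hsub : ∑ l, (p (some l) - q (some l)) ^ 2 / m (some l) =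
        ∑ l ∈ S.1 \ G, (p (some l) - q (some l)) ^ 2 / m (some l) := by
      refine (Finset.sum_subset (Finset.subset_univ _) fun l _ hl => ?_).symm
      rw [hrest l hl]
      simp
    have hcard : ∀ l ∈ A, (A.erase l).card = A.card - 1 := fun l hl => Finset.card_erase_of_mem hl
    have hle := Finset.card_le_card hAK
    have hsA : ∑ l ∈ A, (p (some l) - q (some l)) ^ 2 / m (some l) = A.card *
        ((β * (1 / 2) ^ (S.1 \ G).card * markInt (A.card - 1) ((S.1 \ G).card - A.card)) ^ 2 / mA) := by
      rw [← nsmul_eq_mul, ← Finset.sum_const]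
      refine Finset.sum_congr rfl fun l hl => ?_
      have hpos : 0 < A.card := Finset.card_pos.2 ⟨l, hl⟩
      rw [hd, obsSum_markedBandit_some hGA (hAK hl) hAS, hcard l hl]
      simp only [hm, hl, if_true]
      have e : (S.1 \ G).card - 1 - (A.card - 1) = (S.1 \ G).card - A.card := by omega
      rw [e]
      congr 1
      ring
    have hsB : ∑ l ∈ (S.1 \ G) \ A, (p (some l) - q (some l)) ^ 2 / m (some l) =
        ((S.1 \ G).card - A.card : ℕ) * ((β * (1 / 2) ^ (S.1 \ G).card *
          markInt A.card ((S.1 \ G).card - A.card - 1)) ^ 2 / mB) := by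
      rw [← Finset.card_sdiff_of_subset hAK, ← nsmul_eq_mul, ← Finset.sum_const]
      refine Finset.sum_congr rfl fun l hl => ?_
      obtain ⟨h1, h2⟩ := Finset.mem_sdiff.1 hl
      rw [hd, obsSum_markedBandit_some hGA h1 hAS, Finset.erase_eq_of_notMem h2]
      simp only [hm, h1, h2, if_true, if_false]
      have e : (S.1 \ G).card - 1 - A.card = ((S.1 \ G) \ A).card - 1 := by
        rw [Finset.card_sdiff_of_subset hAK]
        omega
      rw [e]
      congr 1
      ring
    rw [hsub, ← Finset.sum_sdiff hAK, hsA, hsB, hd, obsSum_markedBandit_none hGA, if_pos hAS]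
    simp only [hm]
    apply le_of_eq
    ring

end Bounds

/-! ### Densities modulated by characters -/

section Family

variable {n k : ℕ}

/-- The modulation of the density by characters. -/
def signal (e₁ e₂ c : ℝ) (A B : Finset (Fin n)) (x : Rewards n) : ℝ :=
  1 - e₁ * chi A x - e₂ * chi B x + c * chi (symmDiff A B) x

/-- The characters take the values `1` and `-1`. Both equal to `1` requires `e₁ + e₂ - 1 ≤ c`,
opposite signs require `c + |e₁ - e₂| ≤ 1`, and both equal to `-1` is harmless. -/
lemma signal_nonneg {e₁ e₂ c : ℝ} (he₁ : 0 ≤ e₁) (he₂ : 0 ≤ e₂) (hc : e₁ + e₂ - 1 ≤ c) (hc0 : 0 ≤ c)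
    (hc1 : c + |e₁ - e₂| ≤ 1) (A B : Finset (Fin n)) (x : Rewards n) : 0 ≤ signal e₁ e₂ c A B x := by
  have h := abs_le.1 (show |e₁ - e₂| ≤ 1 - c by linarith)
  rw [signal, ← chi_mul_chi]
  rcases chi_eq A x with hA | hA <;> rcases chi_eq B x with hB | hB <;> rw [hA, hB] <;> linarith

lemma exists_pmf {Q : Rewards n → ℝ} {w : ℝ} (hQ : ∀ x, 0 ≤ Q x) (hw : 0 ≤ w) (hQw : ∑ x, Q x + w = 1)
    {e₁ e₂ c : ℝ} (he₁ : 0 ≤ e₁) (he₂ : 0 ≤ e₂) (hc : e₁ + e₂ - 1 ≤ c) (hc0 : 0 ≤ c)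
    (hc1 : c + |e₁ - e₂| ≤ 1) {G A B : Finset (Fin n)} (hA : ∃ i ∈ A, i ∉ G) (hB : ∃ i ∈ B, i ∉ G)
    (hAB : c = 0 ∨ ∃ i ∈ symmDiff A B, i ∉ G) :
    ∃ ν : PMF (Rewards n), ∀ (F : Feedback n k) (S : KSet n k) (o : F.Obs), obsProb F ν S o =
      obsSum F Q S o + w * (obsSum F (unifOff G) S o -
        e₁ * obsSum F (fun x => unifOff G x * chi A x) S o -
        e₂ * obsSum F (fun x => unifOff G x * chi B x) S o +
        c * obsSum F (fun x => unifOff G x * chi (symmDiff A B) x) S o) := by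
  refine ⟨pmfOfReal (fun x => Q x + w * (unifOff G x * signal e₁ e₂ c A B x))
    (fun x => add_nonneg (hQ x) (mul_nonneg hw (mul_nonneg (unifOff_nonneg G x)
      (signal_nonneg he₁ he₂ hc hc0 hc1 A B x)))) ?_, fun F S o => ?_⟩
  · have h : ∀ x, Q x + w * (unifOff G x * signal e₁ e₂ c A B x) = Q x + w * unifOff G x -
        w * e₁ * (unifOff G x * chi A x) - w * e₂ * (unifOff G x * chi B x) +
        w * (c * (unifOff G x * chi (symmDiff A B) x)) := by
      intro x
      rw [signal]
      ring
    have h0 : c * ∑ x, unifOff G x * chi (symmDiff A B) x = 0 := by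
      rcases hAB with h | h
      · rw [h, zero_mul]
      · rw [sum_unifOff_mul_chi h, mul_zero]
    simp only [h, Finset.sum_add_distrib, Finset.sum_sub_distrib, ← Finset.mul_sum, sum_unifOff,
      sum_unifOff_mul_chi hA, sum_unifOff_mul_chi hB, h0]
    linarith
  · rw [obsProb_pmfOfReal]
    simp only [obsSum, Finset.mul_sum, ← Finset.sum_add_distrib, ← Finset.sum_sub_distrib]
    refine Finset.sum_congr rfl fun x _ => ?_
    rw [signal]
    ring

lemma isBest_and_gap {ν : PMF (Rewards n)} {S : KSet n k} {p Δ : ℝ} (hΔ : 0 < Δ)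
    (hS : expReward ν S = p + Δ) (hle : ∀ S' : KSet n k, S' ≠ S → expReward ν S' ≤ p)
    (hex : ∃ S' : KSet n k, S' ≠ S ∧ expReward ν S' = p) : IsBest ν S ∧ gap ν S = Δ := by
  refine ⟨fun S' hS' => (hle S' hS').trans_lt (by linarith), ?_⟩
  obtain ⟨S₁, h1, h2⟩ := hex
  have : (⨆ S' : {S' : KSet n k // S' ≠ S}, expReward ν S'.1) = p := by
    have : Nonempty {S' : KSet n k // S' ≠ S} := ⟨⟨S₁, h1⟩⟩
    refine le_antisymm (ciSup_le fun S' => hle S'.1 S'.2) ?_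
    rw [← h2]
    exact le_ciSup (f := fun S' : {S' : KSet n k // S' ≠ S} => expReward ν S'.1)
      (Set.finite_range _).bddAbove ⟨S₁, h1⟩
  rw [gap, this, hS]
  ring

end Family

/-- The parameters of the hard distributions: the rewards have density `Q` plus `w` times a
modulation of the law under which the rewards off `G` are fair bits and those in `G` vanish. -/
structure Design (n k : ℕ) where
  Q : Rewards n → ℝ
  w : ℝ
  G : Finset (Fin n)
  best : KSet n k
  e : ℝ
  c : ℝ
  z : ℝ
  k_lt : k < n
  Q_nonneg : ∀ x, 0 ≤ Q x
  w_pos : 0 < w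
  sum_Q : ∑ x, Q x + w = 1
  G_subset : G ⊆ best.1
  G_card : G.card < k
  e_pos : 0 < e
  e_le : e ≤ 1
  c_nonneg : 0 ≤ c
  c_le : c ≤ 1
  two_e_le : 2 * e - 1 ≤ c
  z_eq : ∀ S : KSet n k, G ⊆ S.1 → obsSum (markedBandit n k) Q S (none : Option (Fin n)) = z
  z_le : ∀ S : KSet n k, ¬ G ⊆ S.1 →
    z + w * (1 / 2) ^ (k - G.card) ≤ obsSum (markedBandit n k) Q S (none : Option (Fin n))

/-! ### The hard distribution, its alternatives, and their best sets -/

namespace Design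

variable {n k : ℕ} (d : Design n k)

/-- The signed mass of an observation under the character of `A`. -/
def charSum (F : Feedback n k) (A : Finset (Fin n)) (S : KSet n k) (o : F.Obs) : ℝ :=
  obsSum F (fun x => unifOff d.G x * chi A x) S o

/-- The law of the observation under the unmodulated distribution. -/
def baseProb (F : Feedback n k) (S : KSet n k) (o : F.Obs) : ℝ :=
  obsSum F d.Q S o + d.w * obsSum F (unifOff d.G) S o

/-- `ν` is the unperturbed hard distribution. -/
def IsMain (ν : PMF (Rewards n)) : Prop := ∀ (F : Feedback n k) (S' : KSet n k) (o : F.Obs),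
  obsProb F ν S' o = d.baseProb F S' o - d.w * d.e * d.charSum F (d.best.1 \ d.G) S' o

/-- `ν` is the hard distribution perturbed in favour of `S`. -/
def IsAlt (S : KSet n k) (ν : PMF (Rewards n)) : Prop :=
  ∀ (F : Feedback n k) (S' : KSet n k) (o : F.Obs),
    (S = d.best → obsProb F ν S' o = d.baseProb F S' o) ∧
    (S ≠ d.best → obsProb F ν S' o = d.baseProb F S' o -
      d.w * d.e * d.charSum F (d.best.1 \ d.G) S' o - d.w * d.e * d.charSum F (S.1 \ d.G) S' o +
      d.w * d.c * d.charSum F (symmDiff (d.best.1 \ d.G) (S.1 \ d.G)) S' o)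

lemma exists_mem_sdiff (S : KSet n k) : ∃ i ∈ S.1 \ d.G, i ∉ d.G := by
  have h : (S.1 \ d.G).Nonempty := by
    rw [Finset.sdiff_nonempty]
    intro h
    have := Finset.card_le_card h
    rw [S.2] at this
    exact absurd d.G_card (by omega)
  obtain ⟨i, hi⟩ := h
  exact ⟨i, hi, (Finset.mem_sdiff.1 hi).2⟩

lemma eq_of_sdiff_subset {S S' : KSet n k} (hS' : d.G ⊆ S'.1) (h : S.1 \ d.G ⊆ S'.1) : S' = S := by
  have h1 : S.1 ⊆ S'.1 := by
    intro i hi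
    by_cases hG : i ∈ d.G
    · exact hS' hG
    · exact h (Finset.mem_sdiff.2 ⟨hi, hG⟩)
  exact (Subtype.ext (Finset.eq_of_subset_of_card_le h1 (by rw [S.2, S'.2]))).symm

lemma exists_isMain : ∃ ν, d.IsMain ν := by
  have he := d.e_pos
  have he' := d.e_le
  obtain ⟨ν, h⟩ := exists_pmf (k := k) d.Q_nonneg d.w_pos.le d.sum_Q (e₁ := d.e) (e₂ := 0) (c := 0)
    d.e_pos.le le_rfl (by linarith) le_rfl (by rw [sub_zero, abs_of_pos he]; linarith)
    (d.exists_mem_sdiff d.best) (d.exists_mem_sdiff d.best) (Or.inl rfl)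
  refine ⟨ν, fun F S' o => ?_⟩
  rw [h, baseProb, charSum]
  ring

lemma exists_isAlt (S : KSet n k) : ∃ ν, d.IsAlt S ν := by
  by_cases hb : S = d.best
  · obtain ⟨ν, h⟩ := exists_pmf (k := k) d.Q_nonneg d.w_pos.le d.sum_Q (e₁ := 0) (e₂ := 0) (c := 0)
      le_rfl le_rfl (by norm_num) le_rfl (by norm_num)
      (d.exists_mem_sdiff d.best) (d.exists_mem_sdiff d.best) (Or.inl rfl)
    refine ⟨ν, fun F S' o => ⟨fun _ => ?_, fun hne => (hne hb).elim⟩⟩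
    rw [h, baseProb]
    ring
  · have he := d.two_e_le
    have hc := d.c_le
    obtain ⟨ν, h⟩ := exists_pmf (k := k) d.Q_nonneg d.w_pos.le d.sum_Q (e₁ := d.e) (e₂ := d.e) (c := d.c)
      d.e_pos.le d.e_pos.le (by linarith) d.c_nonneg (by simpa using hc)
      (d.exists_mem_sdiff d.best) (d.exists_mem_sdiff S) (Or.inr (by
        have h1 : ¬ S.1 \ d.G ⊆ d.best.1 := fun h1 => hb (d.eq_of_sdiff_subset d.G_subset h1).symm
        obtain ⟨i, hi, hi'⟩ := Finset.not_subset.1 h1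
        refine ⟨i, ?_, (Finset.mem_sdiff.1 hi).2⟩
        rw [Finset.mem_symmDiff]
        exact Or.inr ⟨hi, fun h => hi' (Finset.mem_sdiff.1 h).1⟩))
    refine ⟨ν, fun F S' o => ⟨fun hne => (hb hne).elim, fun _ => ?_⟩⟩
    rw [h, baseProb, charSum, charSum, charSum]
    ring

lemma disjoint_sdiff (S : KSet n k) : Disjoint (S.1 \ d.G) d.G := Finset.sdiff_disjoint

lemma disjoint_symmDiff (S S' : KSet n k) : Disjoint (symmDiff (S.1 \ d.G) (S'.1 \ d.G)) d.G := by
  rw [Finset.disjoint_left]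
  intro i hi hG
  rw [Finset.mem_symmDiff] at hi
  simp [hG] at hi

lemma card_sdiff {S : KSet n k} (hS : d.G ⊆ S.1) : (S.1 \ d.G).card = k - d.G.card := by
  rw [Finset.card_sdiff_of_subset hS, S.2]

lemma baseProb_none_eq (S : KSet n k) : d.baseProb (markedBandit n k) S (none : Option (Fin n)) =
    obsSum (markedBandit n k) d.Q S (none : Option (Fin n)) + d.w * (1 / 2) ^ (S.1 \ d.G).card := by
  rw [← obsSum_markedBandit_unifOff_none]
  rfl

lemma baseProb_none {S : KSet n k} (hS : d.G ⊆ S.1) :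
    d.baseProb (markedBandit n k) S (none : Option (Fin n)) = d.z + d.w * (1 / 2) ^ (k - d.G.card) := by
  rw [d.baseProb_none_eq, d.z_eq S hS, d.card_sdiff hS]

lemma charSum_none {A : Finset (Fin n)} (hA : Disjoint A d.G) (S : KSet n k) :
    d.charSum (markedBandit n k) A S (none : Option (Fin n)) =
      if A ⊆ S.1 then (1 / 2) ^ (S.1 \ d.G).card else 0 :=
  obsSum_markedBandit_none hA S

/-- Some other `k`-set contains `G`. -/
lemma exists_ne {S : KSet n k} (hS : d.G ⊆ S.1) : ∃ S' : KSet n k, d.G ⊆ S'.1 ∧ S' ≠ S := by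
  obtain ⟨i, hi, hiG⟩ := d.exists_mem_sdiff S
  have hiS := (Finset.mem_sdiff.1 hi).1
  obtain ⟨j, hj⟩ : ∃ j, j ∉ S.1 := by
    by_contra! h
    have : S.1 = Finset.univ := Finset.eq_univ_iff_forall.2 h
    have h2 := S.2
    rw [this, Finset.card_univ, Fintype.card_fin] at h2
    exact absurd d.k_lt (by omega)
  refine ⟨⟨insert j (S.1.erase i), ?_⟩, ?_, ?_⟩
  · rw [Finset.card_insert_of_notMem (fun h => hj (Finset.mem_of_mem_erase h)),
      Finset.card_erase_of_mem hiS, S.2]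
    have := d.G_card
    omega
  · intro l hl
    refine Finset.mem_insert_of_mem (Finset.mem_erase.2 ⟨?_, hS hl⟩)
    rintro rfl
    exact hiG hl
  · intro h
    have : j ∈ S.1 := by
      rw [← h]
      exact Finset.mem_insert_self _ _
    exact hj this

lemma isMain_none {ν : PMF (Rewards n)} (hν : d.IsMain ν) {S : KSet n k} (hS : d.G ⊆ S.1) :
    obsProb (markedBandit n k) ν S (none : Option (Fin n)) =
      d.z + d.w * (1 / 2) ^ (k - d.G.card) * (1 - if S = d.best then d.e else 0) := by
  have hiff : d.best.1 \ d.G ⊆ S.1 ↔ S = d.best :=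
    ⟨fun h => d.eq_of_sdiff_subset hS h, fun h => h ▸ Finset.sdiff_subset⟩
  rw [hν (markedBandit n k) S (none : Option (Fin n)), d.baseProb_none hS, d.charSum_none (d.disjoint_sdiff _), d.card_sdiff hS]
  simp only [hiff]
  split_ifs <;> ring

/-- The modulated part contributes a nonnegative amount because `e ≤ 1`, and `z_le` already makes
the contribution of `Q` large enough. -/
lemma isMain_none_ge {ν : PMF (Rewards n)} (hν : d.IsMain ν) {S : KSet n k} (hS : ¬ d.G ⊆ S.1) :
    d.z + d.w * (1 / 2) ^ (k - d.G.card) ≤ obsProb (markedBandit n k) ν S (none : Option (Fin n)) := by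
  have h := d.z_le S hS
  have hw := d.w_pos
  have he := d.e_le
  have hx : (0 : ℝ) ≤ (1 / 2) ^ (S.1 \ d.G).card := by positivity
  rw [hν (markedBandit n k) S (none : Option (Fin n)), d.baseProb_none_eq, d.charSum_none (d.disjoint_sdiff _)]
  split_ifs
  · nlinarith [mul_nonneg hw.le (mul_nonneg hx (sub_nonneg.2 he))]
  · nlinarith [mul_nonneg hw.le hx]

lemma isBest_and_gap {ν : PMF (Rewards n)} (hν : d.IsMain ν) :
    IsBest ν d.best ∧ gap ν d.best = d.w * d.e * (1 / 2) ^ (k - d.G.card) := by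
  have hw := d.w_pos
  have he := d.e_pos
  refine BestOfK.isBest_and_gap (p := 1 - (d.z + d.w * (1 / 2) ^ (k - d.G.card))) (by positivity) ?_ ?_ ?_
  · rw [expReward_eq, d.isMain_none hν d.G_subset, if_pos rfl]
    ring
  · intro S' hS'
    rw [expReward_eq]
    by_cases h : d.G ⊆ S'.1
    · rw [d.isMain_none hν h, if_neg hS']
      linarith
    · linarith [d.isMain_none_ge hν h]
  · obtain ⟨S', h1, h2⟩ := d.exists_ne d.G_subset
    refine ⟨S', h2, ?_⟩
    rw [expReward_eq, d.isMain_none hν h1, if_neg h2]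
    ring

/-- In terms of the probability of no mark: for `S = best` there is no modulation and all supersets
of `G` tie. Otherwise a superset of `G` that sees the character of `S` or of `best` is that set, so
just these two have their probability lowered by `w * T * e`. A set that misses an arm of `G` may
see all three characters; then `2 * e - 1 ≤ c` keeps its modulated part nonnegative, and `z_le` does
the rest. -/
lemma isAlt_tie {S : KSet n k} (hS : d.G ⊆ S.1) {ν : PMF (Rewards n)} (hν : d.IsAlt S ν) :
    ∃ S₁ S₂ : KSet n k, S₁ ≠ S₂ ∧ (∀ S' : KSet n k, expReward ν S' ≤ expReward ν S₁) ∧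
      ∀ S' : KSet n k, expReward ν S' ≤ expReward ν S₂ := by
  have hw := d.w_pos
  have he := d.e_pos
  have he1 := d.e_le
  have hc := d.c_nonneg
  have h2e := d.two_e_le
  set T : ℝ := (1 / 2) ^ (k - d.G.card) with hT
  have hT0 : 0 ≤ T := by positivity
  suffices h : ∃ (v : ℝ) (S₁ S₂ : KSet n k), S₁ ≠ S₂ ∧
      obsProb (markedBandit n k) ν S₁ (none : Option (Fin n)) = v ∧
      obsProb (markedBandit n k) ν S₂ (none : Option (Fin n)) = v ∧
      ∀ S' : KSet n k, v ≤ obsProb (markedBandit n k) ν S' (none : Option (Fin n)) by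
    obtain ⟨v, S₁, S₂, hne, h1, h2, h3⟩ := h
    refine ⟨S₁, S₂, hne, fun S' => ?_, fun S' => ?_⟩
    · rw [expReward_eq, expReward_eq, h1]
      linarith [h3 S']
    · rw [expReward_eq, expReward_eq, h2]
      linarith [h3 S']
  by_cases hb : S = d.best
  · obtain ⟨S₂, h1, h2⟩ := d.exists_ne hS
    refine ⟨d.z + d.w * T, S, S₂, h2.symm, ?_, ?_, fun S' => ?_⟩
    · rw [(hν (markedBandit n k) S (none : Option (Fin n))).1 hb, d.baseProb_none hS]
    · rw [(hν (markedBandit n k) S₂ (none : Option (Fin n))).1 hb, d.baseProb_none h1]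
    · rw [(hν (markedBandit n k) S' (none : Option (Fin n))).1 hb]
      by_cases h : d.G ⊆ S'.1
      · rw [d.baseProb_none h]
      · have := d.z_le S' h
        rw [d.baseProb_none_eq]
        have hx : (0 : ℝ) ≤ (1 / 2) ^ (S'.1 \ d.G).card := by positivity
        linarith [mul_nonneg hw.le hx]
  · have hsymm : ∀ S' : KSet n k, d.best.1 \ d.G ⊆ S'.1 → S.1 \ d.G ⊆ S'.1 →
        symmDiff (d.best.1 \ d.G) (S.1 \ d.G) ⊆ S'.1 := by
      intro S' h1 h2 i hi
      rcases Finset.mem_symmDiff.1 hi with h | h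
      · exact h1 h.1
      · exact h2 h.1
    have hself : ∀ S' : KSet n k, symmDiff (d.best.1 \ d.G) (S.1 \ d.G) ⊆ S'.1 →
        d.best.1 \ d.G ⊆ S'.1 → S.1 \ d.G ⊆ S'.1 := by
      intro S' h1 h2 i hi
      by_cases hi' : i ∈ d.best.1 \ d.G
      · exact h2 hi'
      · exact h1 (Finset.mem_symmDiff.2 (Or.inr ⟨hi, hi'⟩))
    have hself' : ∀ S' : KSet n k, symmDiff (d.best.1 \ d.G) (S.1 \ d.G) ⊆ S'.1 →
        S.1 \ d.G ⊆ S'.1 → d.best.1 \ d.G ⊆ S'.1 := by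
      intro S' h1 h2 i hi
      by_cases hi' : i ∈ S.1 \ d.G
      · exact h2 hi'
      · exact h1 (Finset.mem_symmDiff.2 (Or.inl ⟨hi, hi'⟩))
    have h1 : d.best.1 \ d.G ⊆ d.best.1 := Finset.sdiff_subset
    have h2 : S.1 \ d.G ⊆ S.1 := Finset.sdiff_subset
    have h3 : ¬ S.1 \ d.G ⊆ d.best.1 := fun h => hb (d.eq_of_sdiff_subset d.G_subset h).symm
    have h4 : ¬ d.best.1 \ d.G ⊆ S.1 := fun h => hb (d.eq_of_sdiff_subset hS h)
    have h5 : ¬ symmDiff (d.best.1 \ d.G) (S.1 \ d.G) ⊆ d.best.1 := fun h => h3 (hself _ h h1)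
    have h6 : ¬ symmDiff (d.best.1 \ d.G) (S.1 \ d.G) ⊆ S.1 := fun h => h4 (hself' _ h h2)
    refine ⟨d.z + d.w * T * (1 - d.e), S, d.best, hb, ?_, ?_, fun S' => ?_⟩
    · rw [(hν (markedBandit n k) S (none : Option (Fin n))).2 hb, d.baseProb_none hS, d.charSum_none (d.disjoint_sdiff _),
        d.charSum_none (d.disjoint_sdiff _), d.charSum_none (d.disjoint_symmDiff _ _), if_neg h4, if_pos h2,
        if_neg h6, d.card_sdiff hS]
      ring
    · rw [(hν (markedBandit n k) d.best (none : Option (Fin n))).2 hb, d.baseProb_none d.G_subset, d.charSum_none (d.disjoint_sdiff _),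
        d.charSum_none (d.disjoint_sdiff _), d.charSum_none (d.disjoint_symmDiff _ _), if_pos h1, if_neg h3,
        if_neg h5, d.card_sdiff d.G_subset]
      ring
    · rw [(hν (markedBandit n k) S' (none : Option (Fin n))).2 hb, d.charSum_none (d.disjoint_sdiff _),
        d.charSum_none (d.disjoint_sdiff _), d.charSum_none (d.disjoint_symmDiff _ _)]
      -- Here `y` stands for the probability that fair bits vanish on `S' \ G`; the second
      -- alternative is that both sets are visible to `S'`.
      have key : ∀ y : ℝ, 0 ≤ y → y * (1 - d.e) ≤ y - d.e * (if d.best.1 \ d.G ⊆ S'.1 then y else 0) -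
          d.e * (if S.1 \ d.G ⊆ S'.1 then y else 0) + d.c * (if symmDiff (d.best.1 \ d.G) (S.1 \ d.G) ⊆ S'.1
            then y else 0) ∨ (d.best.1 \ d.G ⊆ S'.1 ∧ S.1 \ d.G ⊆ S'.1 ∧
              0 ≤ y - d.e * (if d.best.1 \ d.G ⊆ S'.1 then y else 0) -
          d.e * (if S.1 \ d.G ⊆ S'.1 then y else 0) + d.c * (if symmDiff (d.best.1 \ d.G) (S.1 \ d.G) ⊆ S'.1
            then y else 0)) := by
        intro y hy
        have hcy := mul_nonneg hc hy
        have hey := mul_nonneg he.le hy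
        by_cases ha : d.best.1 \ d.G ⊆ S'.1 <;> by_cases hb : S.1 \ d.G ⊆ S'.1
        · right
          refine ⟨ha, hb, ?_⟩
          rw [if_pos ha, if_pos hb, if_pos (hsymm S' ha hb)]
          nlinarith
        all_goals
          left
          simp only [ha, hb, if_true, if_false]
          split_ifs <;> linarith
      have hy : (0 : ℝ) ≤ (1 / 2) ^ (S'.1 \ d.G).card := by positivity
      by_cases h : d.G ⊆ S'.1
      · rw [d.baseProb_none h]
        rcases key _ hy with hk | ⟨ha, hb', -⟩
        · rw [d.card_sdiff h, ← hT] at hk ⊢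
          have := mul_le_mul_of_nonneg_left hk hw.le
          linarith
        · exact (hb ((d.eq_of_sdiff_subset h hb').symm.trans (d.eq_of_sdiff_subset h ha))).elim
      · have hz := d.z_le S' h
        rw [d.baseProb_none_eq]
        rw [← hT] at hz
        have hTe := mul_nonneg (mul_nonneg hw.le hT0) he.le
        rcases key _ hy with hk | ⟨-, -, hk⟩
        · have := mul_le_mul_of_nonneg_left hk hw.le
          have := mul_nonneg hw.le (mul_nonneg hy (sub_nonneg.2 he1))
          linarith
        · have := mul_le_mul_of_nonneg_left hk hw.le
          linarith

/-- The lower bound for `ν` from a family of perturbed distributions. -/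
lemma requiresObs {F : Feedback n k} [Fintype F.Obs] {ν : PMF (Rewards n)} {ν' : KSet n k → PMF (Rewards n)}
    (I : Finset (KSet n k)) (hI : ∀ S ∈ I, d.G ⊆ S.1)
    (hν' : ∀ S ∈ I, d.IsAlt S (ν' S)) (ω : KSet n k → ℝ) (κ : KSet n k → KSet n k → ℝ)
    {K δ N : ℝ} (hδ : 0 < δ) (hK : 0 < K) (hω : ∀ S ∈ I, 0 ≤ ω S)
    (hκ : ∀ S ∈ I, ∀ S', KLBound (obsProb F ν S') (obsProb F (ν' S) S') (κ S S'))
    (hsum : ∀ S', ∑ S ∈ I, ω S * κ S S' ≤ K)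
    (hN : N ≤ (∑ S ∈ I, ω S) / K * Real.log (1 / (2 * δ))) : RequiresObs F ν δ N :=
  requiresObs_of_alternatives ν I (by have := d.G_card; omega) ν' ω κ hδ hK hω hκ
    (fun S hS => d.isAlt_tie (hI S hS) (hν' S hS)) hsum hN

end Design

/-! ### Relative entropies of single observations -/

namespace Design

variable {n k : ℕ} (d : Design n k)

/-- The relative entropy between a law with and without the full character of the query. -/
def ownBound : ℝ :=
  1 / 2 * (d.w * d.e * (1 / 2) ^ (k - d.G.card)) ^ 2 *
    (1 / (d.z + d.w * (1 / 2) ^ (k - d.G.card) * (1 - d.e)) +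
      1 / (d.w * (1 - (1 / 2) ^ (k - d.G.card))))

lemma half_pow_lt_one : ((1 : ℝ) / 2) ^ (k - d.G.card) < 1 := by
  have := d.G_card
  exact pow_lt_one₀ (by norm_num) (by norm_num) (by omega)

lemma obsSum_Q_nonneg (F : Feedback n k) (S : KSet n k) (o : F.Obs) : 0 ≤ obsSum F d.Q S o :=
  obsSum_nonneg F d.Q_nonneg S o

lemma baseProb_some_ge {S : KSet n k} {l : Fin n} (hl : l ∈ S.1 \ d.G) :
    d.w * ((1 - (1 / 2) ^ (S.1 \ d.G).card) / (S.1 \ d.G).card) ≤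
      d.baseProb (markedBandit n k) S (some l : Option (Fin n)) := by
  rw [← obsSum_markedBandit_unifOff_some hl]
  exact le_add_of_nonneg_left (d.obsSum_Q_nonneg (markedBandit n k) S (some l : Option (Fin n)))

lemma charSum_some {A : Finset (Fin n)} (hA : Disjoint A d.G) {S : KSet n k} {l : Fin n}
    (hl : l ∈ S.1 \ d.G) (hAS : A ⊆ S.1) :
    d.charSum (markedBandit n k) A S (some l : Option (Fin n)) =
      (if l ∈ A then -1 else 1) * (1 / 2) ^ (S.1 \ d.G).card *
        markInt (A.erase l).card ((S.1 \ d.G).card - 1 - (A.erase l).card) :=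
  obsSum_markedBandit_some hA hl hAS

/-- The character changes all the marks in `S \ G` by the same amount, so that together they count
like one event of probability at least `w * (1 - 2 ^ (-r))`, where `r = k - d.G.card`. It makes
marks more likely and the absence of a mark less likely, which tells from which of the two laws each
minorant comes. -/
lemma klBound_own {S : KSet n k} (hS : d.G ⊆ S.1)
    (hz : 0 < d.z + d.w * (1 / 2) ^ (k - d.G.card) * (1 - d.e)) {ν ν' : PMF (Rewards n)}
    (h : ∀ o, obsProb (markedBandit n k) ν S o = d.baseProb (markedBandit n k) S o)
    (h' : ∀ o, obsProb (markedBandit n k) ν' S o = d.baseProb (markedBandit n k) S o -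
      d.w * d.e * d.charSum (markedBandit n k) (S.1 \ d.G) S o) :
    KLBound (obsProb (markedBandit n k) ν S) (obsProb (markedBandit n k) ν' S) d.ownBound ∧
    KLBound (obsProb (markedBandit n k) ν' S) (obsProb (markedBandit n k) ν S) d.ownBound := by
  have hw := d.w_pos
  have he := d.e_pos
  have hT1 := d.half_pow_lt_one
  have hr : 0 < k - d.G.card := Nat.sub_pos_of_lt d.G_card
  have hr' : (0 : ℝ) < (k - d.G.card : ℕ) := by exact_mod_cast hr
  have hcard := d.card_sdiff hS
  have hsub : S.1 \ d.G ⊆ S.1 := Finset.sdiff_subset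
  set r := k - d.G.card with hrdef
  have hT0 : (0 : ℝ) < (1 / 2) ^ r := by positivity
  set m₁ := d.w * ((1 - (1 / 2) ^ r) / r) with hm1
  have hm1pos : 0 < m₁ := by
    have : (0 : ℝ) < 1 - (1 / 2) ^ r := by linarith
    positivity
  have hnone : obsProb (markedBandit n k) ν S (none : Option (Fin n)) = d.z + d.w * (1 / 2) ^ r := by
    rw [h (none : Option (Fin n)), d.baseProb_none hS]
  have hnone' : obsProb (markedBandit n k) ν' S (none : Option (Fin n)) =
      d.z + d.w * (1 / 2) ^ r * (1 - d.e) := by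
    rw [h' (none : Option (Fin n)), d.baseProb_none hS, d.charSum_none (d.disjoint_sdiff _),
      if_pos hsub, hcard]
    ring
  have hb : ∀ l ∈ S.1 \ d.G, m₁ ≤ obsProb (markedBandit n k) ν S (some l : Option (Fin n)) := by
    intro l hl
    have := d.baseProb_some_ge hl
    rw [hcard] at this
    rwa [h (some l : Option (Fin n))]
  have hb' : ∀ l ∈ S.1 \ d.G, m₁ ≤ obsProb (markedBandit n k) ν' S (some l : Option (Fin n)) := by
    intro l hl
    have h1 := hb l hl
    rw [h (some l : Option (Fin n))] at h1
    rw [h' (some l : Option (Fin n)), d.charSum_some (d.disjoint_sdiff _) hl hsub, if_pos hl,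
      Finset.card_erase_of_mem hl, hcard, Nat.sub_self, markInt_zero_right]
    have : 0 ≤ d.w * d.e * ((1 / 2) ^ r * (1 / ((r - 1 : ℕ) + 1))) := by positivity
    linarith
  have hmin : d.z + d.w * (1 / 2) ^ r * (1 - d.e) ≤ d.z + d.w * (1 / 2) ^ r := by
    have : 0 ≤ d.w * (1 / 2) ^ r * d.e := by positivity
    linarith
  -- The character lives on all of `S \ G`, so the third kind of observation is empty and its
  -- minorant can be any positive number; `1` is used.
  have hempty : ∀ l ∈ (S.1 \ d.G) \ (S.1 \ d.G), False := fun l hl => by simp at hl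
  have hval : ∀ β, β ^ 2 = (d.w * d.e) ^ 2 → 1 / 2 * (β * (1 / 2) ^ (S.1 \ d.G).card) ^ 2 *
      (1 / (d.z + d.w * (1 / 2) ^ r * (1 - d.e)) +
        (S.1 \ d.G).card * markInt ((S.1 \ d.G).card - 1) ((S.1 \ d.G).card - (S.1 \ d.G).card) ^ 2 / m₁ +
        ((S.1 \ d.G).card - (S.1 \ d.G).card : ℕ) *
          markInt (S.1 \ d.G).card ((S.1 \ d.G).card - (S.1 \ d.G).card - 1) ^ 2 / 1) = d.ownBound := by
    intro β hβ
    have hcast : ((r - 1 : ℕ) : ℝ) + 1 = r := by exact_mod_cast Nat.sub_add_cancel hr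
    rw [hcard, Nat.sub_self, markInt_zero_right, ownBound, ← hrdef, hcast, mul_pow, hβ]
    have hT' : (1 : ℝ) - (1 / 2) ^ r ≠ 0 := by linarith
    have e1 : (r : ℝ) * (1 / r) ^ 2 / m₁ = 1 / (d.w * (1 - (1 / 2) ^ r)) := by
      rw [hm1]
      field_simp
    rw [e1]
    push_cast
    ring
  constructor
  · rw [← hval (-(d.w * d.e)) (by ring)]
    refine klBound_markedBandit (d.disjoint_sdiff _) hsub hz hm1pos one_pos ?_ (hnone ▸ hmin) hnone'.ge
      hb hb' (fun l hl => (hempty l hl).elim) (fun l hl => (hempty l hl).elim)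
    intro o
    rw [h' o, h o]
    change _ = _ + _ * d.charSum (markedBandit n k) (S.1 \ d.G) S o
    ring
  · rw [← hval (d.w * d.e) rfl]
    refine klBound_markedBandit (d.disjoint_sdiff _) hsub hz hm1pos one_pos ?_ hnone'.ge (hnone ▸ hmin)
      hb' hb (fun l hl => (hempty l hl).elim) (fun l hl => (hempty l hl).elim)
    intro o
    rw [h' o, h o]
    change _ = _ + _ * d.charSum (markedBandit n k) (S.1 \ d.G) S o
    ring

/-- The relative entropy between a law with and without a character of weight `c` on `a` of the `k`
arms of the query. -/
def crossBound (a : ℕ) : ℝ :=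
  1 / 2 * (d.w * d.c * (1 / 2) ^ k) ^ 2 * (1 / (d.z + d.w * (1 / 2) ^ k) +
    a * markInt (a - 1) (k - a) ^ 2 /
      (d.w * ((1 - (1 / 2) ^ k) / k - d.c * (1 / 2) ^ k * markInt (a - 1) (k - a))) +
    (k - a : ℕ) * markInt a (k - a - 1) ^ 2 / (d.w * ((1 - (1 / 2) ^ k) / k)))

lemma markInt_nonneg (a b : ℕ) : 0 ≤ markInt a b := by
  refine intervalIntegral.integral_nonneg zero_le_one fun t ht => ?_
  have := ht.1
  have := sub_nonneg.2 ht.2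
  positivity

/-- The character now enters with a plus sign: it lowers only the marks in `A`, and `hpos` says that
what remains of them is positive. -/
lemma klBound_cross (hG : d.G = ∅) (hz : 0 ≤ d.z) {S : KSet n k} {A : Finset (Fin n)} (hA : A ⊆ S.1)
    (hpos : 0 < (1 - (1 / 2) ^ k) / k - d.c * (1 / 2) ^ k * markInt (A.card - 1) (k - A.card))
    {ν ν' : PMF (Rewards n)}
    (h : ∀ o, obsProb (markedBandit n k) ν S o = d.baseProb (markedBandit n k) S o)
    (h' : ∀ o, obsProb (markedBandit n k) ν' S o = d.baseProb (markedBandit n k) S o +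
      d.w * d.c * d.charSum (markedBandit n k) A S o) :
    KLBound (obsProb (markedBandit n k) ν S) (obsProb (markedBandit n k) ν' S)
      (d.crossBound A.card) := by
  have hw := d.w_pos
  have hc := d.c_nonneg
  have hk : 0 < k := by have := d.G_card; omega
  have hk' : (0 : ℝ) < k := by exact_mod_cast hk
  have hS0 : S.1 \ d.G = S.1 := by simp [hG]
  have hS : d.G ⊆ S.1 := by simp [hG]
  have hdisj : Disjoint A d.G := by simp [hG]
  have hr : k - d.G.card = k := by simp [hG]
  have hT1 := d.half_pow_lt_one
  rw [hr] at hT1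
  have hT0 : (0 : ℝ) < (1 / 2) ^ k := by positivity
  have hm0 : 0 < d.z + d.w * (1 / 2) ^ k := by positivity
  have hmB : 0 < d.w * ((1 - (1 / 2) ^ k) / k) := by
    have : (0 : ℝ) < 1 - (1 / 2) ^ k := by linarith
    positivity
  have hJ := markInt_nonneg (A.card - 1) (k - A.card)
  have hnone : obsProb (markedBandit n k) ν S (none : Option (Fin n)) = d.z + d.w * (1 / 2) ^ k := by
    rw [h (none : Option (Fin n)), d.baseProb_none hS, hr]
  have hb : ∀ l ∈ S.1, d.w * ((1 - (1 / 2) ^ k) / k) ≤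
      obsProb (markedBandit n k) ν S (some l : Option (Fin n)) := by
    intro l hl
    have := d.baseProb_some_ge (S := S) (l := l) (by rwa [hS0])
    rw [hS0, S.2] at this
    rwa [h (some l : Option (Fin n))]
  have hle : d.w * ((1 - (1 / 2) ^ k) / k - d.c * (1 / 2) ^ k * markInt (A.card - 1) (k - A.card)) ≤
      d.w * ((1 - (1 / 2) ^ k) / k) := by
    have : 0 ≤ d.w * (d.c * (1 / 2) ^ k * markInt (A.card - 1) (k - A.card)) := by positivity
    linarith
  have hAle := Finset.card_le_card hA
  rw [S.2] at hAle
  have hmain := klBound_markedBandit (ν := ν) (ν' := ν') (β := d.w * d.c) hdisj hA hm0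
    (mul_pos hw hpos) hmB (fun o => by rw [h' o, h o]; rfl) hnone.ge ?_
    (fun l hl => hle.trans (hb l (hA hl))) ?_
    (fun l hl => hb l (by simpa [hS0] using (Finset.mem_sdiff.1 hl).1)) ?_
  · rw [hS0, S.2] at hmain
    exact hmain
  · rw [h' (none : Option (Fin n)), ← h (none : Option (Fin n)), hnone, d.charSum_none hdisj, if_pos hA]
    have : 0 ≤ d.w * d.c * (1 / 2) ^ (S.1 \ d.G).card := by positivity
    linarith
  · intro l hl
    have hlS : l ∈ S.1 \ d.G := by rw [hS0]; exact hA hl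
    have hpos' : 0 < A.card := Finset.card_pos.2 ⟨l, hl⟩
    have e : k - 1 - (A.card - 1) = k - A.card := by omega
    rw [h' (some l : Option (Fin n)), d.charSum_some hdisj hlS hA, if_pos hl, Finset.card_erase_of_mem hl,
      hS0, S.2, e]
    have := hb l (hA hl)
    rw [h (some l : Option (Fin n))] at this
    linarith
  · intro l hl
    obtain ⟨h1, h2⟩ := Finset.mem_sdiff.1 hl
    rw [h' (some l : Option (Fin n)), d.charSum_some hdisj h1 hA, if_neg h2]
    have := hb l (by rwa [hS0] at h1)
    rw [h (some l : Option (Fin n))] at this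
    have h3 := markInt_nonneg (A.erase l).card ((S.1 \ d.G).card - 1 - (A.erase l).card)
    have : 0 ≤ d.w * d.c * (1 * (1 / 2) ^ (S.1 \ d.G).card *
      markInt (A.erase l).card ((S.1 \ d.G).card - 1 - (A.erase l).card)) := by positivity
    linarith

/-- With `u` the law of the observation under `unifOff`, the two laws differ by `w * b * u` with a
sign, and `w * u` or `w * u * (1 - b)` is a common minorant according to the sign. The signs balance
under `u`, so the average of `1` and `1 / (1 - b)` appears. -/
lemma klBound_semiBandit {S : KSet n k} {A : Finset (Fin n)} (hA : A ⊆ S.1) (hne : ∃ i ∈ A, i ∉ d.G)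
    {b η : ℝ} (hb : 0 ≤ b) (hb1 : b < 1) (hη : η = 1 ∨ η = -1) {ν ν' : PMF (Rewards n)}
    (h : ∀ o, obsProb (semiBandit n k) ν S o = d.baseProb (semiBandit n k) S o)
    (h' : ∀ o, obsProb (semiBandit n k) ν' S o = d.baseProb (semiBandit n k) S o +
      d.w * (η * b) * d.charSum (semiBandit n k) A S o) :
    KLBound (obsProb (semiBandit n k) ν S) (obsProb (semiBandit n k) ν' S)
      (1 / 4 * d.w * b ^ 2 * (1 / (1 - b) + 1)) ∧
    KLBound (obsProb (semiBandit n k) ν' S) (obsProb (semiBandit n k) ν S)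
      (1 / 4 * d.w * b ^ 2 * (1 / (1 - b) + 1)) := by
  classical
  have hw := d.w_pos
  set u : (Fin n → Option Bool) → ℝ := obsSum (semiBandit n k) (unifOff d.G) S with hu
  set s : (Fin n → Option Bool) → ℝ := fun y => η * obsChi A y with hs
  have hu0 : ∀ y, 0 ≤ u y := fun y => obsSum_nonneg (semiBandit n k) (unifOff_nonneg d.G) S y
  have hs1 : ∀ y, s y = 1 ∨ s y = -1 := by
    intro y
    rcases hη with h | h <;> rcases obsChi_eq A y with h2 | h2 <;> simp [hs, h, h2]
  have hsu : ∑ y, s y * u y = 0 := by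
    set v : (Fin n → Option Bool) → ℝ :=
      obsSum (semiBandit n k) (fun x => unifOff d.G x * chi A x) S with hv
    have h1 : ∑ y, v y = 0 :=
      (sum_obsSum (semiBandit n k) (fun x => unifOff d.G x * chi A x) S).trans (sum_unifOff_mul_chi hne)
    have h2 : ∀ y, s y * u y = η * v y := by
      intro y
      rw [hv, obsSum_semiBandit hA]
      simp only [hs, hu]
      ring
    simp only [h2]
    rw [← Finset.mul_sum, h1, mul_zero]
  have hu1 : ∑ y, u y = 1 := by
    have h1 := sum_obsSum (semiBandit n k) (unifOff d.G) S
    rwa [sum_unifOff] at h1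
  set p : (Fin n → Option Bool) → ℝ := obsProb (semiBandit n k) ν S with hp
  set q : (Fin n → Option Bool) → ℝ := obsProb (semiBandit n k) ν' S with hq
  have hpu : ∀ y, d.w * u y ≤ p y := by
    intro y
    rw [h y]
    exact le_add_of_nonneg_left (d.obsSum_Q_nonneg (semiBandit n k) S y)
  have hqp : ∀ y, q y = p y + d.w * b * (s y * u y) := by
    intro y
    have e : d.charSum (semiBandit n k) A S y = obsChi A y * u y := obsSum_semiBandit hA y
    rw [h' y, ← h y, e]
    simp only [hs]
    ring
  set m : (Fin n → Option Bool) → ℝ := fun y => d.w * u y * (if s y = 1 then 1 else 1 - b) with hm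
  have hmp : ∀ y, m y ≤ p y := by
    intro y
    refine le_trans ?_ (hpu y)
    refine mul_le_of_le_one_right (mul_nonneg hw.le (hu0 y)) ?_
    split_ifs <;> linarith
  have hmq : ∀ y, m y ≤ q y := by
    intro y
    rw [hqp]
    have h1 := hpu y
    have h2 := mul_nonneg (mul_nonneg hw.le (hu0 y)) hb
    rcases hs1 y with h3 | h3
    · simp only [hm, h3, if_true]
      linarith
    · simp only [hm, h3]
      norm_num
      linarith
  have hm0 : ∀ y, p y ≠ q y → 0 < m y := by
    intro y hy
    have : u y ≠ 0 := fun h0 => hy (by rw [hqp, h0]; ring)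
    have := (hu0 y).lt_of_ne' this
    simp only [hm]
    split_ifs
    · positivity
    · have := sub_pos.2 hb1
      positivity
  have hsum : ∑ y, (p y - q y) ^ 2 / m y ≤ 2 * (1 / 4 * d.w * b ^ 2 * (1 / (1 - b) + 1)) := by
    have h1 : ∀ y, (p y - q y) ^ 2 / m y =
        d.w * b ^ 2 * ((1 / (1 - b) + 1) / 2) * u y + d.w * b ^ 2 * ((1 - 1 / (1 - b)) / 2) * (s y * u y) := by
      intro y
      have h1b : 1 - b ≠ 0 := by linarith
      by_cases h0 : u y = 0
      · rw [hqp, h0]; simp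
      rw [hqp]
      rcases hs1 y with h3 | h3
      · simp only [hm, h3, if_true]
        field_simp
        ring
      · simp only [hm, h3]
        norm_num
        field_simp
        ring
    simp only [h1, Finset.sum_add_distrib, ← Finset.mul_sum, hsu, hu1]
    apply le_of_eq
    ring
  have hp1 : ∑ y, p y = 1 := sum_obsProb (F := semiBandit n k) ν S
  have hq1 : ∑ y, q y = 1 := sum_obsProb (F := semiBandit n k) ν' S
  constructor
  · exact klBound_of_sum_le (α := Fin n → Option Bool) (fun y => obsProb_nonneg _ _ _) hp1 hq1 hmp hmq hm0 hsum
  · refine klBound_of_sum_le (α := Fin n → Option Bool) (fun y => obsProb_nonneg _ _ _) hq1 hp1 hmq hmp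
      (fun y hy => hm0 y hy.symm) ?_
    simp only [sub_sq_comm (q _)]
    exact hsum

/-- With `G` empty, a query reveals at most one of the differences between the main distribution
and a perturbed one. -/
lemma klBound_isAlt (hG : d.G = ∅) {F : Feedback n k} [Fintype F.Obs]
    (hF : ∀ (A : Finset (Fin n)) (S : KSet n k) (o : F.Obs), ¬ A ⊆ S.1 → d.charSum F A S o = 0)
    {κo κc : ℝ} {S : KSet n k}
    (hown : ∀ (S : KSet n k) (ν ν' : PMF (Rewards n)), (∀ o, obsProb F ν S o = d.baseProb F S o) →
      (∀ o, obsProb F ν' S o = d.baseProb F S o - d.w * d.e * d.charSum F S.1 S o) →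
      KLBound (obsProb F ν S) (obsProb F ν' S) κo ∧ KLBound (obsProb F ν' S) (obsProb F ν S) κo)
    (hcross : ∀ (S' : KSet n k) (ν ν' : PMF (Rewards n)), S ≠ d.best → symmDiff d.best.1 S.1 ⊆ S'.1 →
      (∀ o, obsProb F ν S' o = d.baseProb F S' o) → (∀ o, obsProb F ν' S' o = d.baseProb F S' o +
        d.w * d.c * d.charSum F (symmDiff d.best.1 S.1) S' o) →
      KLBound (obsProb F ν S') (obsProb F ν' S') κc)
    {ν ν' : PMF (Rewards n)} (hν : d.IsMain ν) (hν' : d.IsAlt S ν') (S' : KSet n k) :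
    KLBound (obsProb F ν S') (obsProb F ν' S') (if S' = S then κo else
      if S ≠ d.best ∧ symmDiff d.best.1 S.1 ⊆ S'.1 then κc else 0) := by
  have hsd : ∀ S : KSet n k, S.1 \ d.G = S.1 := fun S => by simp [hG]
  have hsubset : ∀ S S' : KSet n k, S.1 ⊆ S'.1 → S' = S := fun S S' h =>
    d.eq_of_sdiff_subset (by simp [hG]) (by rwa [hsd])
  have h1 := fun o => hν F S' o
  have h2 := fun o => hν' F S' o
  simp only [hsd] at h1 h2
  have hself : KLBound (obsProb F ν S') (obsProb F ν S') 0 :=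
    klBound_self (fun o => obsProb_nonneg _ _ _) (sum_obsProb _ _)
  split_ifs with hS hc
  · subst hS
    by_cases hb : S' = d.best
    -- For the best set the roles are exchanged: the main law carries the character and the
    -- alternative does not.
    · refine (hown S' ν' ν (fun o => (h2 o).1 hb) fun o => ?_).2
      rw [h1 o, hb]
    · have hn : ¬ d.best.1 ⊆ S'.1 := fun h => hb (hsubset _ _ h)
      refine (hown S' ν ν' (fun o => ?_) fun o => ?_).1
      · rw [h1 o, hF _ _ _ hn]
        ring
      · rw [(h2 o).2 hb, hF _ _ _ hn, hF (symmDiff _ _)]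
        · ring
        · intro h
          refine hn fun i hi => ?_
          by_cases hi' : i ∈ S'.1
          · exact hi'
          · exact h (Finset.mem_symmDiff.2 (Or.inl ⟨hi, hi'⟩))
  · obtain ⟨hb, hc⟩ := hc
    have hnS : ¬ S.1 ⊆ S'.1 := fun h => hS (hsubset _ _ h)
    have hn : ¬ d.best.1 ⊆ S'.1 := by
      intro h
      refine hnS fun i hi => ?_
      by_cases hi' : i ∈ d.best.1
      · exact h hi'
      · exact hc (Finset.mem_symmDiff.2 (Or.inr ⟨hi, hi'⟩))
    refine hcross S' ν ν' hb hc (fun o => ?_) fun o => ?_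
    · rw [h1 o, hF _ _ _ hn]
      ring
    · rw [(h2 o).2 hb, hF _ _ _ hn, hF _ _ _ hnS]
      ring
  · have hnS : ¬ S.1 ⊆ S'.1 := fun h => hS (hsubset _ _ h)
    have he : obsProb F ν' S' = obsProb F ν S' := by
      funext o
      by_cases hb : S = d.best
      · have hn : ¬ d.best.1 ⊆ S'.1 := hb ▸ hnS
        rw [(h2 o).1 hb, h1 o, hF _ _ _ hn]
        ring
      · have hn : ¬ symmDiff d.best.1 S.1 ⊆ S'.1 := fun h => hc ⟨hb, h⟩
        rw [(h2 o).2 hb, h1 o, hF _ _ _ hnS, hF _ _ _ hn]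
        ring
    rw [he]
    exact hself

end Design

/-! ### Lower bounds uniform in `δ` -/

section Requirements

variable {n k : ℕ}

/-- `F` requires `M log (1 / (2 δ))` observations to be `δ`-correct, for all `δ`. -/
def HardFor (F : Feedback n k) (ν : PMF (Rewards n)) (M : ℝ) : Prop :=
  ∀ δ : ℝ, 0 < δ → RequiresObs F ν δ (M * Real.log (1 / (2 * δ)))

/-- The marked-bandit and bandit requirement. -/
def BanditHardFor (n k : ℕ) (ν : PMF (Rewards n)) (M : ℝ) : Prop :=
  HardFor (bandit n k) ν M ∧ HardFor (markedBandit n k) ν M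

lemma requiresObs_of_nonpos {F : Feedback n k} {ν : PMF (Rewards n)} {δ N : ℝ} (hN : N ≤ 0) :
    RequiresObs F ν δ N := fun A _ => by
  rw [ENNReal.ofReal_of_nonpos hN]
  exact zero_le

end Requirements

/-! ### Lower bounds from sums of relative entropies, and designs without common arms -/

namespace Design

variable {n k : ℕ} (d : Design n k)

lemma hardFor {F : Feedback n k} [Fintype F.Obs] {ν : PMF (Rewards n)} {ν' : KSet n k → PMF (Rewards n)}
    (I : Finset (KSet n k)) (hI : ∀ S ∈ I, d.G ⊆ S.1)
    (hν' : ∀ S ∈ I, d.IsAlt S (ν' S)) (ω : KSet n k → ℝ) (κ : KSet n k → KSet n k → ℝ)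
    {K M : ℝ} (hK : 0 < K) (hM : 0 ≤ M) (hω : ∀ S ∈ I, 0 ≤ ω S)
    (hκ : ∀ S ∈ I, ∀ S', KLBound (obsProb F ν S') (obsProb F (ν' S) S') (κ S S'))
    (hsum : ∀ S', ∑ S ∈ I, ω S * κ S S' ≤ K)
    (hMK : M * K ≤ ∑ S ∈ I, ω S) : HardFor F ν M := by
  intro δ hδ
  by_cases hL : 0 ≤ Real.log (1 / (2 * δ))
  · refine d.requiresObs I hI hν' ω κ hδ hK hω hκ hsum ?_
    exact mul_le_mul_of_nonneg_right ((le_div_iff₀ hK).2 hMK) hL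
  · exact requiresObs_of_nonpos (mul_nonpos_of_nonneg_of_nonpos hM (not_le.1 hL).le)

lemma banditHardFor {ν : PMF (Rewards n)} {ν' : KSet n k → PMF (Rewards n)}
    (I : Finset (KSet n k)) (hI : ∀ S ∈ I, d.G ⊆ S.1)
    (hν' : ∀ S ∈ I, d.IsAlt S (ν' S)) (ω : KSet n k → ℝ) (κ : KSet n k → KSet n k → ℝ)
    {K M : ℝ} (hK : 0 < K) (hM : 0 ≤ M) (hω : ∀ S ∈ I, 0 ≤ ω S)
    (hκ : ∀ S ∈ I, ∀ S', KLBound (obsProb (markedBandit n k) ν S') (obsProb (markedBandit n k) (ν' S) S')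
      (κ S S'))
    (hsum : ∀ S', ∑ S ∈ I, ω S * κ S S' ≤ K)
    (hMK : M * K ≤ ∑ S ∈ I, ω S) : BanditHardFor n k ν M :=
  ⟨d.hardFor I hI hν' ω κ hK hM hω
    (fun S hS S' => (hκ S hS S').of_map (Option.isSome (α := Fin n)) bandit_channel_eq_map) hsum hMK,
    d.hardFor I hI hν' ω κ hK hM hω hκ hsum hMK⟩

/-- The sum over the weighted perturbed distributions of the relative entropies for the query `S'`. -/
def colSum (ω : KSet n k → ℝ) (κo κx : ℝ) (S' : KSet n k) : ℝ :=
  ω S' * κo + κx * ∑ S with S ≠ d.best ∧ symmDiff d.best.1 S.1 ⊆ S'.1, ω S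

lemma sum_le_colSum {ω : KSet n k → ℝ} (hω : ∀ S, 0 ≤ ω S) {κo κx : ℝ} (hκo : 0 ≤ κo) (hκx : 0 ≤ κx)
    (I : Finset (KSet n k)) (S' : KSet n k) :
    ∑ S ∈ I, ω S * (if S' = S then κo else
      if S ≠ d.best ∧ symmDiff d.best.1 S.1 ⊆ S'.1 then κx else 0) ≤ d.colSum ω κo κx S' := by
  have h1 : ∀ S, ω S * (if S' = S then κo else
      if S ≠ d.best ∧ symmDiff d.best.1 S.1 ⊆ S'.1 then κx else 0) ≤
      (if S' = S then ω S * κo else 0) + κx * (if S ≠ d.best ∧ symmDiff d.best.1 S.1 ⊆ S'.1 then ω S else 0) := by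
    intro S
    have h2 := hω S
    have h3 := mul_nonneg hκx h2
    split_ifs <;> linarith
  have h0 : ∀ S, 0 ≤ ω S * (if S' = S then κo else
      if S ≠ d.best ∧ symmDiff d.best.1 S.1 ⊆ S'.1 then κx else 0) := by
    intro S
    have := hω S
    split_ifs <;> positivity
  refine (Finset.sum_le_sum_of_subset_of_nonneg (Finset.subset_univ I) fun S _ _ => h0 S).trans ?_
  refine (Finset.sum_le_sum fun S _ => h1 S).trans (le_of_eq ?_)
  rw [Finset.sum_add_distrib, ← Finset.mul_sum, Finset.sum_ite_eq, if_pos (Finset.mem_univ _), colSum,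
    ← Finset.sum_filter]

/-- The semi-bandit relative entropy for a character of weight `b`. -/
def semiVal (w b : ℝ) : ℝ := 1 / 4 * w * b ^ 2 * (1 / (1 - b) + 1)

lemma semiVal_nonneg {w b : ℝ} (hw : 0 ≤ w) (hb : b < 1) : 0 ≤ semiVal w b := by
  have := sub_pos.2 hb
  unfold semiVal
  positivity

lemma card_symmDiff_le {S S' : KSet n k} (h : symmDiff d.best.1 S.1 ⊆ S'.1) :
    (symmDiff d.best.1 S.1).card ≤ k := by
  have := Finset.card_le_card h
  rwa [S'.2] at this

lemma charSum_markedBandit_eq_zero {A : Finset (Fin n)} (hA : Disjoint A d.G) (S : KSet n k)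
    (o : (markedBandit n k).Obs) (hS : ¬ A ⊆ S.1) : d.charSum (markedBandit n k) A S o = 0 :=
  obsSum_markedBandit_eq_zero hA hS o

lemma charSum_semiBandit_eq_zero {A : Finset (Fin n)} (hA : Disjoint A d.G) (S : KSet n k)
    (o : (semiBandit n k).Obs) (hS : ¬ A ⊆ S.1) : d.charSum (semiBandit n k) A S o = 0 :=
  obsSum_semiBandit_eq_zero hA hS o

/-- The alternatives of weight zero are discarded, so that the bound `κx` on a visible symmetric
difference is needed only for those that are used. -/
lemma banditHardFor_of_colSum (hG : d.G = ∅) (hz : 0 ≤ d.z) (he : d.e < 1) {ν : PMF (Rewards n)}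
    (hν : d.IsMain ν) {ω : KSet n k → ℝ} (hω : ∀ S, 0 ≤ ω S) {κx : ℝ} (hκx : 0 ≤ κx)
    (hcross : ∀ S, ω S ≠ 0 → S ≠ d.best → (symmDiff d.best.1 S.1).card ≤ k →
      0 < (1 - (1 / 2) ^ k) / k - d.c * (1 / 2) ^ k *
        markInt ((symmDiff d.best.1 S.1).card - 1) (k - (symmDiff d.best.1 S.1).card) ∧
      d.crossBound (symmDiff d.best.1 S.1).card ≤ κx)
    {K M : ℝ} (hK : 0 < K) (hM : 0 ≤ M) (hsum : ∀ S', d.colSum ω d.ownBound κx S' ≤ K)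
    (hMK : M * K ≤ ∑ S, ω S) : BanditHardFor n k ν M := by
  classical
  have hw := d.w_pos
  have he1 := sub_pos.2 he
  have hT := sub_pos.2 d.half_pow_lt_one
  choose ν' hν' using d.exists_isAlt
  have hown0 : 0 ≤ d.ownBound := by
    have h0 : (0 : ℝ) < 1 - d.e := he1
    have h1 : (0 : ℝ) < 1 - (1 / 2) ^ (k - d.G.card) := hT
    unfold ownBound
    positivity
  have hz0 : 0 < d.z + d.w * (1 / 2) ^ (k - d.G.card) * (1 - d.e) := by
    have h0 : (0 : ℝ) < 1 - d.e := he1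
    positivity
  refine d.banditHardFor (Finset.univ.filter fun S => ω S ≠ 0) (fun S _ => by simp [hG])
    (fun S _ => hν' S) ω (fun S S' => if S' = S then d.ownBound else
      if S ≠ d.best ∧ symmDiff d.best.1 S.1 ⊆ S'.1 then κx else 0) hK hM (fun S _ => hω S) ?_
    (fun S' => (d.sum_le_colSum hω hown0 hκx _ S').trans (hsum S')) ?_
  · intro S hS S'
    have hS0 : ω S ≠ 0 := by simpa using hS
    refine d.klBound_isAlt hG (F := markedBandit n k)
      (fun A => d.charSum_markedBandit_eq_zero (by simp [hG])) ?_ ?_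
      hν (hν' S) S'
    · intro S ν ν' h h'
      have hsd : S.1 \ d.G = S.1 := by simp [hG]
      refine d.klBound_own (by simp [hG]) hz0 h ?_
      rw [hsd]
      exact h'
    · intro S' ν ν' hb hsub h h'
      obtain ⟨h1, h2⟩ := hcross S hS0 hb (d.card_symmDiff_le hsub)
      exact (d.klBound_cross hG hz hsub h1 h h').mono h2
  · rw [Finset.sum_filter_ne_zero]
    exact hMK

lemma semiHardFor_of_colSum (hG : d.G = ∅) (he : d.e < 1) (hc : d.c < 1) {ν : PMF (Rewards n)}
    (hν : d.IsMain ν) {ω : KSet n k → ℝ} (hω : ∀ S, 0 ≤ ω S)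
    {K M : ℝ} (hK : 0 < K) (hM : 0 ≤ M)
    (hsum : ∀ S', d.colSum ω (semiVal d.w d.e) (semiVal d.w d.c) S' ≤ K)
    (hMK : M * K ≤ ∑ S, ω S) : HardFor (semiBandit n k) ν M := by
  have hw := d.w_pos
  choose ν' hν' using d.exists_isAlt
  refine d.hardFor Finset.univ (fun S _ => by simp [hG])
    (fun S _ => hν' S) ω (fun S S' => if S' = S then semiVal d.w d.e else
      if S ≠ d.best ∧ symmDiff d.best.1 S.1 ⊆ S'.1 then semiVal d.w d.c else 0) hK hM (fun S _ => hω S) ?_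
    (fun S' => (d.sum_le_colSum hω (semiVal_nonneg hw.le he) (semiVal_nonneg hw.le hc) _ S').trans (hsum S'))
    hMK
  intro S _ S'
  refine d.klBound_isAlt hG (F := semiBandit n k)
    (fun A => d.charSum_semiBandit_eq_zero (by simp [hG])) ?_ ?_
    hν (hν' S) S'
  · intro S ν ν' h h'
    refine d.klBound_semiBandit (A := S.1) (η := -1) subset_rfl ?_ d.e_pos.le he (Or.inr rfl) h fun o => ?_
    · obtain ⟨i, hi, hi'⟩ := d.exists_mem_sdiff S
      exact ⟨i, (Finset.mem_sdiff.1 hi).1, hi'⟩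
    · rw [h' o]
      ring
  · intro S' ν ν' hb hsub h h'
    refine (d.klBound_semiBandit (η := 1) hsub ?_ d.c_nonneg hc (Or.inl rfl) h fun o => ?_).1
    · have hne : (symmDiff d.best.1 S.1).Nonempty := by
        rw [Finset.nonempty_iff_ne_empty, Ne, ← Finset.bot_eq_empty, symmDiff_eq_bot]
        exact fun h => hb (Subtype.ext h.symm)
      obtain ⟨i, hi⟩ := hne
      exact ⟨i, hi, by simp [hG]⟩
    · rw [h' o, one_mul]

/-- The designs in which no arm is distinguished: the rewards vanish with probability `1 - w`. -/
def ofEmpty (hk : 0 < k) (hkn : k < n) (best : KSet n k) (w e c : ℝ) (hw : 0 < w) (hw1 : w ≤ 1)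
    (he : 0 < e) (he1 : e ≤ 1) (hc : 0 ≤ c) (hc1 : c ≤ 1) (hec : 2 * e - 1 ≤ c) : Design n k where
  Q x := if x = (fun _ => false) then 1 - w else 0
  w := w
  G := ∅
  best := best
  e := e
  c := c
  z := 1 - w
  k_lt := hkn
  Q_nonneg x := by split_ifs <;> linarith
  w_pos := hw
  sum_Q := by simp
  G_subset := Finset.empty_subset _
  G_card := by simpa using hk
  e_pos := he
  e_le := he1
  c_nonneg := hc
  c_le := hc1
  two_e_le := hec
  z_eq S _ := by
    simp only [obsSum]
    rw [Finset.sum_eq_single fun _ => false, toReal_markedBandit_none]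
    · simp
    · intro x _ hx
      rw [if_neg hx, zero_mul]
    · simp
  z_le S h := (h (Finset.empty_subset _)).elim

end Design

/-! ### Counting `k`-sets -/

section Counting

variable {n k : ℕ}

lemma card_kSet (n k : ℕ) : Fintype.card (KSet n k) = n.choose k := by
  simp [Fintype.card_finset_len]

lemma exists_kSet (hkn : k ≤ n) : Nonempty (KSet n k) := by
  rw [← Fintype.card_pos_iff, card_kSet]
  exact Nat.choose_pos hkn

lemma card_filter_subset (B : Finset (Fin n)) :
    (Finset.univ.filter fun S : KSet n k => S.1 ⊆ B).card = B.card.choose k := by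
  rw [← Finset.card_powersetCard, ← Finset.card_map (Function.Embedding.subtype _)]
  congr 1
  ext S
  simp only [Finset.mem_map, Finset.mem_filter, Finset.mem_univ, true_and,
    Function.Embedding.coe_subtype, Finset.mem_powersetCard]
  constructor
  · rintro ⟨T, h, rfl⟩
    exact ⟨h, T.2⟩
  · rintro ⟨h1, h2⟩
    exact ⟨⟨S, h2⟩, h1, rfl⟩

/-- Among the `k`-sets that agree with `R` off `S'`, the number of those other than `R`. -/
lemma card_filter_symmDiff_subset_le (R S' : KSet n k) :
    (Finset.univ.filter fun S : KSet n k => S ≠ R ∧ symmDiff R.1 S.1 ⊆ S'.1).card ≤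
      k.choose (k / 2) - 1 := by
  set E := Finset.univ.filter fun S : KSet n k => symmDiff R.1 S.1 ⊆ S'.1 with hE
  have hR : R ∈ E := by simp [hE]
  have h1 : (Finset.univ.filter fun S : KSet n k => S ≠ R ∧ symmDiff R.1 S.1 ⊆ S'.1) = E.erase R := by
    ext S
    simp [hE]
  rw [h1, Finset.card_erase_of_mem hR]
  refine Nat.sub_le_sub_right ?_ 1
  -- Such an `S` agrees with `R` outside `S'`, so it is determined by `S ∩ S'`, a subset of `S'` of
  -- prescribed size.
  have houtside : ∀ S ∈ E, S.1 \ S'.1 = R.1 \ S'.1 := by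
    intro S hS
    have hS' : symmDiff R.1 S.1 ⊆ S'.1 := by simpa [hE] using hS
    ext i
    simp only [Finset.mem_sdiff]
    refine and_congr_left fun hi => ?_
    have := mt (@hS' i) hi
    rw [Finset.mem_symmDiff] at this
    tauto
  have hcard : ∀ S ∈ E, (S.1 ∩ S'.1).card = (R.1 ∩ S'.1).card := by
    intro S hS
    have h2 := Finset.card_inter_add_card_sdiff S.1 S'.1
    have h3 := Finset.card_inter_add_card_sdiff R.1 S'.1
    rw [houtside S hS, S.2] at h2
    rw [R.2] at h3
    omega
  have hmaps : Set.MapsTo (fun S : KSet n k => S.1 ∩ S'.1) E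
      (Finset.powersetCard (R.1 ∩ S'.1).card S'.1) := by
    intro S hS
    exact Finset.mem_coe.2 (Finset.mem_powersetCard.2 ⟨Finset.inter_subset_right, hcard S hS⟩)
  have hinj : Set.InjOn (fun S : KSet n k => S.1 ∩ S'.1) E := by
    intro S hS T hT h
    have h2 : S.1 \ S'.1 = T.1 \ S'.1 := (houtside S hS).trans (houtside T hT).symm
    refine Subtype.ext ?_
    rw [← Finset.sdiff_union_inter S.1 S'.1, ← Finset.sdiff_union_inter T.1 S'.1, h2]
    exact congrArg _ h
  refine (Finset.card_le_card_of_injOn _ hmaps hinj).trans ?_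
  rw [Finset.card_powersetCard, S'.2]
  exact Nat.choose_le_middle _ _

lemma card_symmDiff (R S : KSet n k) : (symmDiff R.1 S.1).card + 2 * (S.1 ∩ R.1).card = 2 * k := by
  have h1 := Finset.card_inter_add_card_sdiff S.1 R.1
  have h2 := Finset.card_inter_add_card_sdiff R.1 S.1
  rw [Finset.inter_comm] at h2
  rw [S.2] at h1
  rw [R.2] at h2
  have h3 : (symmDiff R.1 S.1).card = (R.1 \ S.1).card + (S.1 \ R.1).card := by
    rw [symmDiff_def, Finset.sup_eq_union, Finset.card_union_of_disjoint disjoint_sdiff_sdiff]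
  omega

/-- The weight that favours the `k`-sets which meet `R` in less than half of their arms. -/
def farWeight (R S : KSet n k) : ℝ :=
  if 2 * (S.1 ∩ R.1).card < k then 1 else if 2 * (S.1 ∩ R.1).card = k then 1 / 2 else 0

lemma farWeight_nonneg (R S : KSet n k) : 0 ≤ farWeight R S := by
  unfold farWeight
  split_ifs <;> norm_num

lemma farWeight_le_one (R S : KSet n k) : farWeight R S ≤ 1 := by
  unfold farWeight
  split_ifs <;> norm_num

lemma farWeight_ne_zero {R S : KSet n k} (h : farWeight R S ≠ 0) : 2 * (S.1 ∩ R.1).card ≤ k := by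
  unfold farWeight at h
  split_ifs at h with h1 h2
  · exact h1.le
  · exact h2.le
  · exact (h rfl).elim

/-- Disjoint sets share at most `k` arms of `R` between them: if one takes more than half, the other
takes less than half and has weight `1`, and the value `1 / 2` at exactly half covers the balanced
case. -/
lemma one_le_farWeight_add {R S T : KSet n k} (h : Disjoint S.1 T.1) :
    1 ≤ farWeight R S + farWeight R T := by
  have hle : (S.1 ∩ R.1).card + (T.1 ∩ R.1).card ≤ k := by
    rw [← Finset.card_union_of_disjoint, ← Finset.union_inter_distrib_right]
    · exact (Finset.card_le_card Finset.inter_subset_right).trans R.2.le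
    · exact h.mono Finset.inter_subset_left Finset.inter_subset_left
  unfold farWeight
  split_ifs <;> first | omega | norm_num

/-- Sum `one_le_farWeight_add` over all ordered disjoint pairs. Every `k`-set lies in equally many
of them, a positive number because `2 * k ≤ n`. -/
lemma choose_le_two_mul_sum_farWeight (hn : 2 * k ≤ n) (R : KSet n k) :
    (n.choose k : ℝ) ≤ 2 * ∑ S, farWeight R S := by
  have hpart : ∀ S : KSet n k, (Finset.univ.filter fun T : KSet n k => Disjoint S.1 T.1).card =
      (n - k).choose k := by
    intro S
    have h := card_filter_subset (k := k) S.1ᶜ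
    rw [Finset.card_compl, S.2, Fintype.card_fin] at h
    rw [← h]
    congr 1
    ext T
    simp only [Finset.mem_filter, Finset.mem_univ, true_and]
    rw [disjoint_comm, Finset.subset_compl_iff_disjoint_right]
  have hm : 0 < (n - k).choose k := Nat.choose_pos (by omega)
  have hm' : (0 : ℝ) < ((n - k).choose k : ℕ) := by exact_mod_cast hm
  have h1 : ∑ S : KSet n k, ∑ T : KSet n k, (if Disjoint S.1 T.1 then (1 : ℝ) else 0) ≤
      ∑ S : KSet n k, ∑ T : KSet n k, (if Disjoint S.1 T.1 then farWeight R S + farWeight R T else 0) := by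
    refine Finset.sum_le_sum fun S _ => Finset.sum_le_sum fun T _ => ?_
    split_ifs with h
    · exact one_le_farWeight_add h
    · exact le_rfl
  have h2 : ∑ S : KSet n k, ∑ T : KSet n k, (if Disjoint S.1 T.1 then (1 : ℝ) else 0) =
      n.choose k * ((n - k).choose k : ℕ) := by
    simp_rw [Finset.sum_boole, hpart]
    simp [Finset.card_univ, Fintype.card_finset_len]
  have h3 : ∑ S : KSet n k, ∑ T : KSet n k, (if Disjoint S.1 T.1 then farWeight R S else 0) =
      (∑ S, farWeight R S) * ((n - k).choose k : ℕ) := by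
    rw [Finset.sum_mul]
    refine Finset.sum_congr rfl fun S _ => ?_
    rw [← Finset.sum_filter, Finset.sum_const, hpart, nsmul_eq_mul, mul_comm]
  have h4 : ∑ S : KSet n k, ∑ T : KSet n k, (if Disjoint S.1 T.1 then farWeight R T else 0) =
      (∑ S, farWeight R S) * ((n - k).choose k : ℕ) := by
    rw [Finset.sum_comm, ← h3]
    simp_rw [disjoint_comm]
  have h5 : ∑ S : KSet n k, ∑ T : KSet n k, (if Disjoint S.1 T.1 then farWeight R S + farWeight R T else 0) =
      2 * (∑ S, farWeight R S) * ((n - k).choose k : ℕ) := by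
    have : ∀ S T : KSet n k, (if Disjoint S.1 T.1 then farWeight R S + farWeight R T else 0) =
        (if Disjoint S.1 T.1 then farWeight R S else 0) + (if Disjoint S.1 T.1 then farWeight R T else 0) := by
      intro S T
      split_ifs <;> simp
    simp_rw [this, Finset.sum_add_distrib]
    rw [h3, h4]
    ring
  rw [h2, h5] at h1
  exact le_of_mul_le_mul_right h1 hm'

end Counting

/-! ### The two weightings of the alternatives -/

namespace Design

variable {n k : ℕ} (d : Design n k)

lemma colSum_one_le {κo κx : ℝ} (hκx : 0 ≤ κx) (S' : KSet n k) :
    d.colSum (fun _ => 1) κo κx S' ≤ κo + κx * (k.choose (k / 2) - 1 : ℕ) := by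
  rw [colSum, Finset.sum_const, nsmul_eq_mul, one_mul, mul_one]
  exact add_le_add_right (mul_le_mul_of_nonneg_left
    (by exact_mod_cast card_filter_symmDiff_subset_le d.best S') hκx) _

/-- A set of nonzero weight shares at most half of its arms with `best`, so the symmetric difference
has at least `k` arms and fits into `S'` only by being equal to it. Then `S'` determines the set,
and both it and `S'` share exactly half of their arms with `best`, so both have weight `1 / 2`. -/
lemma colSum_farWeight_le {κo κx K : ℝ} (hκo : 0 ≤ κo) (h1 : κo ≤ K)
    (h2 : 1 / 2 * κo + 1 / 2 * κx ≤ K) (S' : KSet n k) :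
    d.colSum (farWeight d.best) κo κx S' ≤ K := by
  rw [colSum]
  by_cases hex : ∃ S : KSet n k, (S ≠ d.best ∧ symmDiff d.best.1 S.1 ⊆ S'.1) ∧ farWeight d.best S ≠ 0
  · obtain ⟨S, ⟨hb, hsub⟩, hS⟩ := hex
    have key : ∀ T : KSet n k, symmDiff d.best.1 T.1 ⊆ S'.1 → farWeight d.best T ≠ 0 →
        symmDiff d.best.1 T.1 = S'.1 ∧ 2 * (T.1 ∩ d.best.1).card = k := by
      intro T hT hT0
      have h3 := farWeight_ne_zero hT0
      have h4 := card_symmDiff d.best T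
      have h5 := d.card_symmDiff_le hT
      refine ⟨Finset.eq_of_subset_of_card_le hT ?_, by omega⟩
      rw [S'.2]
      omega
    obtain ⟨hS1, hS2⟩ := key S hsub hS
    have hsum : ∑ T with T ≠ d.best ∧ symmDiff d.best.1 T.1 ⊆ S'.1, farWeight d.best T = 1 / 2 := by
      rw [Finset.sum_eq_single S]
      · unfold farWeight
        rw [if_neg (by omega), if_pos hS2]
      · intro T hT hne
        by_contra hT0
        have hT' : T ≠ d.best ∧ symmDiff d.best.1 T.1 ⊆ S'.1 := by simpa using hT
        have h3 := (key T hT'.2 hT0).1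
        rw [← hS1] at h3
        exact hne (Subtype.ext (symmDiff_right_injective _ h3))
      · intro h
        exact (h (by simpa using ⟨hb, hsub⟩)).elim
    have hS' : farWeight d.best S' = 1 / 2 := by
      have h3 : S'.1 ∩ d.best.1 = d.best.1 \ S.1 := by
        rw [← hS1]
        ext i
        simp only [Finset.mem_inter, Finset.mem_symmDiff, Finset.mem_sdiff]
        tauto
      have h4 := Finset.card_inter_add_card_sdiff d.best.1 S.1
      rw [Finset.inter_comm, d.best.2] at h4
      unfold farWeight
      rw [h3, if_neg (by omega), if_pos (by omega)]
    rw [hsum, hS']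
    linarith
  · push Not at hex
    rw [Finset.sum_eq_zero fun S hS => hex S (by simpa using hS), mul_zero, add_zero]
    have := farWeight_le_one d.best S'
    exact (mul_le_of_le_one_left hκo this).trans h1

end Design

/-! ### Small and moderate gaps -/

section EmptyDesigns

variable {n k : ℕ}

lemma half_pow_pos (k : ℕ) : (0 : ℝ) < (1 / 2) ^ k := by positivity

lemma half_pow_le {j k : ℕ} (h : j ≤ k) : ((1 : ℝ) / 2) ^ k ≤ (1 / 2) ^ j :=
  pow_le_pow_of_le_one (by norm_num) (by norm_num) h

namespace Design

lemma ofEmpty_isBest_and_gap (hk : 0 < k) (hkn : k < n) (best : KSet n k) (w e c : ℝ) (hw : 0 < w)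
    (hw1 : w ≤ 1) (he : 0 < e) (he1 : e ≤ 1) (hc : 0 ≤ c) (hc1 : c ≤ 1) (hec : 2 * e - 1 ≤ c)
    {ν : PMF (Rewards n)} (hν : (ofEmpty hk hkn best w e c hw hw1 he he1 hc hc1 hec).IsMain ν) :
    IsBest ν best ∧ gap ν best = w * e * (1 / 2) ^ k :=
  Design.isBest_and_gap _ hν

end Design

/-- The distributions without the correlation `c`, with the same weight for all perturbations. -/
lemma exists_hard_of_no_cross (hk : 2 ≤ k) (hkn : k < n) {w e : ℝ} (hw : 0 < w) (hw1 : w ≤ 1) (he : 0 < e)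
    (he1 : e ≤ 1 / 2) : ∃ (ν : PMF (Rewards n)) (S : KSet n k), IsBest ν S ∧
      gap ν S = w * e * (1 / 2) ^ k ∧
      (∀ B : ℝ, 0 ≤ B → 2 / 3 * B * (1 / ((1 - w) + w * (1 / 2) ^ k * (1 - e)) +
          1 / (w * (1 - (1 / 2) ^ k))) ≤ 1 →
        BanditHardFor n k ν (4 / 3 * B * (n.choose k : ℝ) * ((w * e * (1 / 2) ^ k) ^ 2)⁻¹)) ∧
      ∀ a : ℝ, 0 ≤ a → a * Design.semiVal w e ≤ 1 →
        HardFor (semiBandit n k) ν (a * (n.choose k : ℝ)) := by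
  obtain ⟨best⟩ := exists_kSet (n := n) hkn.le
  have hk0 : 0 < k := by omega
  set T : ℝ := (1 / 2) ^ k with hT
  have hT0 : 0 < T := half_pow_pos k
  have hT1 : T ≤ 1 / 4 := (half_pow_le hk).trans (by norm_num)
  set d := Design.ofEmpty hk0 hkn best w e 0 hw hw1 he (by linarith) le_rfl zero_le_one (by linarith) with hd
  obtain ⟨ν, hν⟩ := d.exists_isMain
  obtain ⟨hbest, hgap⟩ := Design.ofEmpty_isBest_and_gap _ _ _ _ _ _ _ _ _ _ _ _ _ hν
  have hsum1 : ∑ _S : KSet n k, (1 : ℝ) = n.choose k := by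
    simp [Finset.card_univ, Fintype.card_finset_len]
  have hz : 0 < (1 - w) + w * T * (1 - e) := by
    have : 0 < w * T * (1 - e) := mul_pos (mul_pos hw hT0) (by linarith)
    linarith
  have hT1' : 0 < 1 - T := by linarith
  refine ⟨ν, best, hbest, hgap, fun B hB hBX => ?_, fun a ha hav => ?_⟩
  · have hown : d.ownBound = 1 / 2 * (w * e * T) ^ 2 *
        (1 / ((1 - w) + w * T * (1 - e)) + 1 / (w * (1 - T))) := rfl
    have hpos : 0 < d.ownBound := by
      rw [hown]
      positivity
    refine d.banditHardFor_of_colSum rfl (by change 0 ≤ 1 - w; linarith) (by change e < 1; linarith) hν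
      (ω := fun _ => 1) (fun _ => zero_le_one) (κx := 0) le_rfl ?_ hpos (by positivity)
      (fun S' => (d.colSum_one_le le_rfl S').trans (by simp)) ?_
    · intro S _ _ _
      have hc : d.c = 0 := rfl
      refine ⟨?_, ?_⟩
      · rw [hc, zero_mul, zero_mul, sub_zero]
        exact div_pos hT1' (by exact_mod_cast hk0)
      · rw [Design.crossBound, hc]
        simp
    · rw [hsum1, hown]
      have hC : (0 : ℝ) ≤ n.choose k := Nat.cast_nonneg _
      have hwe : (w * e * T) ^ 2 ≠ 0 := by positivity
      calc _ = (n.choose k : ℝ) * (2 / 3 * B * (1 / ((1 - w) + w * T * (1 - e)) + 1 / (w * (1 - T)))) := by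
            field_simp
            ring
        _ ≤ n.choose k := mul_le_of_le_one_right hC hBX
  · have hv : 0 < Design.semiVal w e := by
      have : 0 < 1 - e := by linarith
      unfold Design.semiVal
      positivity
    refine d.semiHardFor_of_colSum rfl (by change e < 1; linarith) (by change (0 : ℝ) < 1; norm_num) hν
      (ω := fun _ => 1) (fun _ => zero_le_one) hv (by positivity) (fun S' => ?_) ?_
    · have h0 : Design.semiVal d.w d.c = 0 := by
        have hc : d.c = 0 := rfl
        simp [Design.semiVal, hc]
      rw [h0]
      refine (d.colSum_one_le le_rfl S').trans ?_
      rw [zero_mul, add_zero]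
      exact le_rfl
    · rw [hsum1]
      have hC : (0 : ℝ) ≤ n.choose k := Nat.cast_nonneg _
      calc _ = (n.choose k : ℝ) * (a * Design.semiVal w e) := by ring
        _ ≤ n.choose k := mul_le_of_le_one_right hC hav

/-- Some distribution with gap `D / 2 ^ k` is hard for all three kinds of feedback; the bandit bounds
are parametrized by a factor `B`. -/
def HasHard (n k : ℕ) (D : ℝ) : Prop :=
  ∃ (ν : PMF (Rewards n)) (S : KSet n k), IsBest ν S ∧ gap ν S = D * (1 / 2) ^ k ∧
    (∀ B : ℝ, 0 ≤ B → B ≤ (1 - D * (1 / 2) ^ k) ^ 2 / 4 →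
      ((1 / 2) ^ k ≤ D * (1 + D * (1 / 2) ^ k) / 2 →
        B ≤ ((1 / 2) ^ k / D - D * (1 / 2) ^ k) * (1 - (1 / 2) ^ k / D)) →
      BanditHardFor n k ν (4 / 3 * B * (n.choose k : ℝ) * ((D * (1 / 2) ^ k) ^ 2)⁻¹)) ∧
    HardFor (semiBandit n k) ν (2 / 3 * (1 - D) / D ^ 2 * (n.choose k : ℝ))

/-- Small gaps. -/
lemma exists_hard_small (hk : 2 ≤ k) (hkn : k < n) {D : ℝ} (hD : 0 < D) (hD1 : D ≤ 3 / 8) :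
    ∃ (ν : PMF (Rewards n)) (S : KSet n k), IsBest ν S ∧ gap ν S = D * (1 / 2) ^ k ∧
      (∀ B : ℝ, 0 ≤ B → B ≤ 1 / 4 →
        BanditHardFor n k ν (4 / 3 * B * (n.choose k : ℝ) * ((D * (1 / 2) ^ k) ^ 2)⁻¹)) ∧
      HardFor (semiBandit n k) ν (2 / 3 * (1 - D) / D ^ 2 * (n.choose k : ℝ)) := by
  obtain ⟨ν, S, h1, h2, h3, h4⟩ := exists_hard_of_no_cross (n := n) hk hkn (w := 3 / 4) (e := 4 * D / 3)
    (by norm_num) (by norm_num) (by linarith) (by linarith)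
  have e : (3 / 4 : ℝ) * (4 * D / 3) = D := by ring
  rw [e] at h2 h3
  have hT0 := half_pow_pos k
  have hT1 : ((1 : ℝ) / 2) ^ k ≤ 1 / 4 := (half_pow_le hk).trans (by norm_num)
  refine ⟨ν, S, h1, h2, fun B hB hB1 => h3 B hB ?_, h4 _ ?_ ?_⟩
  · set T : ℝ := (1 / 2) ^ k
    have hp : 0 ≤ 3 / 4 * T * (1 - 4 * D / 3) :=
      mul_nonneg (by positivity) (by linarith)
    -- The two reciprocals are at most `4` and `2`, and `2 / 3 * (1 / 4) * 6 = 1`.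
    have i1 : 1 / ((1 - 3 / 4) + 3 / 4 * T * (1 - 4 * D / 3)) ≤ 4 := by
      rw [div_le_iff₀ (by linarith)]
      linarith
    have i2 : 1 / (3 / 4 * (1 - T)) ≤ 2 := by
      rw [div_le_iff₀ (by linarith)]
      linarith
    nlinarith
  · have : 0 ≤ 1 - D := by linarith
    positivity
  · have hv : Design.semiVal (3 / 4) (4 * D / 3) ≤ D ^ 2 := by
      have i1 : 1 / (1 - 4 * D / 3) ≤ 2 := by
        rw [div_le_iff₀ (by linarith)]
        linarith
      unfold Design.semiVal
      nlinarith [sq_nonneg D]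
    calc _ ≤ 2 / 3 * (1 - D) / D ^ 2 * D ^ 2 := by
          refine mul_le_mul_of_nonneg_left hv ?_
          have : 0 ≤ 1 - D := by linarith
          positivity
      _ = 2 / 3 * (1 - D) := by field_simp
      _ ≤ 1 := by linarith

/-- Small gaps for semi-bandit feedback. -/
lemma exists_hard_semi (hk : 2 ≤ k) (hkn : k < n) {D : ℝ} (hD : 0 < D) (hD1 : D ≤ 1 / 2) :
    ∃ (ν : PMF (Rewards n)) (S : KSet n k), IsBest ν S ∧ gap ν S = D * (1 / 2) ^ k ∧
      HardFor (semiBandit n k) ν (1 / 3 * (D ^ 2)⁻¹ * (n.choose k : ℝ)) := by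
  obtain ⟨ν, S, h1, h2, -, h4⟩ := exists_hard_of_no_cross (n := n) hk hkn (w := 1) (e := D)
    (by norm_num) (by norm_num) hD hD1
  rw [one_mul] at h2
  refine ⟨ν, S, h1, h2, h4 _ (by positivity) ?_⟩
  have hv : Design.semiVal 1 D ≤ 3 * D ^ 2 := by
    have i1 : 1 / (1 - D) ≤ 2 := by
      rw [div_le_iff₀ (by linarith)]
      linarith
    unfold Design.semiVal
    nlinarith [sq_nonneg D]
  calc _ ≤ 1 / 3 * (D ^ 2)⁻¹ * (3 * D ^ 2) := mul_le_mul_of_nonneg_left hv (by positivity)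
    _ = 1 := by field_simp

lemma mul_mul_le_one {B X b c : ℝ} (hB0 : 0 ≤ B) (hB : B ≤ b) (hX : X ≤ c) (hX0 : 0 ≤ X)
    (h : 2 / 3 * b * c ≤ 1) : 2 / 3 * B * X ≤ 1 := by
  have h1 : B * X ≤ b * c := mul_le_mul hB hX hX0 (hB0.trans hB)
  linarith

/-- The three values of `T` belong to `k = 2`, `k = 3` and `k ≥ 4`. The first bound on `B` is enough
for `T = 1 / 4`. For `T ≤ 1 / 8` the premise of the second holds on the whole range of `D`, which is
cut at `0.41` so that crude decimal bounds on each factor suffice. -/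
lemma moderate_bound {T D B : ℝ} (hT0 : 0 < T) (hD : 3 / 8 ≤ D) (hD1 : D ≤ 9 / 20) (hB : 0 ≤ B)
    (hT : T = 1 / 4 ∨ T = 1 / 8 ∨ T ≤ 1 / 16) (hB1 : B ≤ (1 - D * T) ^ 2 / 4)
    (hB2 : T ≤ D * (1 + D * T) / 2 → B ≤ (T / D - D * T) * (1 - T / D)) :
    2 / 3 * B * (1 / ((1 - 2 * D) + 2 * D * T * (1 - 1 / 2)) + 1 / (2 * D * (1 - T))) ≤ 1 := by
  have hD0 : 0 < D := by linarith
  have hDT : 0 < D * T := by positivity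
  have hT4 : T ≤ 1 / 4 := by rcases hT with h | h | h <;> linarith
  have hX0 : 0 ≤ 1 / ((1 - 2 * D) + 2 * D * T * (1 - 1 / 2)) + 1 / (2 * D * (1 - T)) := by
    have h1 : 0 ≤ (1 - 2 * D) + 2 * D * T * (1 - 1 / 2) := by nlinarith
    have h2 : 0 ≤ 1 - T := by linarith
    positivity
  have hX : ∀ c₁ c₂ : ℝ, 0 < c₁ → 0 < c₂ → 1 ≤ c₁ * ((1 - 2 * D) + 2 * D * T * (1 - 1 / 2)) →
      1 ≤ c₂ * (2 * D * (1 - T)) →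
      1 / ((1 - 2 * D) + 2 * D * T * (1 - 1 / 2)) + 1 / (2 * D * (1 - T)) ≤ c₁ + c₂ := by
    intro c₁ c₂ h1 h2 h3 h4
    refine add_le_add ?_ ?_
    · rw [div_le_iff₀ (pos_of_mul_pos_right (zero_lt_one.trans_le h3) h1.le)]
      exact h3
    · rw [div_le_iff₀ (pos_of_mul_pos_right (zero_lt_one.trans_le h4) h2.le)]
      exact h4
  have hB2' : ∀ y v : ℝ, T ≤ 1 / 8 → 1 ≤ y * D → 1 - T / D ≤ v → B ≤ T * (y - D) * v := by
    intro y v hT8 hy hv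
    have h1 := hB2 (by nlinarith)
    have h2 : T / D ≤ T * y := by
      rw [div_le_iff₀ hD0]
      nlinarith
    have h3 : T / D ≤ 1 := by
      rw [div_le_one hD0]
      linarith
    have hy1 : D ≤ y := by nlinarith
    refine h1.trans (mul_le_mul (by linarith) hv (by linarith) ?_)
    have := sub_nonneg.2 hy1
    positivity
  rcases hT with rfl | rfl | hT
  -- This is `(1 - 3 / 32) ^ 2 / 4` rounded up, the value at `D = 3 / 8`.
  · have hb : B ≤ 0.2054 := by nlinarith
    exact mul_mul_le_one hB hb (hX 4.71 1.78 (by norm_num) (by norm_num) (by linarith) (by linarith)) hX0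
      (by norm_num)
  · have hv : 1 - 1 / 8 / D ≤ 13 / 18 := by
      have : (5 / 18 : ℝ) ≤ 1 / 8 / D := by
        rw [le_div_iff₀ hD0]
        linarith
      linarith
    rcases le_total D 0.41 with h | h
    · have hb := hB2' (8 / 3) _ le_rfl (by linarith) hv
      have hb' : B ≤ 0.207 := hb.trans (by nlinarith)
      exact mul_mul_le_one hB hb' (hX 4.33 1.53 (by norm_num) (by norm_num) (by linarith) (by linarith)) hX0
        (by norm_num)
    · have hb := hB2' 2.44 _ le_rfl (by linarith) hv
      have hb' : B ≤ 0.1834 := hb.trans (by nlinarith)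
      exact mul_mul_le_one hB hb' (hX 6.41 1.4 (by norm_num) (by norm_num) (by linarith) (by linarith)) hX0
        (by norm_num)
  · have hv : 1 - T / D ≤ 1 := by
      have : 0 ≤ T / D := by positivity
      linarith
    rcases le_total D 0.41 with h | h
    · have hb := hB2' (8 / 3) _ (by linarith) (by linarith) hv
      have hb' : B ≤ 0.1433 := hb.trans (by nlinarith)
      exact mul_mul_le_one hB hb' (hX 5.56 1.43 (by norm_num) (by norm_num) (by nlinarith) (by nlinarith)) hX0
        (by norm_num)
    · have hb := hB2' 2.44 _ (by linarith) (by linarith) hv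
      have hb' : B ≤ 0.127 := hb.trans (by nlinarith)
      exact mul_mul_le_one hB hb' (hX 10 1.31 (by norm_num) (by norm_num) (by nlinarith) (by nlinarith)) hX0
        (by norm_num)

/-- Moderate gaps. -/
lemma hasHard_moderate (hk : 2 ≤ k) (hkn : k < n) {D : ℝ} (hD : 3 / 8 ≤ D) (hD1 : D ≤ 9 / 20) :
    HasHard n k D := by
  obtain ⟨ν, S, h1, h2, h3, h4⟩ := exists_hard_of_no_cross (n := n) hk hkn (w := 2 * D) (e := 1 / 2)
    (by linarith) (by linarith) (by norm_num) (by norm_num)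
  have e : 2 * D * (1 / 2) = D := by ring
  rw [e] at h2 h3
  refine ⟨ν, S, h1, h2, fun B hB hB1 hB2 => h3 B hB ?_, h4 _ ?_ ?_⟩
  · have hT0 := half_pow_pos k
    have hD0 : 0 < D := by linarith
    refine moderate_bound hT0 hD hD1 hB ?_ hB1 hB2
    obtain rfl | rfl | hk4 : k = 2 ∨ k = 3 ∨ 4 ≤ k := by omega
    · left; norm_num
    · right; left; norm_num
    · right; right
      exact (half_pow_le hk4).trans (by norm_num)
  · have : 0 ≤ 1 - D := by linarith
    positivity
  · have hD0 : 0 < D := by linarith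
    have hv : Design.semiVal (2 * D) (1 / 2) = 3 / 8 * D := by
      unfold Design.semiVal
      ring
    rw [hv, div_mul_eq_mul_div, div_le_one (by positivity)]
    nlinarith

end EmptyDesigns

/-! ### Large gaps with many arms -/

section LargeGaps

variable {n k : ℕ}

/-- The relative entropy for the designs used for large gaps, up to the factor `Δ ^ 2 / 2`. -/
def largeOwn (T D : ℝ) : ℝ := (1 + 2 * D) * (1 / ((1 - D) * (1 + 2 * D * T)) + 1 / (3 * D * (1 - T)))

/-- The design used for large gaps. -/
def largeDesign (hk : 0 < k) (hkn : k < n) (best : KSet n k) (D : ℝ) (hD : 9 / 20 ≤ D) (hD1 : D < 1) :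
    Design n k :=
  Design.ofEmpty hk hkn best (3 * D / (1 + 2 * D)) ((1 + 2 * D) / 3) ((4 * D - 1) / 3)
    (div_pos (by linarith) (by linarith)) ((div_le_one (by linarith)).2 (by linarith)) (by linarith)
    (by linarith) (by linarith) (by linarith) (by linarith)

variable (hk : 0 < k) (hkn : k < n) (best : KSet n k) {D : ℝ} (hD : 9 / 20 ≤ D) (hD1 : D < 1)

lemma largeDesign_w : (largeDesign hk hkn best D hD hD1).w = 3 * D / (1 + 2 * D) := rfl
lemma largeDesign_e : (largeDesign hk hkn best D hD hD1).e = (1 + 2 * D) / 3 := rfl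
lemma largeDesign_c : (largeDesign hk hkn best D hD hD1).c = (4 * D - 1) / 3 := rfl
lemma largeDesign_z : (largeDesign hk hkn best D hD hD1).z = 1 - 3 * D / (1 + 2 * D) := rfl
lemma largeDesign_G : (largeDesign hk hkn best D hD hD1).G = ∅ := rfl

/-- The parameters satisfy `w * e = D` and `c = 2 * e - 1`, the least value that `two_e_le` admits.
-/
lemma largeDesign_ownBound : (largeDesign hk hkn best D hD hD1).ownBound =
    1 / 2 * (D * (1 / 2) ^ k) ^ 2 * largeOwn ((1 / 2) ^ k) D := by
  have h0 : (0 : ℝ) < 1 + 2 * D := by linarith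
  have hT0 := half_pow_pos k
  have hT1 : ((1 : ℝ) / 2) ^ k < 1 := pow_lt_one₀ (by norm_num) (by norm_num) hk.ne'
  rw [Design.ownBound, largeDesign_w, largeDesign_e, largeDesign_z, largeDesign_G, Finset.card_empty,
    Nat.sub_zero, largeOwn]
  set T : ℝ := (1 / 2) ^ k
  have e1 : 3 * D / (1 + 2 * D) * ((1 + 2 * D) / 3) = D := by field_simp
  have e2 : 1 - 3 * D / (1 + 2 * D) + 3 * D / (1 + 2 * D) * T * (1 - (1 + 2 * D) / 3) =
      (1 - D) * (1 + 2 * D * T) / (1 + 2 * D) := by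
    field_simp
    ring
  have e3 : 3 * D / (1 + 2 * D) * (1 - T) = 3 * D * (1 - T) / (1 + 2 * D) := by
    field_simp
  rw [e1, e2, e3, one_div_div, one_div_div]
  ring

lemma largeOwn_pos {T : ℝ} (hT0 : 0 < T) (hT1 : T < 1) (hD : 9 / 20 ≤ D) (hD1 : D < 1) :
    0 < largeOwn T D := by
  have h1 : 0 < 1 - D := by linarith
  have h2 : 0 < 1 - T := by linarith
  have h3 : 0 < D := by linarith
  unfold largeOwn
  positivity

lemma largeDesign_ownBound_pos : 0 < (largeDesign hk hkn best D hD hD1).ownBound := by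
  have hT1 : ((1 : ℝ) / 2) ^ k < 1 := pow_lt_one₀ (by norm_num) (by norm_num) hk.ne'
  have hT0 := half_pow_pos k
  have := largeOwn_pos hT0 hT1 hD hD1
  have : 0 < D := by linarith
  rw [largeDesign_ownBound]
  positivity

lemma largeDesign_isBest_and_gap {ν : PMF (Rewards n)}
    (hν : (largeDesign hk hkn best D hD hD1).IsMain ν) :
    IsBest ν best ∧ gap ν best = D * (1 / 2) ^ k := by
  have h := Design.ofEmpty_isBest_and_gap _ _ _ _ _ _ _ _ _ _ _ _ _ hν
  have h0 : (1 : ℝ) + 2 * D ≠ 0 := by linarith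
  have e1 : 3 * D / (1 + 2 * D) * ((1 + 2 * D) / 3) = D := by field_simp
  rwa [e1] at h

lemma largeDesign_semiVal_own (hD : 9 / 20 ≤ D) (hD1 : D < 1) : 2 / 3 * (1 - D) / D ^ 2 *
    Design.semiVal (3 * D / (1 + 2 * D)) ((1 + 2 * D) / 3) = (1 + 2 * D) * (5 - 2 * D) / (36 * D) := by
  have h1 : 1 + 2 * D ≠ 0 := by linarith
  have h2 : 1 - D ≠ 0 := by linarith
  have h3 : D ≠ 0 := by linarith
  have e : 1 - (1 + 2 * D) / 3 = 2 * (1 - D) / 3 := by ring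
  rw [Design.semiVal, e]
  field_simp
  ring

lemma largeDesign_semiVal_cross (hD : 9 / 20 ≤ D) (hD1 : D < 1) : 2 / 3 * (1 - D) / D ^ 2 *
    Design.semiVal (3 * D / (1 + 2 * D)) ((4 * D - 1) / 3) =
      (4 * D - 1) ^ 2 * (7 - 4 * D) / (72 * D * (1 + 2 * D)) := by
  have h1 : 1 + 2 * D ≠ 0 := by linarith
  have h2 : 1 - D ≠ 0 := by linarith
  have h3 : D ≠ 0 := by linarith
  have e : 1 - (4 * D - 1) / 3 = 4 * (1 - D) / 3 := by ring
  rw [Design.semiVal, e]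
  field_simp
  ring

/-- The threshold `9 / 20` is nearly sharp: at `T = 1 / 4` it makes the right-hand side about
`0.2503`. -/
lemma largeDesign_cond {T : ℝ} (hT0 : 0 < T) (hT1 : T ≤ 1 / 4) (hD : 9 / 20 ≤ D) :
    T ≤ D * (1 + D * T) / 2 := by
  nlinarith [mul_nonneg (sub_nonneg.2 hD) hT0.le, mul_nonneg (sub_nonneg.2 hD) (sub_nonneg.2 hD),
    mul_nonneg (mul_nonneg (sub_nonneg.2 hD) (sub_nonneg.2 hD)) hT0.le]

/-- Large gaps, when there are many arms. -/
lemma hasHard_large_of_two_mul_le (hk4 : 4 ≤ k) (hn : 2 * k ≤ n) (hkn : k < n) (hD : 9 / 20 ≤ D)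
    (hD1 : D < 1) : HasHard n k D := by
  have hk : 0 < k := by omega
  obtain ⟨best⟩ := exists_kSet (n := n) hkn.le
  set d := largeDesign hk hkn best D hD hD1 with hd
  have hD0 : 0 < D := by linarith
  have hT0 := half_pow_pos k
  have hT1 : ((1 : ℝ) / 2) ^ k ≤ 1 / 16 := (half_pow_le hk4).trans (by norm_num)
  obtain ⟨ν, hν⟩ := d.exists_isMain
  obtain ⟨hbest, hgap⟩ := largeDesign_isBest_and_gap hk hkn best hD hD1 hν
  have hω : (n.choose k : ℝ) ≤ 2 * ∑ S, farWeight best S := choose_le_two_mul_sum_farWeight hn best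
  have hC : (0 : ℝ) ≤ n.choose k := Nat.cast_nonneg _
  have hd2 : 0 < 1 + 2 * D := by linarith
  have hd1 : 0 < 1 - D := by linarith
  refine ⟨ν, best, hbest, hgap, fun B hB hB1 hB2 => ?_, ?_⟩
  · have hB3 := hB2 (largeDesign_cond hT0 (by linarith) hD)
    have hown := largeDesign_ownBound hk hkn best hD hD1
    have hownpos := largeDesign_ownBound_pos hk hkn best hD hD1
    rw [← hd] at hown hownpos
    -- Since `c ≤ e`, only the reduced minorant of the marks is worse than in `ownBound`, and `T ≤ 1
    -- / 16` limits this loss to the factor `8 / 7`.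
    have hcross : d.crossBound k ≤ 8 / 7 * d.ownBound := by
      have hk' : (0 : ℝ) < k := by exact_mod_cast hk
      have e1 : ((k - 1 : ℕ) : ℝ) + 1 = k := by exact_mod_cast Nat.sub_add_cancel hk
      have hw := d.w_pos
      have he := d.e_pos
      have hz : d.z = (1 - D) / (1 + 2 * D) := by
        rw [hd, largeDesign_z]
        field_simp
        ring
      have hz0 : 0 < d.z := by rw [hz]; positivity
      have hce : d.c ≤ d.e := by
        rw [hd, largeDesign_c, largeDesign_e]
        linarith
      have he1 : 0 ≤ 1 - d.e := by linarith [d.e_le]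
      have hG : k - d.G.card = k := by rw [hd, largeDesign_G]; simp
      rw [Design.crossBound, Design.ownBound, hG, Nat.sub_self, markInt_zero_right, e1]
      set T : ℝ := (1 / 2) ^ k
      have hcT : d.c * T ≤ 1 / 16 := by nlinarith [d.c_le]
      have hden : 0 < (1 - T) / k - d.c * T * (1 / k) := by
        have : (1 - T) / k - d.c * T * (1 / k) = (1 - T - d.c * T) / k := by ring
        rw [this]
        have : 0 < 1 - T - d.c * T := by linarith
        positivity
      have e2 : (k : ℝ) * (1 / k) ^ 2 / (d.w * ((1 - T) / k - d.c * T * (1 / k))) =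
          1 / (d.w * (1 - T - d.c * T)) := by
        have : (1 - T) / k - d.c * T * (1 / k) = (1 - T - d.c * T) / k := by ring
        rw [this]
        field_simp
      have h1T : 0 < 1 - T := by linarith
      have h2T : 0 < 1 - T - d.c * T := by linarith
      have i1 : 1 / (d.z + d.w * T) ≤ 8 / 7 * (1 / (d.z + d.w * T * (1 - d.e))) := by
        have : 1 / (d.z + d.w * T) ≤ 1 / (d.z + d.w * T * (1 - d.e)) := by
          apply one_div_le_one_div_of_le (by positivity)
          have : 0 ≤ d.w * T * d.e := by positivity
          linarith
        have h0 : 0 ≤ 1 / (d.z + d.w * T * (1 - d.e)) := by positivity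
        linarith
      have i2 : 1 / (d.w * (1 - T - d.c * T)) ≤ 8 / 7 * (1 / (d.w * (1 - T))) := by
        rw [mul_one_div, div_le_div_iff₀ (by positivity) (by positivity)]
        have : 1 * (1 - T) ≤ 8 / 7 * (1 - T - d.c * T) := by
          have := mul_le_mul_of_nonneg_right d.c_le hT0.le
          linarith
        have := mul_le_mul_of_nonneg_left this hw.le
        linarith
      rw [e2, Nat.cast_zero, zero_mul, zero_div, add_zero]
      have i3 : (d.w * d.c * T) ^ 2 ≤ (d.w * d.e * T) ^ 2 := by
        have := d.c_nonneg
        gcongr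
      calc _ ≤ 1 / 2 * (d.w * d.e * T) ^ 2 * (8 / 7 * (1 / (d.z + d.w * T * (1 - d.e))) +
            8 / 7 * (1 / (d.w * (1 - T)))) := by
            apply mul_le_mul (by linarith) (add_le_add i1 i2) (by positivity) (by positivity)
        _ = _ := by ring
    have hκx : (0 : ℝ) ≤ 8 / 7 * d.ownBound := by positivity
    -- `15 / 14` is the mean of `1` and `8 / 7`, as `colSum_farWeight_le` requires.
    refine d.banditHardFor_of_colSum rfl ?_ ?_ hν (ω := farWeight best) (farWeight_nonneg best) hκx ?_
      (K := 15 / 14 * d.ownBound) (by positivity) (by positivity)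
      (fun S' => d.colSum_farWeight_le hownpos.le (by linarith) (by linarith) S') ?_
    · rw [hd, largeDesign_z, sub_nonneg, div_le_one hd2]
      linarith
    · rw [hd, largeDesign_e]
      linarith
    · intro S hS hne hcard
      -- Sharing at most half of the arms means that the symmetric difference has at least `k` arms,
      -- hence exactly `k`.
      have h2 := farWeight_ne_zero hS
      have h3 := card_symmDiff best S
      have hcard' : (symmDiff best.1 S.1).card ≤ k := hcard
      have h4 : (symmDiff best.1 S.1).card = k := by omega
      change 0 < (1 - (1 / 2) ^ k) / k - d.c * (1 / 2) ^ k *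
        markInt ((symmDiff best.1 S.1).card - 1) (k - (symmDiff best.1 S.1).card) ∧
        d.crossBound (symmDiff best.1 S.1).card ≤ _
      rw [h4]
      refine ⟨?_, hcross⟩
      have hk' : (0 : ℝ) < k := by exact_mod_cast hk
      have e1 : ((k - 1 : ℕ) : ℝ) + 1 = k := by exact_mod_cast Nat.sub_add_cancel hk
      rw [Nat.sub_self, markInt_zero_right, e1]
      have : (1 - (1 / 2) ^ k) / (k : ℝ) - d.c * (1 / 2) ^ k * (1 / k) =
        (1 - (1 / 2) ^ k - d.c * (1 / 2) ^ k) / k := by ring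
      rw [this]
      have := mul_le_mul_of_nonneg_right d.c_le hT0.le
      have : 0 < 1 - (1 / 2) ^ k - d.c * (1 / 2) ^ k := by linarith
      positivity
    · rw [hown]
      set T : ℝ := (1 / 2) ^ k
      have hBT : B ≤ (1 - D ^ 2) / (16 * D) := by
        refine hB3.trans ?_
        have hTD : 0 < T / D := by positivity
        have h1 : T / D - D * T ≤ (1 - D ^ 2) / (16 * D) := by
          have e : T / D - D * T = T * ((1 - D ^ 2) / D) := by field_simp
          have e' : (1 - D ^ 2) / (16 * D) = 1 / 16 * ((1 - D ^ 2) / D) := by field_simp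
          rw [e, e']
          refine mul_le_mul_of_nonneg_right hT1 ?_
          have : 0 ≤ 1 - D ^ 2 := by nlinarith
          positivity
        have h2 : 0 ≤ T / D - D * T := by
          have e : T / D - D * T = T * ((1 - D ^ 2) / D) := by field_simp
          rw [e]
          have : 0 ≤ 1 - D ^ 2 := by nlinarith
          positivity
        exact (mul_le_of_le_one_right h2 (by linarith)).trans h1
      -- The constants combine to `4 / 3 * (15 / 14) * (1 / 2) = 5 / 7`, and `5 / 7 * (7 / 10) = 1 /
      -- 2` is the guaranteed share of the total weight in `n.choose k`.
      have hY : (1 - D ^ 2) / (16 * D) * largeOwn T D ≤ 7 / 10 := by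
        have h1 : 1 / (1 + 2 * D * T) ≤ 1 := by
          rw [div_le_one (by positivity)]
          have : 0 ≤ 2 * D * T := by positivity
          linarith
        have h2 : 1 / (3 * D * (1 - T)) ≤ 16 / (45 * D) := by
          rw [div_le_div_iff₀ (by have : 0 < 1 - T := by linarith
                                  positivity) (by positivity)]
          nlinarith
        have e : (1 - D ^ 2) / (16 * D) * largeOwn T D = (1 + D) * (1 + 2 * D) / (16 * D) *
            (1 / (1 + 2 * D * T) + (1 - D) * (1 / (3 * D * (1 - T)))) := by
          rw [largeOwn]
          have : 1 - T ≠ 0 := by linarith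
          have : 1 + 2 * D * T ≠ 0 := by positivity
          field_simp
          ring
        rw [e]
        calc _ ≤ (1 + D) * (1 + 2 * D) / (16 * D) * (1 + (1 - D) * (16 / (45 * D))) := by gcongr
          _ = (1 + D) * (1 + 2 * D) * (29 * D + 16) / (720 * D ^ 2) := by field_simp; ring
          _ ≤ 7 / 10 := by
            rw [div_le_iff₀ (by positivity)]
            nlinarith [mul_nonneg (sub_nonneg.2 hD) hd1.le, mul_nonneg (mul_nonneg (sub_nonneg.2 hD) hd1.le) hD0.le]
      have hown0 := largeOwn_pos hT0 (by linarith) hD hD1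
      have hBY : B * largeOwn T D ≤ 7 / 10 :=
        (mul_le_mul_of_nonneg_right hBT hown0.le).trans hY
      calc _ = (n.choose k : ℝ) * (5 / 7 * (B * largeOwn T D)) := by
            have : D * T ≠ 0 := by positivity
            field_simp
            ring
        _ ≤ (n.choose k : ℝ) * (1 / 2) := mul_le_mul_of_nonneg_left (by linarith) hC
        _ ≤ _ := by linarith
  · have hown := largeDesign_semiVal_own hD hD1
    have hle : Design.semiVal (3 * D / (1 + 2 * D)) ((4 * D - 1) / 3) ≤
        Design.semiVal (3 * D / (1 + 2 * D)) ((1 + 2 * D) / 3) := by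
      unfold Design.semiVal
      have h1 : (0 : ℝ) < 1 - (1 + 2 * D) / 3 := by linarith
      have h2 : (0 : ℝ) ≤ (4 * D - 1) / 3 := by linarith
      have h3 : (4 * D - 1) / 3 ≤ (1 + 2 * D) / 3 := by linarith
      have h4 : (0 : ℝ) < 1 - (4 * D - 1) / 3 := by linarith
      gcongr
    have hpos : 0 < Design.semiVal (3 * D / (1 + 2 * D)) ((1 + 2 * D) / 3) := by
      unfold Design.semiVal
      have h1 : (0 : ℝ) < 1 - (1 + 2 * D) / 3 := by linarith
      positivity
    refine d.semiHardFor_of_colSum rfl ?_ ?_ hν (ω := farWeight best) (farWeight_nonneg best) hpos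
      (by positivity) (fun S' => d.colSum_farWeight_le hpos.le le_rfl ?_ S') ?_
    · rw [hd, largeDesign_e]; linarith
    · rw [hd, largeDesign_c]; linarith
    · rw [hd, largeDesign_w, largeDesign_c]
      linarith
    · have h5 : (1 + 2 * D) * (5 - 2 * D) / (36 * D) ≤ 1 / 2 := by
        rw [div_le_iff₀ (by positivity)]
        nlinarith
      calc _ = (n.choose k : ℝ) * (2 / 3 * (1 - D) / D ^ 2 *
            Design.semiVal (3 * D / (1 + 2 * D)) ((1 + 2 * D) / 3)) := by ring
        _ ≤ (n.choose k : ℝ) * (1 / 2) := by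
            rw [hown]
            exact mul_le_mul_of_nonneg_left h5 hC
        _ ≤ _ := by linarith

end LargeGaps

/-! ### Large gaps for `k ≤ 3` -/

section FewArms

variable {n k : ℕ}

/-- The symmetric difference of two sets of equal size is even, and here it is nonempty with at most
three arms. -/
lemma card_symmDiff_eq_two (hk3 : k ≤ 3) {R S : KSet n k} (hne : S ≠ R)
    (h : (symmDiff R.1 S.1).card ≤ k) : (symmDiff R.1 S.1).card = 2 := by
  have h1 := card_symmDiff R S
  have h2 : (symmDiff R.1 S.1).card ≠ 0 := by
    rw [Finset.card_ne_zero, Finset.nonempty_iff_ne_empty, Ne, ← Finset.bot_eq_empty, symmDiff_eq_bot]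
    exact fun h => hne (Subtype.ext h.symm)
  omega

lemma largeDesign_semi_le {D : ℝ} (hD : 9 / 20 ≤ D) (hD1 : D < 1) :
    (1 + 2 * D) * (5 - 2 * D) / (36 * D) + 2 * ((4 * D - 1) ^ 2 * (7 - 4 * D) / (72 * D * (1 + 2 * D))) ≤ 1 := by
  have hD0 : 0 < D := by linarith
  rw [mul_div_assoc', div_add_div _ _ (by positivity) (by positivity), div_le_one (by positivity)]
  -- Up to constants these are the Bernstein polynomials of the interval; taken as nonnegative atoms
  -- they make the polynomial inequality linear.
  have hb : ∀ i j : ℕ, 0 ≤ (D - 9 / 20) ^ i * (1 - D) ^ j := fun i j =>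
    mul_nonneg (pow_nonneg (by linarith) _) (pow_nonneg (by linarith) _)
  linarith [hb 0 4, hb 1 3, hb 2 2, hb 3 1, hb 4 0]

/-- The bound on the relative entropy for a difference on two arms, up to the factor `Δ ^ 2 / 2`. -/
def pairCross (k : ℕ) (D : ℝ) : ℝ :=
  if k = 2 then (4 * D - 1) ^ 2 / (1 + 2 * D) * (4 / (4 - D) + 2 / (D * (5 - 2 * D)))
  else (4 * D - 1) ^ 2 / (1 + 2 * D) * (8 / (8 - 5 * D) + 64 / (3 * D * (23 - 8 * D)) + 8 / (63 * D))

lemma pairCross_nonneg {D : ℝ} (hD : 9 / 20 ≤ D) (hD1 : D < 1) : 0 ≤ pairCross k D := by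
  have hD0 : 0 < D := by linarith
  have h1 : 0 < 4 - D := by linarith
  have h2 : 0 < 5 - 2 * D := by linarith
  have h3 : 0 < 8 - 5 * D := by linarith
  have h4 : 0 < 23 - 8 * D := by linarith
  unfold pairCross
  split_ifs <;> positivity

lemma largeDesign_crossBound_two (hk0 : 0 < k) (hkn : k < n) (best : KSet n k) (hk : k = 2 ∨ k = 3) {D : ℝ}
    (hD : 9 / 20 ≤ D) (hD1 : D < 1) :
    0 < (1 - (1 / 2) ^ k) / (k : ℝ) - (largeDesign hk0 hkn best D hD hD1).c * (1 / 2) ^ k *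
      markInt (2 - 1) (k - 2) ∧
    (largeDesign hk0 hkn best D hD hD1).crossBound 2 = 1 / 2 * (D * (1 / 2) ^ k) ^ 2 * pairCross k D := by
  have hD0 : 0 < D := by linarith
  have h0 : 1 + 2 * D ≠ 0 := by linarith
  rw [Design.crossBound, largeDesign_w, largeDesign_c, largeDesign_z]
  rcases hk with rfl | rfl
  · have h1 : 4 - D ≠ 0 := by linarith
    have h2 : 5 - 2 * D ≠ 0 := by linarith
    have e1 : markInt (2 - 1) (2 - 2) = 1 / 2 := by
      rw [Nat.sub_self, markInt_zero_right]
      norm_num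
    rw [e1]
    refine ⟨by push_cast; linarith, ?_⟩
    have e2 : 1 - 3 * D / (1 + 2 * D) + 3 * D / (1 + 2 * D) * (1 / 2) ^ 2 = (4 - D) / (4 * (1 + 2 * D)) := by
      field_simp
      ring
    have e3 : 3 * D / (1 + 2 * D) * ((1 - (1 / 2) ^ 2) / ((2 : ℕ) : ℝ) - (4 * D - 1) / 3 * (1 / 2) ^ 2 * (1 / 2)) =
        D * (5 - 2 * D) / (4 * (1 + 2 * D)) := by
      push_cast
      field_simp
      ring
    rw [e2, e3, pairCross, if_pos rfl, Nat.sub_self]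
    push_cast
    field_simp
    ring
  · have h1 : 8 - 5 * D ≠ 0 := by linarith
    have h2 : 23 - 8 * D ≠ 0 := by linarith
    have e1 : markInt (2 - 1) (3 - 2) = 2 / 3 := by
      change markInt 1 1 = 2 / 3
      rw [markInt_one_right]
      norm_num
    have e1' : markInt 2 (3 - 2 - 1) = 1 / 3 := by
      change markInt 2 0 = 1 / 3
      rw [markInt_zero_right]
      norm_num
    rw [e1, e1']
    refine ⟨by push_cast; linarith, ?_⟩
    have e2 : 1 - 3 * D / (1 + 2 * D) + 3 * D / (1 + 2 * D) * (1 / 2) ^ 3 = (8 - 5 * D) / (8 * (1 + 2 * D)) := by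
      field_simp
      ring
    have e3 : 3 * D / (1 + 2 * D) * ((1 - (1 / 2) ^ 3) / ((3 : ℕ) : ℝ) - (4 * D - 1) / 3 * (1 / 2) ^ 3 * (2 / 3)) =
        D * (23 - 8 * D) / (24 * (1 + 2 * D)) := by
      push_cast
      field_simp
      ring
    have e4 : 3 * D / (1 + 2 * D) * ((1 - (1 / 2) ^ 3) / ((3 : ℕ) : ℝ)) = 7 * D / (8 * (1 + 2 * D)) := by
      push_cast
      field_simp
      ring
    rw [e2, e3, e4, pairCross, if_neg (by norm_num), show (3 - 2 : ℕ) = 1 from rfl]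
    push_cast
    field_simp
    ring

/-- The coefficient of `pairCross` is the number `k.choose (k / 2) - 1` of alternatives whose
difference can lie in one query: `1` here, and `2` for `k = 3`. -/
lemma pairCross_bound_two {D : ℝ} (hD : 9 / 20 ≤ D) (hD1 : D < 1) :
    2 / 3 * (((1 / 2) ^ 2 / D - D * (1 / 2) ^ 2) * (1 - (1 / 2) ^ 2 / D)) *
      (largeOwn ((1 / 2) ^ 2) D + pairCross 2 D) ≤ 1 := by
  have hD0 : 0 < D := by linarith
  have h1 : 0 < 1 - D := by linarith
  have h2 : 0 < 4 - D := by linarith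
  have h3 : 0 < 5 - 2 * D := by linarith
  have h4 : 0 < 2 + D := by linarith
  have e : 2 / 3 * (((1 / 2) ^ 2 / D - D * (1 / 2) ^ 2) * (1 - (1 / 2) ^ 2 / D)) *
      (largeOwn ((1 / 2) ^ 2) D + pairCross 2 D) = (1 + D) * (4 * D - 1) *
        ((1 + 2 * D) * (18 * D + 4 * (1 - D) * (2 + D)) * ((1 + 2 * D) * (4 - D) * (5 - 2 * D)) +
          (1 - D) * (4 * D - 1) ^ 2 * (4 * D * (5 - 2 * D) + 2 * (4 - D)) * (9 * (2 + D))) /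
        (24 * D ^ 3 * (9 * (2 + D) * ((1 + 2 * D) * (4 - D) * (5 - 2 * D)))) := by
    rw [largeOwn, pairCross, if_pos rfl]
    have e1 : (1 : ℝ) + 2 * D * (1 / 2) ^ 2 = (2 + D) / 2 := by ring
    rw [e1]
    field_simp
    ring
  rw [e, div_le_one (by positivity)]
  have hb : ∀ i j : ℕ, 0 ≤ (D - 9 / 20) ^ i * (1 - D) ^ j := fun i j =>
    mul_nonneg (pow_nonneg (by linarith) _) (pow_nonneg (by linarith) _)
  linarith [hb 0 8, hb 1 7, hb 2 6, hb 3 5, hb 4 4, hb 5 3, hb 6 2, hb 7 1, hb 8 0]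

lemma pairCross_bound_three {D : ℝ} (hD : 9 / 20 ≤ D) (hD1 : D < 1) :
    2 / 3 * (((1 / 2) ^ 3 / D - D * (1 / 2) ^ 3) * (1 - (1 / 2) ^ 3 / D)) *
      (largeOwn ((1 / 2) ^ 3) D + 2 * pairCross 3 D) ≤ 1 := by
  have hD0 : 0 < D := by linarith
  have h1 : 0 < 1 - D := by linarith
  have h2 : 0 < 8 - 5 * D := by linarith
  have h3 : 0 < 23 - 8 * D := by linarith
  have h4 : 0 < 4 + D := by linarith
  have e : 2 / 3 * (((1 / 2) ^ 3 / D - D * (1 / 2) ^ 3) * (1 - (1 / 2) ^ 3 / D)) *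
      (largeOwn ((1 / 2) ^ 3) D + 2 * pairCross 3 D) = (1 + D) * (8 * D - 1) *
        ((1 + 2 * D) * (84 * D + 8 * (1 - D) * (4 + D)) * (63 * ((1 + 2 * D) * (8 - 5 * D) * (23 - 8 * D))) +
          2 * (1 - D) * (4 * D - 1) ^ 2 * (504 * D * (23 - 8 * D) + 1344 * (8 - 5 * D) +
            8 * ((8 - 5 * D) * (23 - 8 * D))) * (21 * (4 + D))) /
        (96 * D ^ 3 * (21 * (4 + D) * (63 * ((1 + 2 * D) * (8 - 5 * D) * (23 - 8 * D))))) := by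
    rw [largeOwn, pairCross, if_neg (by norm_num)]
    have e1 : (1 : ℝ) + 2 * D * (1 / 2) ^ 3 = (4 + D) / 4 := by ring
    obtain ⟨a, ha⟩ : ∃ a, a = 8 - 5 * D := ⟨_, rfl⟩
    obtain ⟨b, hb⟩ : ∃ b, b = 23 - 8 * D := ⟨_, rfl⟩
    rw [e1]
    rw [← ha] at h2 ⊢
    rw [← hb] at h3 ⊢
    field_simp
    rw [ha, hb]
    ring
  rw [e, div_le_one (by positivity)]
  have hb : ∀ i j : ℕ, 0 ≤ (D - 9 / 20) ^ i * (1 - D) ^ j := fun i j =>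
    mul_nonneg (pow_nonneg (by linarith) _) (pow_nonneg (by linarith) _)
  linarith [hb 0 8, hb 1 7, hb 2 6, hb 3 5, hb 4 4, hb 5 3, hb 6 2, hb 7 1, hb 8 0]

/-- Large gaps, for sets of two or three arms. -/
lemma hasHard_large_of_le_three (hk : k = 2 ∨ k = 3) (hkn : k < n) {D : ℝ} (hD : 9 / 20 ≤ D)
    (hD1 : D < 1) : HasHard n k D := by
  have hk0 : 0 < k := by omega
  obtain ⟨best⟩ := exists_kSet (n := n) hkn.le
  set d := largeDesign hk0 hkn best D hD hD1 with hd
  have hD0 : 0 < D := by linarith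
  have hd1 : 0 < 1 - D := by linarith
  have hT0 := half_pow_pos k
  obtain ⟨ν, hν⟩ := d.exists_isMain
  obtain ⟨hbest, hgap⟩ := largeDesign_isBest_and_gap hk0 hkn best hD hD1 hν
  obtain ⟨hpos, hcross⟩ := largeDesign_crossBound_two hk0 hkn best hk hD hD1
  have hC : (0 : ℝ) ≤ n.choose k := Nat.cast_nonneg _
  have hsum1 : ∑ _S : KSet n k, (1 : ℝ) = n.choose k := by
    simp [Finset.card_univ, Fintype.card_finset_len]
  have hj : ((k.choose (k / 2) - 1 : ℕ) : ℝ) ≤ 2 := by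
    rcases hk with rfl | rfl <;> norm_num [Nat.choose]
  refine ⟨ν, best, hbest, hgap, fun B hB hB1 hB2 => ?_, ?_⟩
  · have hown := largeDesign_ownBound hk0 hkn best hD hD1
    have hownpos := largeDesign_ownBound_pos hk0 hkn best hD hD1
    rw [← hd] at hown hownpos
    have hT1 : ((1 : ℝ) / 2) ^ k ≤ 1 / 4 := (half_pow_le (show 2 ≤ k by omega)).trans (by norm_num)
    have hB3 := hB2 (largeDesign_cond hT0 hT1 hD)
    have hZ0 : 0 ≤ pairCross k D := pairCross_nonneg hD hD1
    have hκx : 0 ≤ 1 / 2 * (D * (1 / 2) ^ k) ^ 2 * pairCross k D := by positivity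
    refine d.banditHardFor_of_colSum rfl ?_ ?_ hν (ω := fun _ => 1) (fun _ => zero_le_one) hκx ?_
      (K := d.ownBound + 1 / 2 * (D * (1 / 2) ^ k) ^ 2 * pairCross k D * (k.choose (k / 2) - 1 : ℕ))
      (by positivity) (by positivity) (fun S' => d.colSum_one_le hκx S') ?_
    · rw [hd, largeDesign_z, sub_nonneg, div_le_one (by linarith)]
      linarith
    · rw [hd, largeDesign_e]
      linarith
    · intro S _ hne hcard
      have h2 : (symmDiff d.best.1 S.1).card = 2 := card_symmDiff_eq_two (by omega) hne hcard
      rw [h2]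
      exact ⟨hpos, hcross.le⟩
    · rw [hown, hsum1]
      have key : 2 / 3 * B * (largeOwn ((1 / 2) ^ k) D + (k.choose (k / 2) - 1 : ℕ) * pairCross k D) ≤ 1 := by
        have h0 := largeOwn_pos hT0 (by linarith) hD hD1
        refine (mul_le_mul_of_nonneg_right (mul_le_mul_of_nonneg_left hB3 (by norm_num))
          (by positivity)).trans ?_
        rcases hk with rfl | rfl
        · have := pairCross_bound_two hD hD1
          norm_num [Nat.choose] at this ⊢
          exact this
        · have := pairCross_bound_three hD hD1
          norm_num [Nat.choose] at this ⊢
          exact this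
      have hDT : D * (1 / 2) ^ k ≠ 0 := by positivity
      calc _ = (n.choose k : ℝ) * (2 / 3 * B * (largeOwn ((1 / 2) ^ k) D +
            (k.choose (k / 2) - 1 : ℕ) * pairCross k D)) := by
            field_simp
            ring
        _ ≤ n.choose k := mul_le_of_le_one_right hC key
  · have hown := largeDesign_semiVal_own hD hD1
    have hcr := largeDesign_semiVal_cross hD hD1
    have hv0 : 0 < Design.semiVal (3 * D / (1 + 2 * D)) ((1 + 2 * D) / 3) := by
      unfold Design.semiVal
      have h1 : (0 : ℝ) < 1 - (1 + 2 * D) / 3 := by linarith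
      positivity
    have hv1 : 0 ≤ Design.semiVal (3 * D / (1 + 2 * D)) ((4 * D - 1) / 3) :=
      Design.semiVal_nonneg (by positivity) (by linarith)
    refine d.semiHardFor_of_colSum rfl ?_ ?_ hν (ω := fun _ => 1) (fun _ => zero_le_one)
      (K := Design.semiVal (3 * D / (1 + 2 * D)) ((1 + 2 * D) / 3) +
        Design.semiVal (3 * D / (1 + 2 * D)) ((4 * D - 1) / 3) * 2) (by positivity)
      (by positivity) (fun S' => (d.colSum_one_le hv1 S').trans
        (add_le_add_right (mul_le_mul_of_nonneg_left hj hv1) _)) ?_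
    · rw [hd, largeDesign_e]; linarith
    · rw [hd, largeDesign_c]; linarith
    · rw [hsum1]
      have := largeDesign_semi_le hD hD1
      calc _ = (n.choose k : ℝ) * (2 / 3 * (1 - D) / D ^ 2 *
            Design.semiVal (3 * D / (1 + 2 * D)) ((1 + 2 * D) / 3) + 2 * (2 / 3 * (1 - D) / D ^ 2 *
            Design.semiVal (3 * D / (1 + 2 * D)) ((4 * D - 1) / 3))) := by ring
        _ ≤ n.choose k := by
            rw [hown, hcr]
            exact mul_le_of_le_one_right hC this

end FewArms

/-! ### Designs with arms common to the best sets -/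

section CommonArms

variable {n k : ℕ}

lemma choose_le_card_filter_superset {G : Finset (Fin n)} (hG : G.card ≤ k) :
    (n - G.card).choose (k - G.card) ≤ (Finset.univ.filter fun S : KSet n k => G ⊆ S.1).card := by
  have h1 : (Finset.powersetCard (k - G.card) Gᶜ).card = (n - G.card).choose (k - G.card) := by
    rw [Finset.card_powersetCard, Finset.card_compl, Fintype.card_fin]
  rw [← h1]
  refine Finset.card_le_card_of_surjOn (fun S : KSet n k => S.1 \ G) fun A hA => ?_
  obtain ⟨hA1, hA2⟩ := Finset.mem_powersetCard.1 (Finset.mem_coe.1 hA)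
  have hdisj : Disjoint A G := Finset.subset_compl_iff_disjoint_right.1 hA1
  refine ⟨⟨A ∪ G, ?_⟩, by simp, ?_⟩
  · rw [Finset.card_union_of_disjoint hdisj, hA2]
    omega
  · change (A ∪ G) \ G = A
    rw [Finset.union_sdiff_right, Finset.sdiff_eq_self_of_disjoint hdisj]

namespace Design

variable (d : Design n k)

lemma card_filter_sdiff_subset_le (S' : KSet n k) :
    (Finset.univ.filter fun S : KSet n k => d.G ⊆ S.1 ∧ S.1 \ d.G ⊆ S'.1).card ≤
      (S'.1 \ d.G).card.choose (k - d.G.card) := by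
  rw [← Finset.card_powersetCard]
  refine Finset.card_le_card_of_injOn (fun S : KSet n k => S.1 \ d.G) ?_ ?_
  · intro S hS
    obtain ⟨h1, h2⟩ : d.G ⊆ S.1 ∧ S.1 \ d.G ⊆ S'.1 := by simpa using hS
    refine Finset.mem_coe.2 (Finset.mem_powersetCard.2 ⟨fun i hi => ?_, d.card_sdiff h1⟩)
    exact Finset.mem_sdiff.2 ⟨h2 hi, (Finset.mem_sdiff.1 hi).2⟩
  · intro S hS T hT h
    obtain ⟨h1, -⟩ : d.G ⊆ S.1 ∧ S.1 \ d.G ⊆ S'.1 := by simpa using hS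
    obtain ⟨h2, -⟩ : d.G ⊆ T.1 ∧ T.1 \ d.G ⊆ S'.1 := by simpa using hT
    refine Subtype.ext ?_
    rw [← Finset.sdiff_union_of_subset h1, ← Finset.sdiff_union_of_subset h2]
    exact congrArg (· ∪ d.G) h

lemma card_sdiff_eq_add (S' : KSet n k) :
    (S'.1 \ d.G).card = k - d.G.card + (d.G \ S'.1).card := by
  have h1 := Finset.card_inter_add_card_sdiff S'.1 d.G
  have h2 := Finset.card_inter_add_card_sdiff d.G S'.1
  rw [Finset.inter_comm] at h2
  rw [S'.2] at h1
  have := d.G_card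
  omega

/-- The lower bound on the probability of the marks outside `G`, for a query that misses `i` arms
of `G`. -/
def markLower (i : ℕ) : ℝ :=
  d.w * ((1 - (1 / 2) ^ (k - d.G.card + i)) / (k - d.G.card + i : ℕ) -
    (1 / 2) ^ (k - d.G.card + i) * markInt (k - d.G.card) (i - 1))

/-- The relative entropy between laws which differ by the character of the arms of a set outside
`G`, for a query that contains these and misses `i` arms of `G`. -/
def partialBound (α : ℝ) (i : ℕ) : ℝ :=
  1 / 2 * (d.w * d.e * (1 / 2) ^ (k - d.G.card + i)) ^ 2 * (1 / α +
    ((k - d.G.card : ℕ) * markInt (k - d.G.card - 1) i ^ 2 + i * markInt (k - d.G.card) (i - 1) ^ 2) /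
      d.markLower i)

/-- A mark inside `A` has a nonpositive sum, and a mark outside `A` attains the bound when `A` is
visible. So subtracting the character can make only the marks outside `A` less likely. -/
lemma charSum_some_le {A : Finset (Fin n)} (hA : Disjoint A d.G) (hAc : A.card = k - d.G.card)
    {S' : KSet n k} {l : Fin n} (hl : l ∈ S'.1 \ d.G) :
    d.charSum (markedBandit n k) A S' (some l : Option (Fin n)) ≤
      (1 / 2) ^ (S'.1 \ d.G).card * markInt (k - d.G.card) ((d.G \ S'.1).card - 1) := by
  have hJ := markInt_nonneg (k - d.G.card) ((d.G \ S'.1).card - 1)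
  by_cases hsub : A ⊆ S'.1
  · rw [d.charSum_some hA hl hsub]
    by_cases hlA : l ∈ A
    · rw [if_pos hlA]
      have h1 := markInt_nonneg (A.erase l).card ((S'.1 \ d.G).card - 1 - (A.erase l).card)
      have h2 : (0 : ℝ) ≤ (1 / 2) ^ (S'.1 \ d.G).card := by positivity
      have h3 := mul_nonneg h2 h1
      have h4 := mul_nonneg h2 hJ
      linarith
    · rw [if_neg hlA, Finset.erase_eq_of_notMem hlA, hAc, one_mul, d.card_sdiff_eq_add S']
      have e : k - d.G.card + (d.G \ S'.1).card - 1 - (k - d.G.card) = (d.G \ S'.1).card - 1 := by omega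
      rw [e]
  · exact (d.charSum_markedBandit_eq_zero hA S' (some l : Option (Fin n)) hsub).le.trans (by positivity)

lemma charSum_none_le {A : Finset (Fin n)} (hA : Disjoint A d.G) (S' : KSet n k) :
    d.charSum (markedBandit n k) A S' (none : Option (Fin n)) ≤ (1 / 2) ^ (S'.1 \ d.G).card := by
  rw [d.charSum_none hA]
  split_ifs
  · exact le_rfl
  · positivity

/-- Two characters of weight at most `1 / 2` cost no more than one of weight `1`, which is why
`markLower` subtracts the bound of `charSum_some_le` once. -/
lemma le_obsProb_some (he : d.e ≤ 1 / 2) {A B : Finset (Fin n)} (hA : Disjoint A d.G)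
    (hAc : A.card = k - d.G.card) (hB : Disjoint B d.G) (hBc : B.card = k - d.G.card) {S' : KSet n k}
    {l : Fin n} (hl : l ∈ S'.1 \ d.G) {a b : ℝ} (ha : 0 ≤ a) (ha1 : a ≤ 1) (hb : 0 ≤ b) (hb1 : b ≤ 1) :
    d.markLower (d.G \ S'.1).card ≤ d.baseProb (markedBandit n k) S' (some l : Option (Fin n)) -
      d.w * d.e * (a * d.charSum (markedBandit n k) A S' (some l : Option (Fin n)) +
        b * d.charSum (markedBandit n k) B S' (some l : Option (Fin n))) := by
  have hw := d.w_pos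
  have he0 := d.e_pos
  have h1 := d.baseProb_some_ge hl
  have h2 := d.charSum_some_le hA hAc hl
  have h3 := d.charSum_some_le hB hBc hl
  rw [markLower, ← d.card_sdiff_eq_add S']
  set v : ℝ := (1 / 2) ^ (S'.1 \ d.G).card * markInt (k - d.G.card) ((d.G \ S'.1).card - 1) with hv
  have hv0 : 0 ≤ v := mul_nonneg (by positivity) (markInt_nonneg _ _)
  have h4 : ∀ {a x : ℝ}, 0 ≤ a → a ≤ 1 → x ≤ v → a * x ≤ v := fun ha ha1 hx =>
    (mul_le_mul_of_nonneg_left hx ha).trans (mul_le_of_le_one_left hv0 ha1)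
  have h5 := mul_le_mul_of_nonneg_left (add_le_add (h4 ha ha1 h2) (h4 hb hb1 h3)) (mul_pos hw he0).le
  have h6 := mul_le_mul_of_nonneg_left he (mul_nonneg hw.le hv0)
  linarith

lemma le_obsProb_none (he : d.e ≤ 1 / 2) {A B : Finset (Fin n)} (hA : Disjoint A d.G)
    (hB : Disjoint B d.G) {S' : KSet n k} {α a b : ℝ} (ha : 0 ≤ a) (ha1 : a ≤ 1) (hb : 0 ≤ b)
    (hb1 : b ≤ 1) (hα : α ≤ obsSum (markedBandit n k) d.Q S' (none : Option (Fin n))) :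
    α ≤ d.baseProb (markedBandit n k) S' (none : Option (Fin n)) -
      d.w * d.e * (a * d.charSum (markedBandit n k) A S' (none : Option (Fin n)) +
        b * d.charSum (markedBandit n k) B S' (none : Option (Fin n))) := by
  have hw := d.w_pos
  have he0 := d.e_pos
  have h2 := d.charSum_none_le hA S'
  have h3 := d.charSum_none_le hB S'
  rw [d.baseProb_none_eq]
  set v : ℝ := (1 / 2) ^ (S'.1 \ d.G).card with hv
  have hv0 : 0 ≤ v := by positivity
  have h4 : ∀ {a x : ℝ}, 0 ≤ a → a ≤ 1 → x ≤ v → a * x ≤ v := fun ha ha1 hx =>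
    (mul_le_mul_of_nonneg_left hx ha).trans (mul_le_of_le_one_left hv0 ha1)
  have h5 := mul_le_mul_of_nonneg_left (add_le_add (h4 ha ha1 h2) (h4 hb hb1 h3)) (mul_pos hw he0).le
  have h6 := mul_le_mul_of_nonneg_left he (mul_nonneg hw.le hv0)
  linarith

/-- Whether the alternative adds the character of `S \ G` or, for `S = best`, removes it, both laws
are the base law minus `w * e` times a combination of two characters with coefficients in `[0, 1]`.
So the same minorants serve for both. -/
lemma klBound_partial (hc : d.c = 0) (he : d.e ≤ 1 / 2) {α : ℝ} (hα : 0 < α) {S S' : KSet n k}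
    (hS : d.G ⊆ S.1) (hS' : S.1 \ d.G ⊆ S'.1)
    (hm : 0 < d.markLower (d.G \ S'.1).card)
    (hα' : α ≤ obsSum (markedBandit n k) d.Q S' (none : Option (Fin n))) {ν ν' : PMF (Rewards n)}
    (hν : d.IsMain ν) (hν' : d.IsAlt S ν') :
    KLBound (obsProb (markedBandit n k) ν S') (obsProb (markedBandit n k) ν' S')
      (d.partialBound α (d.G \ S'.1).card) := by
  have hA := d.disjoint_sdiff S
  have hAc := d.card_sdiff hS
  have hB := d.disjoint_sdiff d.best
  have hBc := d.card_sdiff d.G_subset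
  have hK := d.card_sdiff_eq_add S'
  set A := S.1 \ d.G with hAdef
  set B := d.best.1 \ d.G with hBdef
  obtain ⟨a, b, a', b', ha, ha1, hb, hb1, ha', ha1', hb', hb1', hab, hab', hp, hq⟩ :
      ∃ a b a' b' : ℝ, 0 ≤ a ∧ a ≤ 1 ∧ 0 ≤ b ∧ b ≤ 1 ∧ 0 ≤ a' ∧ a' ≤ 1 ∧ 0 ≤ b' ∧ b' ≤ 1 ∧ b' = b ∧
        (a' - a) ^ 2 = 1 ∧
        (∀ o, obsProb (markedBandit n k) ν S' o = d.baseProb (markedBandit n k) S' o -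
          d.w * d.e * (a * d.charSum (markedBandit n k) A S' o + b * d.charSum (markedBandit n k) B S' o)) ∧
        ∀ o, obsProb (markedBandit n k) ν' S' o = d.baseProb (markedBandit n k) S' o -
          d.w * d.e * (a' * d.charSum (markedBandit n k) A S' o +
            b' * d.charSum (markedBandit n k) B S' o) := by
    by_cases hb : S = d.best
    · have hAB : A = B := by rw [hAdef, hBdef, hb]
      refine ⟨1, 0, 0, 0, zero_le_one, le_rfl, le_rfl, zero_le_one, le_rfl, zero_le_one, le_rfl, zero_le_one,
        rfl, by norm_num, fun o => ?_, fun o => ?_⟩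
      · rw [hν (markedBandit n k) S' o, hAB]
        ring
      · rw [(hν' (markedBandit n k) S' o).1 hb]
        ring
    · refine ⟨0, 1, 1, 1, le_rfl, zero_le_one, zero_le_one, le_rfl, zero_le_one, le_rfl, zero_le_one, le_rfl,
        rfl, by norm_num, fun o => ?_, fun o => ?_⟩
      · rw [hν (markedBandit n k) S' o]
        ring
      · rw [(hν' (markedBandit n k) S' o).2 hb, hc]
        ring
  have hmain := klBound_markedBandit (ν := ν) (ν' := ν') (β := -(d.w * d.e * (a' - a))) hA hS' hα hm hm
    (fun o => ?_) ?_ ?_ (fun l hl => ?_) (fun l hl => ?_) (fun l hl => ?_) (fun l hl => ?_)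
  · refine hmain.mono (le_of_eq ?_)
    rw [partialBound, hK, hAc, Nat.add_sub_cancel_left]
    have e : (-(d.w * d.e * (a' - a)) * (1 / 2) ^ (k - d.G.card + (d.G \ S'.1).card)) ^ 2 =
        (d.w * d.e * (1 / 2) ^ (k - d.G.card + (d.G \ S'.1).card)) ^ 2 * (a' - a) ^ 2 := by ring
    rw [e, hab', mul_one]
    ring
  · rw [hp o, hq o, hab]
    change _ = _ + _ * d.charSum (markedBandit n k) A S' o
    ring
  · rw [hp (none : Option (Fin n))]
    exact d.le_obsProb_none he hA hB ha ha1 hb hb1 hα'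
  · rw [hq (none : Option (Fin n))]
    exact d.le_obsProb_none he hA hB ha' ha1' hb' hb1' hα'
  · rw [hp (some l : Option (Fin n))]
    exact d.le_obsProb_some he hA hAc hB hBc
      (Finset.mem_sdiff.2 ⟨hS' hl, (Finset.mem_sdiff.1 hl).2⟩) ha ha1 hb hb1
  · rw [hq (some l : Option (Fin n))]
    exact d.le_obsProb_some he hA hAc hB hBc
      (Finset.mem_sdiff.2 ⟨hS' hl, (Finset.mem_sdiff.1 hl).2⟩) ha' ha1' hb' hb1'
  · rw [hp (some l : Option (Fin n))]
    exact d.le_obsProb_some he hA hAc hB hBc (Finset.mem_sdiff.1 hl).1 ha ha1 hb hb1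
  · rw [hq (some l : Option (Fin n))]
    exact d.le_obsProb_some he hA hAc hB hBc (Finset.mem_sdiff.1 hl).1 ha' ha1' hb' hb1'

lemma klBound_isAlt_of_zero (hc : d.c = 0) (he : d.e ≤ 1 / 2) {α : ℝ} (hα : 0 < α)
    (hα' : ∀ S', α ≤ obsSum (markedBandit n k) d.Q S' (none : Option (Fin n)))
    (hm : ∀ i, 0 < i → i ≤ d.G.card → 0 < d.markLower i) {ν ν' : PMF (Rewards n)} (hν : d.IsMain ν)
    {S : KSet n k} (hS : d.G ⊆ S.1) (hν' : d.IsAlt S ν') (S' : KSet n k) :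
    KLBound (obsProb (markedBandit n k) ν S') (obsProb (markedBandit n k) ν' S')
      (if S.1 \ d.G ⊆ S'.1 then
        if d.G ⊆ S'.1 then d.ownBound else d.partialBound α (d.G \ S'.1).card else 0) := by
  have hw := d.w_pos
  split_ifs with hsub hG
  · obtain rfl := d.eq_of_sdiff_subset hG hsub
    have hz : 0 < d.z + d.w * (1 / 2) ^ (k - d.G.card) * (1 - d.e) := by
      have h1 := hα' S'
      rw [d.z_eq S' hG] at h1
      have h2 : 0 < 1 - d.e := by linarith
      have h3 : 0 < d.z := hα.trans_le h1
      positivity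
    by_cases hb : S' = d.best
    · refine (d.klBound_own hG hz (ν := ν') (ν' := ν) (fun o => ?_) fun o => ?_).2
      · exact (hν' (markedBandit n k) S' o).1 hb
      · rw [hν (markedBandit n k) S' o, hb]
    · have hn : ¬ d.best.1 \ d.G ⊆ S'.1 := fun h => hb (d.eq_of_sdiff_subset hG h)
      have h0 := fun o => d.charSum_markedBandit_eq_zero (d.disjoint_sdiff d.best) S' o hn
      refine (d.klBound_own hG hz (fun o => ?_) fun o => ?_).1
      · rw [hν (markedBandit n k) S' o, h0]
        ring
      · rw [(hν' (markedBandit n k) S' o).2 hb, h0, hc]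
        ring
  · have hpos : 0 < (d.G \ S'.1).card := Finset.card_pos.2 (Finset.sdiff_nonempty.2 hG)
    exact d.klBound_partial hc he hα hS hsub (hm _ hpos (Finset.card_le_card Finset.sdiff_subset)) (hα' S') hν hν'
  · have h1 := fun o => d.charSum_markedBandit_eq_zero (d.disjoint_sdiff S) S' o hsub
    have e : obsProb (markedBandit n k) ν' S' = obsProb (markedBandit n k) ν S' := by
      funext o
      by_cases hb : S = d.best
      · have := h1 o
        rw [hb] at this
        rw [(hν' (markedBandit n k) S' o).1 hb, hν (markedBandit n k) S' o, this]
        ring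
      · rw [(hν' (markedBandit n k) S' o).2 hb, hν (markedBandit n k) S' o, h1, hc]
        ring
    rw [e]
    exact klBound_self (fun o => obsProb_nonneg _ _ _) (sum_obsProb _ _)

/-- The bound for bandit feedback from the perturbations towards the sets that contain `G`. -/
lemma banditHardFor_of_partial (hc : d.c = 0) (he : d.e ≤ 1 / 2) {α : ℝ} (hα : 0 < α)
    (hα' : ∀ S', α ≤ obsSum (markedBandit n k) d.Q S' (none : Option (Fin n)))
    (hm : ∀ i, 0 < i → i ≤ d.G.card → 0 < d.markLower i) {ν : PMF (Rewards n)} (hν : d.IsMain ν)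
    {K M : ℝ} (hK : 0 < K) (hM : 0 ≤ M) (hown : d.ownBound ≤ K)
    (hpart : ∀ i, 0 < i → i ≤ d.G.card →
      ((k - d.G.card + i).choose (k - d.G.card) : ℝ) * d.partialBound α i ≤ K)
    (hMK : M * K ≤ ((n - d.G.card).choose (k - d.G.card) : ℕ)) : BanditHardFor n k ν M := by
  choose ν' hν' using d.exists_isAlt
  set I := Finset.univ.filter fun S : KSet n k => d.G ⊆ S.1 with hI
  have hmem : ∀ S ∈ I, d.G ⊆ S.1 := fun S hS => by simpa [hI] using hS
  refine d.banditHardFor I hmem (fun S _ => hν' S) (fun _ => 1)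
    (fun S S' => if S.1 \ d.G ⊆ S'.1 then
        if d.G ⊆ S'.1 then d.ownBound else d.partialBound α (d.G \ S'.1).card else 0) hK hM
    (fun _ _ => zero_le_one)
    (fun S hS S' => d.klBound_isAlt_of_zero hc he hα hα' hm hν (hmem S hS) (hν' S) S') (fun S' => ?_) ?_
  · have hcard := d.card_filter_sdiff_subset_le S'
    simp only [one_mul]
    -- With `r = k - d.G.card`, a query that misses `i` arms of `G` has `r + i` arms outside it, so
    -- it sees at most `(r + i).choose r` of the characters, and at most one if `i = 0`.
    rw [← Finset.sum_filter, hI, Finset.filter_filter, Finset.sum_const, nsmul_eq_mul]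
    split_ifs with hG
    · rw [d.card_sdiff hG, Nat.choose_self] at hcard
      rcases Nat.le_one_iff_eq_zero_or_eq_one.1 hcard with h | h
      · rw [h, Nat.cast_zero, zero_mul]
        exact hK.le
      · rw [h, Nat.cast_one, one_mul]
        exact hown
    · have hpos : 0 < (d.G \ S'.1).card := Finset.card_pos.2 (Finset.sdiff_nonempty.2 hG)
      have hle := Finset.card_le_card (Finset.sdiff_subset (s := d.G) (t := S'.1))
      rw [d.card_sdiff_eq_add S'] at hcard
      refine le_trans (mul_le_mul_of_nonneg_right (by exact_mod_cast hcard) ?_) (hpart _ hpos hle)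
      have := hm _ hpos hle
      unfold partialBound
      positivity
  · refine hMK.trans ?_
    rw [Finset.sum_const, nsmul_eq_mul, mul_one]
    exact_mod_cast choose_le_card_filter_superset d.G_card.le

end Design

end CommonArms

/-! ### Mass on vectors with a single one, and the bound from one alternative -/

section Singles

variable {n k : ℕ}

/-- The density with mass `α` at `0` and mass `q j` at the vector whose only `1` is at `j`. -/
def singlesDensity (α : ℝ) (q : Fin n → ℝ) (x : Rewards n) : ℝ :=
  (if x = (fun _ => false) then α else 0) + ∑ j, if x = single j then q j else 0

lemma singlesDensity_nonneg {α : ℝ} {q : Fin n → ℝ} (hα : 0 ≤ α) (hq : ∀ j, 0 ≤ q j) (x : Rewards n) :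
    0 ≤ singlesDensity α q x :=
  add_nonneg (by split_ifs <;> simp [hα]) (Finset.sum_nonneg fun j _ => by split_ifs <;> simp [hq j])

lemma sum_singlesDensity_mul (α : ℝ) (q : Fin n → ℝ) (φ : Rewards n → ℝ) :
    ∑ x, singlesDensity α q x * φ x = α * φ (fun _ => false) + ∑ j, q j * φ (single j) := by
  simp only [singlesDensity, add_mul, Finset.sum_add_distrib, Finset.sum_mul]
  rw [Finset.sum_comm]
  simp

lemma sum_singlesDensity (α : ℝ) (q : Fin n → ℝ) : ∑ x, singlesDensity α q x = α + ∑ j, q j := by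
  simpa using sum_singlesDensity_mul α q fun _ => 1

lemma obsSum_singlesDensity (F : Feedback n k) (α : ℝ) (q : Fin n → ℝ) (S : KSet n k) (o : F.Obs) :
    obsSum F (singlesDensity α q) S o = α * (F.channel S (fun _ => false) o).toReal +
      ∑ j, q j * (F.channel S (single j) o).toReal :=
  sum_singlesDensity_mul α q fun x => (F.channel S x o).toReal

lemma obsSum_singlesDensity_none (α : ℝ) (q : Fin n → ℝ) (S : KSet n k) :
    obsSum (markedBandit n k) (singlesDensity α q) S (none : Option (Fin n)) = α + ∑ j ∈ S.1ᶜ, q j := by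
  have h0 : ((markedBandit n k).channel S (fun _ => false) (none : Option (Fin n))).toReal = 1 := by
    rw [toReal_markedBandit_none]
    simp
  have h1 : ∀ j, ((markedBandit n k).channel S (single j) (none : Option (Fin n))).toReal =
      if j ∈ S.1 then 0 else 1 := by
    intro j
    rw [toReal_markedBandit_none]
    split_ifs with h
    · exact Finset.prod_eq_zero (Finset.mem_univ j) (by simp [h, single])
    · refine Finset.prod_eq_one fun i _ => ?_
      by_cases hi : i ∈ S.1
      · rw [if_pos hi, if_neg]
        simp only [single, decide_eq_true_eq]
        rintro rfl
        exact h hi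
      · rw [if_neg hi]
  refine (obsSum_singlesDensity (markedBandit n k) α q S (none : Option (Fin n))).trans ?_
  rw [h0, mul_one]
  simp only [h1, mul_ite, mul_zero, mul_one]
  rw [← Finset.sum_filter_add_sum_filter_not Finset.univ (· ∈ S.1), Finset.sum_ite_of_true (by simp),
    Finset.sum_ite_of_false (by simp), Finset.sum_const_zero, zero_add]
  congr 1
  refine Finset.sum_congr ?_ fun _ _ => rfl
  ext
  simp

lemma expReward_singlesDensity {α : ℝ} {q : Fin n → ℝ} (h0 : ∀ x, 0 ≤ singlesDensity α q x)
    (h1 : ∑ x, singlesDensity α q x = 1) (S : KSet n k) :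
    expReward (pmfOfReal _ h0 h1) S = ∑ j ∈ S.1, q j := by
  simp only [expReward, toReal_pmfOfReal]
  rw [sum_singlesDensity_mul α q fun x => if reward S x = true then 1 else 0]
  have h : reward S (fun _ => false) ≠ true := by simp [reward_eq_true]
  simp only [h, reward_single, mul_ite, mul_one, mul_zero]
  simp

namespace Design

/-- The designs in which `G` is always part of the best sets. -/
def ofSingles (hkn : k < n) (best : KSet n k) {G : Finset (Fin n)} (hG : G ⊆ best.1) (hGk : G.card < k)
    (s w e α : ℝ) (hs : 0 ≤ s) (hα : 0 ≤ α) (hw : 0 < w) (he : 0 < e) (he1 : e ≤ 1 / 2)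
    (hsum : α + n * s + G.card * (w * (1 / 2) ^ (k - G.card)) + w = 1) : Design n k where
  Q := singlesDensity α fun j => s + if j ∈ G then w * (1 / 2) ^ (k - G.card) else 0
  w := w
  G := G
  best := best
  e := e
  c := 0
  z := α + s * (n - k)
  k_lt := hkn
  Q_nonneg := singlesDensity_nonneg hα fun j => by split_ifs <;> positivity
  w_pos := hw
  sum_Q := by
    rw [sum_singlesDensity, Finset.sum_add_distrib, Finset.sum_const, Finset.sum_ite_mem, Finset.univ_inter,
      Finset.sum_const, Finset.card_univ, Fintype.card_fin, nsmul_eq_mul, nsmul_eq_mul]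
    linarith
  G_subset := hG
  G_card := hGk
  e_pos := he
  e_le := by linarith
  c_nonneg := le_rfl
  c_le := zero_le_one
  two_e_le := by linarith
  z_eq S hS := by
    rw [obsSum_singlesDensity_none, Finset.sum_add_distrib, Finset.sum_eq_zero (s := S.1ᶜ) fun j hj => if_neg ?_,
      Finset.sum_const, Finset.card_compl, S.2, Fintype.card_fin, nsmul_eq_mul, Nat.cast_sub hkn.le]
    · ring
    · exact fun h => Finset.mem_compl.1 hj (hS h)
  z_le S hS := by
    obtain ⟨j, hj, hjS⟩ := Finset.not_subset.1 hS
    rw [obsSum_singlesDensity_none, Finset.sum_add_distrib,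
      Finset.sum_const, Finset.card_compl, S.2, Fintype.card_fin, nsmul_eq_mul, Nat.cast_sub hkn.le]
    have h := Finset.single_le_sum (f := fun j => if j ∈ G then w * (1 / 2) ^ (k - G.card) else 0)
      (fun i _ => by split_ifs <;> positivity) (Finset.mem_compl.2 hjS)
    simp only [hj, if_true] at h
    linarith

variable (d : Design n k)

lemma obsSum_Q_le {ν : PMF (Rewards n)} (hν : d.IsMain ν) (F : Feedback n k) (S : KSet n k) (o : F.Obs) :
    obsSum F d.Q S o ≤ obsProb F ν S o := by
  have hw := d.w_pos
  have he := d.e_pos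
  have h1 : 0 ≤ obsSum F (fun x => unifOff d.G x * (1 - d.e * chi (d.best.1 \ d.G) x)) S o := by
    refine obsSum_nonneg F (fun x => mul_nonneg (unifOff_nonneg _ _) ?_) S o
    rcases chi_eq (d.best.1 \ d.G) x with h | h <;> rw [h] <;> linarith [d.e_le]
  have h2 : obsSum F (fun x => unifOff d.G x * (1 - d.e * chi (d.best.1 \ d.G) x)) S o =
      obsSum F (unifOff d.G) S o - d.e * d.charSum F (d.best.1 \ d.G) S o := by
    simp only [charSum, obsSum, Finset.mul_sum, ← Finset.sum_sub_distrib]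
    exact Finset.sum_congr rfl fun x _ => by ring
  rw [hν F S o, baseProb]
  have := mul_nonneg hw.le (h2 ▸ h1)
  linarith

/-- A bound from the mixture with the uniform distribution on the vectors whose only `1` is in `J`. -/
lemma hardFor_of_mix {F : Feedback n k} [Fintype F.Obs] {ν : PMF (Rewards n)} (hν : d.IsMain ν)
    {σ : ℝ} (hσ : 0 < σ) {J : Finset (Fin n)} (hJ : J.Nonempty) (hJb : Disjoint J d.best.1) {S₁ : KSet n k}
    (hG : d.G ⊆ S₁.1) (hJS : J ⊆ S₁.1)
    (hQ : ∀ S o, σ * ∑ j ∈ J, (F.channel S (single j) o).toReal ≤ obsSum F d.Q S o) {M : ℝ} (hM : 0 ≤ M)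
    (hMK : M * (1 / 2 * (d.w * d.e * (1 / 2) ^ (k - d.G.card)) ^ 2 / (J.card * σ)) ≤ 1) : HardFor F ν M := by
  classical
  have hw := d.w_pos
  have he := d.e_pos
  have hJc : (0 : ℝ) < J.card := by exact_mod_cast Finset.card_pos.2 hJ
  set Δ : ℝ := d.w * d.e * (1 / 2) ^ (k - d.G.card) with hΔ
  have hΔ0 : 0 < Δ := by positivity
  -- This solves `(1 - τ) * Δ = τ`: the mixed-in law gives reward `1` to `S₁` and `0` to `best`,
  -- which exactly makes up for the shrunken gap.
  set τ : ℝ := Δ / (1 + Δ) with hτ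
  have hτ0 : 0 ≤ τ := by positivity
  have hτ' : 1 - τ = 1 / (1 + Δ) := by rw [hτ]; field_simp; ring
  have hτ1 : 0 < 1 - τ := by rw [hτ']; positivity
  set q : Fin n → ℝ := fun j => if j ∈ J then 1 / (J.card : ℝ) else 0 with hq
  have hq0 : ∀ j, 0 ≤ q j := fun j => by
    simp only [hq]
    split_ifs <;> positivity
  have hsumJ : ∑ j, q j = 1 := by
    simp only [hq]
    rw [← Finset.sum_filter]
    simp [hJc.ne']
  have hρ1 : ∑ x, singlesDensity 0 q x = 1 := by rw [sum_singlesDensity, hsumJ, zero_add]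
  set ρ : PMF (Rewards n) := pmfOfReal _ (singlesDensity_nonneg le_rfl hq0) hρ1 with hρ
  set ν' := mix τ hτ0 (by linarith) ν ρ with hν'
  set c : ℝ := 1 / (J.card * σ) with hc
  have hc0 : 0 < c := by positivity
  have hKL : ∀ S, KLBound (obsProb F ν S) (obsProb F ν' S) (1 / 2 * Δ ^ 2 / (J.card * σ)) := by
    intro S
    set p := obsProb F ν S with hp
    set u := obsProb F ρ S with hu
    have hp0 : ∀ o, 0 ≤ p o := fun o => obsProb_nonneg _ _ _
    have hu0 : ∀ o, 0 ≤ u o := fun o => obsProb_nonneg _ _ _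
    have hqo : ∀ o, obsProb F ν' S o = (1 - τ) * p o + τ * u o := fun o => obsProb_mix F τ _ _ ν ρ S o
    -- `Q` already dominates `σ` times the observations from the single vectors of `J`, so the
    -- mixed-in law has density at most `c` with respect to `p`.
    have hle : ∀ o, u o ≤ c * p o := by
      intro o
      have h1 : u o = 1 / (J.card : ℝ) * ∑ j ∈ J, (F.channel S (single j) o).toReal := by
        rw [hu, hρ, obsProb_pmfOfReal, obsSum_singlesDensity]
        simp only [hq, zero_mul, zero_add, ite_mul]
        rw [← Finset.sum_filter, Finset.mul_sum]
        simp
      have h2 := (hQ S o).trans (d.obsSum_Q_le hν F S o)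
      have h3 : u o = c * (σ * ∑ j ∈ J, (F.channel S (single j) o).toReal) := by
        rw [h1, hc]
        field_simp
      rw [h3]
      exact mul_le_mul_of_nonneg_left h2 hc0.le
    have hp1 : ∑ o, p o = 1 := sum_obsProb ν S
    have hu1 : ∑ o, u o = 1 := sum_obsProb ρ S
    refine klBound_of_sum_le (m := fun o => (1 - τ) * p o) (fun o => obsProb_nonneg _ _ _) hp1
      (sum_obsProb _ _) (fun o => ?_) (fun o => ?_) (fun o ho => ?_) ?_
    · exact mul_le_of_le_one_left (hp0 o) (by linarith)
    · rw [hqo]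
      exact le_add_of_nonneg_right (mul_nonneg hτ0 (hu0 o))
    · refine mul_pos hτ1 ((hp0 o).lt_of_ne' fun h0 => ho ?_)
      have h1 := hle o
      rw [h0, mul_zero] at h1
      have h2 : u o = 0 := le_antisymm h1 (hu0 o)
      rw [hqo, h2, h0]
      ring
    -- The difference is `τ * (p - u)`; expanding its square and using `u ^ 2 / p ≤ c * u` bounds
    -- the whole sum by `τ ^ 2 / (1 - τ) * (c - 1)`.
    · have h1 : ∀ o, (p o - obsProb F ν' S o) ^ 2 / ((1 - τ) * p o) ≤
          τ ^ 2 / (1 - τ) * (p o - 2 * u o + c * u o) := by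
        intro o
        rw [hqo]
        rcases (hp0 o).eq_or_lt with h0 | h0
        · have h1 := hle o
          rw [← h0, mul_zero] at h1
          have h2 : u o = 0 := le_antisymm h1 (hu0 o)
          rw [h2, ← h0]
          simp
        · have e : (p o - ((1 - τ) * p o + τ * u o)) ^ 2 / ((1 - τ) * p o) =
              τ ^ 2 / (1 - τ) * (p o - 2 * u o + u o * u o / p o) := by
            field_simp
            ring
          rw [e]
          refine mul_le_mul_of_nonneg_left (add_le_add_right ?_ _) (by positivity)
          rw [div_le_iff₀ h0]
          have := mul_le_mul_of_nonneg_left (hle o) (hu0 o)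
          linarith
      refine (Finset.sum_le_sum fun o _ => h1 o).trans ?_
      rw [← Finset.mul_sum, Finset.sum_add_distrib, Finset.sum_sub_distrib, ← Finset.mul_sum, ← Finset.mul_sum,
        hp1, hu1]
      have h2 : τ ^ 2 / (1 - τ) ≤ Δ ^ 2 := by
        have e : τ ^ 2 / (1 - τ) = Δ ^ 2 / (1 + Δ) := by
          rw [hτ', hτ]
          field_simp
        rw [e]
        exact div_le_self (by positivity) (by linarith)
      have h3 : 0 ≤ τ ^ 2 / (1 - τ) := by positivity
      calc _ = τ ^ 2 / (1 - τ) * c - τ ^ 2 / (1 - τ) := by ring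
        _ ≤ Δ ^ 2 * c := by
          have := mul_le_mul_of_nonneg_right h2 hc0.le
          linarith
        _ = _ := by
          rw [hc]
          ring
  have htie : ∃ S₁ S₂ : KSet n k, S₁ ≠ S₂ ∧ (∀ S' : KSet n k, expReward ν' S' ≤ expReward ν' S₁) ∧
      ∀ S' : KSet n k, expReward ν' S' ≤ expReward ν' S₂ := by
    have hne : S₁ ≠ d.best := by
      rintro rfl
      obtain ⟨j, hj⟩ := hJ
      exact Finset.disjoint_left.1 hJb hj (hJS hj)
    have hrρ : ∀ S' : KSet n k, expReward ρ S' = ∑ j ∈ S'.1, q j := fun S' =>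
      expReward_singlesDensity _ _ S'
    have hrν' : ∀ S' : KSet n k, expReward ν' S' = (1 - τ) * expReward ν S' + τ * ∑ j ∈ S'.1, q j := by
      intro S'
      rw [hν', expReward_mix, hrρ]
    set p₀ : ℝ := 1 - (d.z + d.w * (1 / 2) ^ (k - d.G.card)) with hp₀
    have hτΔ : (1 - τ) * Δ = τ := by rw [hτ', hτ]; ring
    have hbest : expReward ν' d.best = (1 - τ) * p₀ + τ := by
      rw [hrν', expReward_eq, d.isMain_none hν d.G_subset, if_pos rfl,
        Finset.sum_eq_zero fun j hj => if_neg fun h => Finset.disjoint_left.1 hJb h hj]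
      have e : 1 - (d.z + d.w * (1 / 2) ^ (k - d.G.card) * (1 - d.e)) = p₀ + Δ := by
        rw [hp₀, hΔ]
        ring
      rw [e]
      linarith
    have hS₁ : expReward ν' S₁ = (1 - τ) * p₀ + τ := by
      have h1 : ∑ j ∈ S₁.1, q j = 1 := by
        rw [← hsumJ]
        refine Finset.sum_subset (Finset.subset_univ _) fun j _ hj => if_neg fun h => hj (hJS h)
      rw [hrν', expReward_eq, d.isMain_none hν hG, if_neg hne, h1]
      ring
    have hall : ∀ S' : KSet n k, expReward ν' S' ≤ (1 - τ) * p₀ + τ := by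
      intro S'
      by_cases hb : S' = d.best
      · rw [hb, hbest]
      · rw [hrν']
        have h1 : expReward ν S' ≤ p₀ := by
          rw [expReward_eq]
          by_cases h : d.G ⊆ S'.1
          · rw [d.isMain_none hν h, if_neg hb]
            linarith
          · linarith [d.isMain_none_ge hν h]
        have h2 : ∑ j ∈ S'.1, q j ≤ 1 := by
          rw [← hsumJ]
          exact Finset.sum_le_sum_of_subset_of_nonneg (Finset.subset_univ _) fun j _ _ => hq0 j
        have h3 := mul_le_mul_of_nonneg_left h1 hτ1.le
        have h4 := mul_le_mul_of_nonneg_left h2 hτ0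
        linarith
    exact ⟨S₁, d.best, hne, fun S' => (hall S').trans hS₁.ge, fun S' => (hall S').trans hbest.ge⟩
  intro δ hδ
  by_cases hL : 0 ≤ Real.log (1 / (2 * δ))
  · have hK : 0 < 1 / 2 * Δ ^ 2 / (J.card * σ) := by positivity
    refine requiresObs_of_alternatives ν ({()} : Finset Unit) (by have := d.G_card; omega) (fun _ => ν')
      (fun _ => 1) (fun _ _ => 1 / 2 * Δ ^ 2 / (J.card * σ)) hδ hK (fun _ _ => zero_le_one) (fun _ _ => hKL)
      (fun _ _ => htie) (fun _ => by simp) ?_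
    refine mul_le_mul_of_nonneg_right ?_ hL
    rw [Finset.sum_const, Finset.card_singleton, one_smul, le_div_iff₀ hK]
    exact hMK
  · exact requiresObs_of_nonpos (mul_nonpos_of_nonneg_of_nonpos hM (not_le.1 hL).le)

end Design

end Singles

/-! ### Estimates for `n < 2 * k` -/

section FewExtraArms

variable {n k : ℕ}

/-- Induction with the recursion of the central binomial coefficients. The start is tight: `1470 ≤
1536` at `k = 4`. -/
lemma mul_centralBinom_le (hk : 4 ≤ k) : 3 * (2 * k - 1) * k.centralBinom ≤ 2 * 4 ^ k * (k - 1) := by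
  induction k, hk using Nat.le_induction with
  | base => decide
  | succ k hk ih =>
    obtain ⟨j, rfl⟩ : ∃ j, k = j + 1 := ⟨k - 1, by omega⟩
    have h1 := Nat.succ_mul_centralBinom_succ (j + 1)
    have e1 : 2 * (j + 1) - 1 = 2 * j + 1 := by omega
    have e2 : 2 * (j + 1 + 1) - 1 = 2 * j + 3 := by omega
    rw [e1, Nat.add_sub_cancel] at ih
    rw [e2, Nat.add_sub_cancel]
    have hpos : 0 < (j + 1 + 1) * (2 * j + 1) := by positivity
    refine Nat.le_of_mul_le_mul_left ?_ hpos
    calc (j + 1 + 1) * (2 * j + 1) * (3 * (2 * j + 3) * (j + 1 + 1).centralBinom)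
        = 3 * (2 * j + 1) * (2 * j + 3) * ((j + 1 + 1) * (j + 1 + 1).centralBinom) := by ring
      _ = 2 * (2 * j + 3) ^ 2 * (3 * (2 * j + 1) * (j + 1).centralBinom) := by
        rw [h1]
        ring
      _ ≤ 2 * (2 * j + 3) ^ 2 * (2 * 4 ^ (j + 1) * j) := Nat.mul_le_mul_left _ ih
      _ = 4 * 4 ^ (j + 1) * ((2 * j + 3) ^ 2 * j) := by ring
      _ ≤ 4 * 4 ^ (j + 1) * (2 * ((j + 1 + 1) * (2 * j + 1) * (j + 1))) := by
        refine Nat.mul_le_mul_left _ ?_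
        nlinarith [Nat.zero_le (j ^ 3), Nat.zero_le (j ^ 2)]
      _ = (j + 1 + 1) * (2 * j + 1) * (2 * 4 ^ (j + 1 + 1) * (j + 1)) := by ring

/-- The worst case is `n = 2 * k - 1`, where the binomial coefficient is half the central one; the
induction descends from there, since `n * n.choose k / (n - k)` increases with `n` in this range. -/
lemma three_mul_choose_le (hk : 4 ≤ k) (hkn : k < n) (hn : n < 2 * k) :
    3 * n * n.choose k ≤ 4 ^ k * (n - k) := by
  obtain ⟨m, rfl⟩ : ∃ m, n = k + m := ⟨n - k, by omega⟩
  have hm : m ≤ k - 1 := by omega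
  have hm0 : 0 < m := by omega
  rw [Nat.add_sub_cancel_left]
  clear hn hkn
  induction hm using Nat.decreasingInduction with
  | self =>
    have h1 := mul_centralBinom_le hk
    have h2 : (k + (k - 1)).choose k * 2 = k.centralBinom := by
      obtain ⟨j, rfl⟩ : ∃ j, k = j + 1 := ⟨k - 1, by omega⟩
      rw [Nat.centralBinom_eq_two_mul_choose, Nat.add_sub_cancel, show 2 * (j + 1) = (j + 1 + j) + 1 by ring,
        Nat.choose_succ_succ, Nat.choose_symm_of_eq_add (n := j + 1 + j) (a := j) (b := j + 1) (by ring)]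
      ring
    have e : k + (k - 1) = 2 * k - 1 := by omega
    rw [← h2, e] at h1
    rw [e]
    refine Nat.le_of_mul_le_mul_left ?_ (show 0 < 2 by norm_num)
    calc _ = 3 * (2 * k - 1) * ((2 * k - 1).choose k * 2) := by ring
      _ ≤ _ := h1
      _ = _ := by ring
  | of_succ j hj ih =>
    have h1 := Nat.add_one_mul_choose_eq (k + j) j
    have h2 : (k + j).choose j = (k + j).choose k := Nat.choose_symm_of_eq_add (by ring)
    have h3 : (k + j + 1).choose (j + 1) = (k + (j + 1)).choose k := by
      rw [add_assoc]
      exact Nat.choose_symm_of_eq_add (by ring)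
    rw [h2, h3] at h1
    have ih := ih (by omega)
    set x := (k + j).choose k
    set y := (k + (j + 1)).choose k
    have hpos : 0 < (j + 1) * (j + 1) := by positivity
    refine Nat.le_of_mul_le_mul_left ?_ hpos
    calc (j + 1) * (j + 1) * (3 * (k + j) * x) = 3 * x * ((k + j) * ((j + 1) * (j + 1))) := by ring
      _ ≤ 3 * x * ((k + j + 1) * ((k + j + 1) * j)) := by
        refine Nat.mul_le_mul_left _ (Nat.mul_le_mul (by omega) ?_)
        have : j + 1 + (j + 1) ≤ k + j + 1 := by omega
        nlinarith
      _ = 3 * (k + (j + 1)) * j * ((k + j + 1) * x) := by ring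
      _ = (3 * (k + (j + 1)) * y) * (j * (j + 1)) := by
        rw [h1]
        ring
      _ ≤ 4 ^ k * (j + 1) * (j * (j + 1)) := Nat.mul_le_mul_right _ ih
      _ = (j + 1) * (j + 1) * (4 ^ k * j) := by ring

lemma two_mul_sub_one_mul_le (hk : 5 ≤ k) : (2 * (k : ℝ) - 1) * (1 / 2) ^ k ≤ 9 / 32 := by
  induction k, hk using Nat.le_induction with
  | base => norm_num
  | succ k hk ih =>
    have hk' : (5 : ℝ) ≤ k := by exact_mod_cast hk
    have := half_pow_pos k
    rw [pow_succ]
    push_cast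
    nlinarith

lemma two_mul_sub_one_mul_mul_le (hk : 4 ≤ k) :
    (2 * (k : ℝ) - 1) * (2 * k - 2) * (1 / 2) ^ k ≤ 21 / 8 := by
  induction k, hk using Nat.le_induction with
  | base => norm_num
  | succ k hk ih =>
    have hk' : (4 : ℝ) ≤ k := by exact_mod_cast hk
    have := half_pow_pos k
    rw [pow_succ]
    push_cast
    have h1 : (2 * ((k : ℝ) + 1) - 1) * (2 * (k + 1) - 2) ≤ 2 * ((2 * k - 1) * (2 * k - 2)) := by nlinarith
    have h2 := mul_le_mul_of_nonneg_right h1 this.le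
    linarith

namespace Design

variable (d : Design n k)

lemma markLower_one {r : ℕ} (hr : k - d.G.card = r) :
    d.markLower 1 = d.w * ((1 - 2 * (1 / 2) ^ (r + 1)) / (r + 1)) := by
  rw [markLower, hr, Nat.sub_self, markInt_zero_right]
  push_cast
  ring

lemma partialBound_one {r : ℕ} (hr : k - d.G.card = r) (hr0 : 0 < r) (ht : (2 : ℝ) * (1 / 2) ^ (r + 1) ≠ 1)
    (α : ℝ) : d.partialBound α 1 = 1 / 2 * (d.w * d.e * (1 / 2) ^ (r + 1)) ^ 2 *
      (1 / α + (r + 4) / (r * (d.w * (1 - 2 * (1 / 2) ^ (r + 1))))) := by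
  have hw := d.w_pos
  have hr' : (0 : ℝ) < r := by exact_mod_cast hr0
  have e1 : ((r - 1 : ℕ) : ℝ) = r - 1 := by rw [Nat.cast_sub hr0, Nat.cast_one]
  have e2 : 1 - (2 : ℝ) * (1 / 2) ^ (r + 1) ≠ 0 := sub_ne_zero.2 ht.symm
  rw [partialBound, d.markLower_one hr, hr, Nat.sub_self, markInt_zero_right, markInt_one_right, e1]
  congr 2
  generalize (1 - (2 : ℝ) * (1 / 2) ^ (r + 1)) = y at e2 ⊢
  have e3 : (r : ℝ) - 1 + 1 = r := by ring
  have e4 : (r : ℝ) - 1 + 2 = r + 1 := by ring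
  rw [e3, e4]
  push_cast
  field_simp
  ring

lemma markLower_two {r : ℕ} (hr : k - d.G.card = r) :
    d.markLower 2 = d.w * ((1 - (1 / 2) ^ (r + 2) - (1 / 2) ^ (r + 2) * ((r + 3) / (r + 1))) / (r + 2)) := by
  rw [markLower, hr, markInt_one_right]
  push_cast
  field_simp
  ring

/-- `5 / 6 = 1 - 1 / 16 - 5 / 48` is the value at `r = 2`. -/
lemma markLower_two_ge {r : ℕ} (hr : k - d.G.card = r) (hr2 : 2 ≤ r) :
    d.w * (5 / 6 / (r + 2)) ≤ d.markLower 2 := by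
  have hw := d.w_pos
  have hr' : (2 : ℝ) ≤ r := by exact_mod_cast hr2
  have ht : ((1 : ℝ) / 2) ^ (r + 2) ≤ 1 / 16 := (half_pow_le (show 4 ≤ r + 2 by omega)).trans (by norm_num)
  have ht0 := half_pow_pos (r + 2)
  rw [d.markLower_two hr]
  have h1 : ((r : ℝ) + 3) / (r + 1) ≤ 5 / 3 := by
    rw [div_le_div_iff₀ (by positivity) (by norm_num)]
    linarith
  have h2 := mul_le_mul ht h1 (by positivity) (by norm_num)
  refine mul_le_mul_of_nonneg_left (div_le_div_of_nonneg_right ?_ (by positivity)) hw.le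
  linarith

lemma partialBound_two_le {r : ℕ} (hr : k - d.G.card = r) (hr2 : 2 ≤ r) (α : ℝ) :
    d.partialBound α 2 ≤ 1 / 2 * (d.w * d.e * (1 / 2) ^ (r + 2)) ^ 2 * (1 / α + 10 / d.w) := by
  have hw := d.w_pos
  have hr' : (2 : ℝ) ≤ r := by exact_mod_cast hr2
  have e1 : ((r - 1 : ℕ) : ℝ) = r - 1 := by rw [Nat.cast_sub (by omega), Nat.cast_one]
  have e3 : (r : ℝ) - 1 + 1 = r := by ring
  have e4 : (r : ℝ) - 1 + 2 = r + 1 := by ring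
  have e5 : (r : ℝ) - 1 + 3 = r + 2 := by ring
  rw [partialBound, hr, markInt_two_right, show 2 - 1 = 1 from rfl, markInt_one_right, e1, e3, e4, e5]
  refine mul_le_mul_of_nonneg_left (add_le_add_right ?_ _) (by positivity)
  have hm := d.markLower_two_ge hr hr2
  have hpos : 0 < d.w * (5 / 6 / ((r : ℝ) + 2)) := by positivity
  refine (div_le_div_of_nonneg_left (by positivity) hpos hm).trans ?_
  have e : ((r : ℝ) * (4 / r - 4 / (r + 1) + 1 / (r + 2)) ^ 2 + (2 : ℕ) * (2 / (r + 1) - 1 / (r + 2)) ^ 2) /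
      (d.w * (5 / 6 / (r + 2))) = 6 * ((r ^ 2 + 5 * r + 8) ^ 2 + 2 * r * (r + 3) ^ 2) /
        (5 * d.w * (r * (r + 1) ^ 2 * (r + 2))) := by
    have : (r : ℝ) ≠ 0 := by positivity
    push_cast
    field_simp
    ring
  rw [e, div_le_div_iff₀ (by positivity) hw]
  -- With `r = 2 + t` the comparison is between polynomials in `t ≥ 0`, coefficient by coefficient.
  have h1 : 6 * (((r : ℝ) ^ 2 + 5 * r + 8) ^ 2 + 2 * r * (r + 3) ^ 2) ≤ 50 * (r * (r + 1) ^ 2 * (r + 2)) := by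
    obtain ⟨t, ht, h⟩ : ∃ t : ℝ, 0 ≤ t ∧ (r : ℝ) = 2 + t := ⟨r - 2, by linarith, by ring⟩
    rw [h]
    have h2 := pow_nonneg ht 2
    have h3 := pow_nonneg ht 3
    have h4 := pow_nonneg ht 4
    ring_nf
    linarith
  have := mul_le_mul_of_nonneg_right h1 hw.le
  linarith

/-- The single alternative favours `m` arms outside `best`; `m + G.card ≤ k` lets one `k`-set
contain them together with `G`, so that it can tie. -/
lemma semiHardFor_ofSingles (hkn : k < n) (best : KSet n k) {G : Finset (Fin n)} (hG : G ⊆ best.1)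
    (hGk : G.card < k) (s w e α : ℝ) (hs : 0 < s) (hα : 0 ≤ α) (hw : 0 < w) (he : 0 < e) (he1 : e ≤ 1 / 2)
    (hsum : α + n * s + G.card * (w * (1 / 2) ^ (k - G.card)) + w = 1) {ν : PMF (Rewards n)}
    (hν : (ofSingles hkn best hG hGk s w e α hs.le hα hw he he1 hsum).IsMain ν) {m : ℕ} (hm : 0 < m)
    (hmn : m ≤ n - k) (hmG : m + G.card ≤ k) {M : ℝ} (hM : 0 ≤ M)
    (hMK : M * (1 / 2 * (w * e * (1 / 2) ^ (k - G.card)) ^ 2 / (m * s)) ≤ 1) : HardFor (semiBandit n k) ν M := by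
  obtain ⟨J, hJ, hJm⟩ := Finset.exists_subset_card_eq (s := best.1ᶜ) (n := m) (by
    rw [Finset.card_compl, best.2, Fintype.card_fin]
    exact hmn)
  obtain ⟨S, hS, hSk⟩ := Finset.exists_superset_card_eq (s := G ∪ J) (n := k)
    ((Finset.card_union_le _ _).trans (by omega)) (by simpa using hkn.le)
  have hJb : Disjoint J best.1 := Finset.subset_compl_iff_disjoint_right.1 hJ
  refine hardFor_of_mix _ hν hs (J := J) (Finset.card_pos.1 (by omega)) hJb (S₁ := ⟨S, hSk⟩)
    (Finset.subset_union_left.trans hS) (Finset.subset_union_right.trans hS) (fun S' o => ?_) hM (by rw [hJm]; exact hMK)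
  change _ ≤ obsSum (semiBandit n k) (singlesDensity α fun j => s + if j ∈ G then w * (1 / 2) ^ (k - G.card) else 0) S' o
  rw [obsSum_singlesDensity, Finset.mul_sum]
  have hp : ∀ x, 0 ≤ ((semiBandit n k).channel S' x o).toReal := fun x => ENNReal.toReal_nonneg
  have hq : ∀ j, s ≤ s + if j ∈ G then w * (1 / 2) ^ (k - G.card) else 0 := fun j => by
    split_ifs
    · have : 0 ≤ w * (1 / 2) ^ (k - G.card) := by positivity
      linarith
    · simp
  calc _ ≤ ∑ j ∈ J, (s + if j ∈ G then w * (1 / 2) ^ (k - G.card) else 0) *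
        ((semiBandit n k).channel S' (single j) o).toReal :=
        Finset.sum_le_sum fun j _ => mul_le_mul_of_nonneg_right (hq j) (hp _)
    _ ≤ ∑ j, (s + if j ∈ G then w * (1 / 2) ^ (k - G.card) else 0) *
        ((semiBandit n k).channel S' (single j) o).toReal :=
        Finset.sum_le_sum_of_subset_of_nonneg (Finset.subset_univ _)
          fun j _ _ => mul_nonneg (hs.le.trans (hq j)) (hp _)
    _ ≤ _ := le_add_of_nonneg_left (mul_nonneg hα (hp _))

lemma le_obsSum_ofSingles (hkn : k < n) (best : KSet n k) {G : Finset (Fin n)} (hG : G ⊆ best.1)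
    (hGk : G.card < k) (s w e α : ℝ) (hs : 0 ≤ s) (hα : 0 ≤ α) (hw : 0 < w) (he : 0 < e) (he1 : e ≤ 1 / 2)
    (hsum : α + n * s + G.card * (w * (1 / 2) ^ (k - G.card)) + w = 1) (S : KSet n k) :
    α ≤ obsSum (markedBandit n k) (ofSingles hkn best hG hGk s w e α hs hα hw he he1 hsum).Q S
      (none : Option (Fin n)) := by
  change α ≤ obsSum (markedBandit n k) (singlesDensity α fun j => s + if j ∈ G then w * (1 / 2) ^ (k - G.card) else 0)
    S (none : Option (Fin n))
  rw [obsSum_singlesDensity_none]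
  refine le_add_of_nonneg_right (Finset.sum_nonneg fun j _ => ?_)
  split_ifs <;> positivity

end Design

/-- The semi-bandit requirement is implied by a bound on the number `m` of arms that are made more
likely. -/
lemma semi_mul_le_one (hk4 : 4 ≤ k) (hkn : k < n) (hn : n < 2 * k) {D : ℝ} (hD : 0 < D) (hD1 : D < 1) {m : ℕ}
    (hm : 0 < m) (h : (1 - D) * (16 / 9) * ((n - k : ℕ) : ℝ) ≤ m) :
    2 / 3 * (1 - D) / D ^ 2 * (n.choose k : ℝ) *
      (1 / 2 * (D * (1 / 2) ^ k) ^ 2 / (m * (1 / (16 * n)))) ≤ 1 := by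
  have h1 : (3 * n * n.choose k : ℝ) ≤ 4 ^ k * ((n - k : ℕ) : ℝ) := by
    exact_mod_cast three_mul_choose_le hk4 hkn hn
  have hn0 : (0 : ℝ) < n := by exact_mod_cast (show 0 < n by omega)
  have hm0 : (0 : ℝ) < m := by exact_mod_cast hm
  have e4 : ((1 : ℝ) / 2) ^ k * (1 / 2) ^ k = 1 / 4 ^ k := by
    rw [← mul_pow, ← one_div_pow]
    norm_num
  have hd1 : 0 < 1 - D := by linarith
  have e : 2 / 3 * (1 - D) / D ^ 2 * (n.choose k : ℝ) *
      (1 / 2 * (D * (1 / 2) ^ k) ^ 2 / (m * (1 / (16 * n)))) =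
      16 / 9 * (1 - D) * (3 * n * n.choose k) / (4 ^ k * m) := by
    have e5 : (D * ((1 : ℝ) / 2) ^ k) ^ 2 = D ^ 2 * (1 / 4 ^ k) := by
      rw [← e4]
      ring
    rw [e5]
    field_simp
    ring
  rw [e, div_le_one (by positivity)]
  calc _ ≤ 16 / 9 * (1 - D) * (4 ^ k * ((n - k : ℕ) : ℝ)) := mul_le_mul_of_nonneg_left h1 (by positivity)
    _ = 4 ^ k * ((1 - D) * (16 / 9) * ((n - k : ℕ) : ℝ)) := by ring
    _ ≤ _ := mul_le_mul_of_nonneg_left h (by positivity)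

end FewExtraArms

/-! ### Large gaps with few extra arms -/

section CommonArmNumerics

variable {n k : ℕ}

lemma common_arm_bound {D : ℝ} (hD : 9 / 20 ≤ D) (hD1 : D ≤ 3 / 4) :
    7 / 96 * ((1 - D ^ 2) / D * (1 - 1 / (16 * D))) * (1 / (15 / 16 - 9 / 8 * D) + 8 / (3 * D)) ≤ 1 := by
  have hD0 : 0 < D := by linarith
  have h1 : 0 < 15 - 18 * D := by linarith
  have e : 7 / 96 * ((1 - D ^ 2) / D * (1 - 1 / (16 * D))) * (1 / (15 / 16 - 9 / 8 * D) + 8 / (3 * D)) =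
      7 * (1 - D ^ 2) * (16 * D - 1) * (5 - 4 * D) / (192 * D ^ 3 * (15 - 18 * D)) := by
    have e1 : 15 / 16 - 9 / 8 * D = (15 - 18 * D) / 16 := by ring
    obtain ⟨y, hy⟩ : ∃ y, y = 15 - 18 * D := ⟨_, rfl⟩
    rw [e1]
    rw [← hy] at h1 ⊢
    field_simp
    rw [hy]
    ring
  rw [e, div_le_one (by positivity)]
  have hb : ∀ i j : ℕ, 0 ≤ (D - 9 / 20) ^ i * (3 / 4 - D) ^ j := fun i j =>
    mul_nonneg (pow_nonneg (by linarith) _) (pow_nonneg (by linarith) _)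
  linarith [hb 0 5, hb 1 4, hb 2 3, hb 3 2, hb 4 1, hb 5 0]

lemma mul_choose_sub_one (hk : 1 ≤ k) (hkn : k ≤ n) :
    (n : ℝ) * ((n - 1).choose (k - 1) : ℕ) = n.choose k * k := by
  have h := Nat.add_one_mul_choose_eq (n - 1) (k - 1)
  rw [Nat.sub_add_cancel (by omega), Nat.sub_add_cancel hk] at h
  exact_mod_cast h

lemma mul_choose_sub_two (hk : 2 ≤ k) (hkn : k ≤ n) :
    (n : ℝ) * ((n - 1) * ((n - 2).choose (k - 2) : ℕ)) = n.choose k * k * (k - 1) := by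
  have h1 := mul_choose_sub_one (n := n) (k := k) (by omega) hkn
  have h2 := mul_choose_sub_one (n := n - 1) (k := k - 1) (by omega) (by omega)
  rw [Nat.cast_sub (by omega), Nat.cast_sub (by omega), Nat.cast_one, Nat.sub_sub, Nat.sub_sub] at h2
  rw [h2, ← mul_assoc, h1]

lemma le_two_mul_sub_one (hn : n < 2 * k) : (n : ℝ) ≤ 2 * k - 1 := by
  have h : (n : ℝ) + 1 ≤ 2 * k := by exact_mod_cast hn
  linarith

/-- The factor `n` comes from the loss `k / n` in the number of alternatives. At `k = 4` the factor
`1 - T / D` is needed, and `7 / 16` is `(2 * k - 1) * T`; for `k ≥ 5` the bound `9 / 32` leaves room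
to drop that factor. -/
lemma common_arm_mul_le (hk4 : 4 ≤ k) (hn : n < 2 * k) {D : ℝ} (hD : 9 / 20 ≤ D) (hD1 : D ≤ 3 / 4) {B : ℝ}
    (hB : B ≤ ((1 / 2) ^ k / D - D * (1 / 2) ^ k) * (1 - (1 / 2) ^ k / D)) :
    1 / 6 * (n * B) * (1 / (15 / 16 - 9 / 8 * D) + 8 / (3 * D)) ≤ 1 := by
  have hD0 : 0 < D := by linarith
  have hn0 : (0 : ℝ) ≤ n := Nat.cast_nonneg n
  have hn2 := le_two_mul_sub_one hn
  have hT0 := half_pow_pos k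
  have hT1 : ((1 : ℝ) / 2) ^ k ≤ 1 / 16 := (half_pow_le hk4).trans (by norm_num)
  have hY0 : 0 ≤ 1 / (15 / 16 - 9 / 8 * D) + 8 / (3 * D) :=
    add_nonneg (div_nonneg zero_le_one (by linarith)) (by positivity)
  have hnT : n * ((1 / 2) ^ k * (1 - (1 / 2) ^ k / D)) ≤ 7 / 16 * (1 - 1 / (16 * D)) := by
    rcases hk4.eq_or_lt with h | h
    · subst h
      have e : ((1 : ℝ) / 2) ^ 4 = 1 / 16 := by norm_num
      have e2 : 1 / 16 / D = 1 / (16 * D) := by field_simp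
      rw [e, e2]
      have h3 : 0 ≤ 1 - 1 / (16 * D) := by
        rw [sub_nonneg, div_le_one (by positivity)]
        linarith
      have h4 := mul_le_mul_of_nonneg_right hn2 h3
      push_cast at h4
      linarith
    · have h2 := two_mul_sub_one_mul_le (show 5 ≤ k from h)
      set T : ℝ := (1 / 2) ^ k
      have h4 : 0 ≤ T / D := by positivity
      have h5 : (n : ℝ) * (T * (1 - T / D)) ≤ n * (T * 1) :=
        mul_le_mul_of_nonneg_left (mul_le_mul_of_nonneg_left (by linarith) hT0.le) hn0
      have h6 : (n : ℝ) * T ≤ (2 * k - 1) * T := mul_le_mul_of_nonneg_right hn2 hT0.le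
      have h7 : 1 / (16 * D) ≤ 5 / 36 := by
        rw [div_le_div_iff₀ (by positivity) (by norm_num)]
        linarith
      linarith
  set T : ℝ := (1 / 2) ^ k
  have h0 : 0 ≤ (1 - D ^ 2) / D := div_nonneg (by nlinarith) hD0.le
  have hnB : n * B ≤ 7 / 16 * ((1 - D ^ 2) / D * (1 - 1 / (16 * D))) := by
    calc (n : ℝ) * B ≤ n * ((T / D - D * T) * (1 - T / D)) := mul_le_mul_of_nonneg_left hB hn0
      _ = (1 - D ^ 2) / D * (n * (T * (1 - T / D))) := by
        field_simp
      _ ≤ (1 - D ^ 2) / D * (7 / 16 * (1 - 1 / (16 * D))) := mul_le_mul_of_nonneg_left hnT h0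
      _ = _ := by ring
  have := mul_le_mul_of_nonneg_right hnB hY0
  have := common_arm_bound hD hD1
  linarith

lemma two_common_arms_mul_le (hk4 : 4 ≤ k) (hkn : k < n) (hn : n < 2 * k) {D : ℝ} (hD : 3 / 4 ≤ D) (hD1 : D < 1)
    {B : ℝ} (hB : B ≤ ((1 / 2) ^ k / D - D * (1 / 2) ^ k) * (1 - (1 / 2) ^ k / D)) :
    5 / 9 * (n * (n - 1) * B) ≤ 1 := by
  have hD0 : 0 < D := by linarith
  have hn1 : (1 : ℝ) ≤ n := by exact_mod_cast (show 1 ≤ n by omega)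
  have hk1 : (1 : ℝ) ≤ k := by exact_mod_cast (show 1 ≤ k by omega)
  have hn2 := le_two_mul_sub_one hn
  have hT0 := half_pow_pos k
  have h2 := two_mul_sub_one_mul_mul_le hk4
  set T : ℝ := (1 / 2) ^ k
  have hnT : n * (n - 1) * T ≤ 21 / 8 := by
    refine le_trans (mul_le_mul_of_nonneg_right ?_ hT0.le) h2
    exact mul_le_mul hn2 (by linarith) (by linarith) (by linarith)
  have hDD : (1 - D ^ 2) / D ≤ 7 / 12 := by
    rw [div_le_iff₀ hD0]
    nlinarith
  have h0 : 0 ≤ (1 - D ^ 2) / D := div_nonneg (by nlinarith) hD0.le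
  have e : T / D - D * T = (1 - D ^ 2) / D * T := by field_simp
  have h1 : 0 ≤ T / D := by positivity
  have hBT : B ≤ 7 / 12 * T := by
    rw [e] at hB
    exact hB.trans ((mul_le_of_le_one_right (by positivity) (by linarith)).trans
      (mul_le_mul_of_nonneg_right hDD hT0.le))
  have := mul_le_mul_of_nonneg_left hBT (mul_nonneg (show (0 : ℝ) ≤ n by linarith) (sub_nonneg.2 hn1))
  linarith

set_option maxHeartbeats 800000 in
/-- Large gaps, when there are few extra arms and the gap is not too large. -/
lemma hasHard_of_common_arm (hk4 : 4 ≤ k) (hkn : k < n) (hn : n < 2 * k) {D : ℝ} (hD : 9 / 20 ≤ D)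
    (hD1 : D ≤ 3 / 4) : HasHard n k D := by
  have hD0 : 0 < D := by linarith
  have hd1 : 0 < 1 - D := by linarith
  have hn0 : (0 : ℝ) < n := by exact_mod_cast (show 0 < n by omega)
  have hk0 : (0 : ℝ) < k := by exact_mod_cast (show 0 < k by omega)
  have hC : (0 : ℝ) ≤ n.choose k := Nat.cast_nonneg _
  obtain ⟨best⟩ := exists_kSet (n := n) hkn.le
  obtain ⟨G, hG, hG1⟩ := Finset.exists_subset_card_eq (s := best.1) (n := 1) (by rw [best.2]; omega)
  have hT0 := half_pow_pos k
  have hT1 : ((1 : ℝ) / 2) ^ k ≤ 1 / 16 := (half_pow_le hk4).trans (by norm_num)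
  have h2T : ((1 : ℝ) / 2) ^ (k - 1) = 2 * (1 / 2) ^ k := by
    obtain ⟨r, rfl⟩ : ∃ r, k = r + 1 := ⟨k - 1, by omega⟩
    rw [Nat.add_sub_cancel, pow_succ]
    ring
  -- The mass is split into `D` for the modulated bits, `1 / 16` spread evenly over the single
  -- vectors, `2 * D * T` more for the common arm, and `α` at zero; `T ≤ 1 / 16` gives `a ≤ α`.
  set a : ℝ := 15 / 16 - 9 / 8 * D with ha
  have ha0 : 0 < a := by linarith
  set α : ℝ := 1 - D - 1 / 16 - D * (2 * (1 / 2) ^ k) with hα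
  have haα : a ≤ α := by nlinarith
  have hsum : α + n * (1 / (16 * n)) + G.card * (D * (1 / 2) ^ (k - G.card)) + D = 1 := by
    have e : (n : ℝ) * (1 / (16 * n)) = 1 / 16 := by field_simp
    rw [hG1, h2T, e, hα]
    push_cast
    ring
  have hGk : G.card < k := by omega
  have hs : (0 : ℝ) < 1 / (16 * n) := by positivity
  set d := Design.ofSingles hkn best hG hGk (1 / (16 * n)) D (1 / 2) α hs.le (ha0.le.trans haα) hD0
    (by norm_num) le_rfl hsum with hd
  have hdG : d.G.card = 1 := hG1
  have hdw : d.w = D := rfl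
  have hde : d.e = 1 / 2 := rfl
  have hdz : d.z = α + 1 / (16 * n) * (n - k) := rfl
  obtain ⟨ν, hν⟩ := d.exists_isMain
  obtain ⟨hbest, hgap⟩ := d.isBest_and_gap hν
  have hgap' : gap ν best = D * (1 / 2) ^ k := by
    refine hgap.trans ?_
    rw [hdG, hdw, hde, h2T]
    ring
  have hr : k - d.G.card = k - 1 := by rw [hdG]
  have hr1 : k - 1 + 1 = k := by omega
  refine ⟨ν, best, hbest, hgap', fun B hB hB1 hB2 => ?_, ?_⟩
  · set T : ℝ := (1 / 2) ^ k with hT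
    have hB3 := hB2 (largeDesign_cond hT0 (by linarith) hD)
    set Y : ℝ := 1 / a + 8 / (3 * D) with hY
    have hY0 : 0 < Y := by positivity
    -- A query without the common arm sees up to `k` characters at half the amplitude, hence the
    -- factor `k * (1 / 2) * (1 / 2) ^ 2 = k / 8`; this exceeds the factor `1 / 2` of a query with
    -- the common arm because `k ≥ 4`.
    refine d.banditHardFor_of_partial rfl hde.le ha0 (fun S' => haα.trans
      (Design.le_obsSum_ofSingles hkn best hG hGk _ _ _ _ hs.le (ha0.le.trans haα) hD0 (by norm_num) le_rfl
        hsum S')) ?_ hν (K := k / 8 * (D * T) ^ 2 * Y) (by positivity) (by positivity) ?_ ?_ ?_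
    · intro i hi hi1
      obtain rfl : i = 1 := by omega
      rw [d.markLower_one hr, hr1, hdw]
      have : 0 < 1 - 2 * T := by linarith
      positivity
    · rw [Design.ownBound, hr, h2T, hdw, hde]
      have hz : a ≤ d.z := by
        rw [hdz]
        have hkn' : (k : ℝ) ≤ n := by exact_mod_cast hkn.le
        have := mul_nonneg hs.le (sub_nonneg.2 hkn')
        linarith
      have i1 : 1 / (d.z + D * (2 * T) * (1 - 1 / 2)) ≤ 1 / a := by
        refine one_div_le_one_div_of_le ha0 ?_
        have : 0 < D * T := by positivity
        linarith
      have i2 : 1 / (D * (1 - 2 * T)) ≤ 8 / (3 * D) := by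
        rw [div_le_div_iff₀ (mul_pos hD0 (by linarith)) (by positivity)]
        nlinarith
      have e : 1 / 2 * (D * (1 / 2) * (2 * T)) ^ 2 = 1 / 2 * (D * T) ^ 2 := by ring
      rw [e]
      have hk4' : (4 : ℝ) ≤ k := by exact_mod_cast hk4
      have h1 : (1 : ℝ) / 2 * (D * T) ^ 2 ≤ k / 8 * (D * T) ^ 2 :=
        mul_le_mul_of_nonneg_right (by linarith) (by positivity)
      exact mul_le_mul h1 (add_le_add i1 i2) (add_nonneg (div_nonneg zero_le_one (by
        have : 0 < D * T := by positivity
        linarith)) (div_nonneg zero_le_one (mul_nonneg hD0.le (by linarith)))) (by positivity)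
    · intro i hi hi1
      obtain rfl : i = 1 := by omega
      rw [d.partialBound_one hr (by omega) (by rw [hr1]; linarith), hr, hr1, hdw, hde,
        Nat.choose_symm_of_eq_add hr1.symm, Nat.choose_one_right]
      have hr3 : (3 : ℝ) ≤ (k - 1 : ℕ) := by exact_mod_cast (show 3 ≤ k - 1 by omega)
      have i2 : (((k - 1 : ℕ) : ℝ) + 4) / ((k - 1 : ℕ) * (D * (1 - 2 * T))) ≤ 8 / (3 * D) := by
        have h2 : 0 < 1 - 2 * T := by linarith
        rw [div_le_div_iff₀ (by positivity) (by positivity)]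
        have h3 : (((k - 1 : ℕ) : ℝ) + 4) * 3 ≤ 8 * ((k - 1 : ℕ) * (1 - 2 * T)) := by
          have : ((k - 1 : ℕ) : ℝ) * (7 / 8) ≤ (k - 1 : ℕ) * (1 - 2 * T) :=
            mul_le_mul_of_nonneg_left (by linarith) (by linarith)
          linarith
        have := mul_le_mul_of_nonneg_right h3 hD0.le
        linarith
      have e : (k : ℝ) * (1 / 2 * (D * (1 / 2) * T) ^ 2 * (1 / a + ((k - 1 : ℕ) + 4) /
          ((k - 1 : ℕ) * (D * (1 - 2 * T))))) = k / 8 * (D * T) ^ 2 * (1 / a + ((k - 1 : ℕ) + 4) /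
          ((k - 1 : ℕ) * (D * (1 - 2 * T)))) := by ring
      rw [e]
      exact mul_le_mul_of_nonneg_left (by linarith) (by positivity)
    · have hch := mul_choose_sub_one (n := n) (k := k) (by omega) hkn.le
      rw [hdG]
      refine le_of_mul_le_mul_left ?_ hn0
      rw [hch]
      have h8 := common_arm_mul_le hk4 hn hD hD1 hB3
      rw [← ha, ← hY] at h8
      have hDT : D * T ≠ 0 := by positivity
      calc _ = (n.choose k * k : ℝ) * (1 / 6 * (n * B) * Y) := by
            field_simp
            ring
        _ ≤ n.choose k * k := mul_le_of_le_one_right (by positivity) h8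
  · have e : (D * (1 / 2) * (1 / 2) ^ (k - G.card)) ^ 2 = (D * (1 / 2) ^ k) ^ 2 := by
      rw [hG1, h2T]
      ring
    have hm : 0 < n - k := by omega
    have hm' : (0 : ℝ) < (n - k : ℕ) := by exact_mod_cast hm
    refine Design.semiHardFor_ofSingles hkn best hG hGk _ _ _ _ hs (ha0.le.trans haα) hD0 (by norm_num) le_rfl hsum hν
      hm le_rfl (by omega) (by positivity) ?_
    rw [e]
    refine semi_mul_le_one hk4 hkn hn hD0 (by linarith) hm ?_
    -- At `D = 9 / 20` the factor `(1 - D) * (16 / 9)` is `44 / 45`.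
    exact mul_le_of_le_one_left hm'.le (by linarith)

set_option maxHeartbeats 800000 in
/-- Large gaps, when there are few extra arms and the gap is close to the largest possible one. -/
lemma hasHard_of_two_common_arms (hk4 : 4 ≤ k) (hkn : k < n) (hn : n < 2 * k) {D : ℝ} (hD : 3 / 4 ≤ D)
    (hD1 : D < 1) : HasHard n k D := by
  have hD0 : 0 < D := by linarith
  have hd1 : 0 < 1 - D := by linarith
  have hn0 : (0 : ℝ) < n := by exact_mod_cast (show 0 < n by omega)
  have hk0 : (0 : ℝ) < k := by exact_mod_cast (show 0 < k by omega)
  have hk4' : (4 : ℝ) ≤ k := by exact_mod_cast hk4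
  have hkn' : (k : ℝ) + 1 ≤ n := by exact_mod_cast hkn
  have hC : (0 : ℝ) ≤ n.choose k := Nat.cast_nonneg _
  obtain ⟨best⟩ := exists_kSet (n := n) hkn.le
  obtain ⟨G, hG, hG1⟩ := Finset.exists_subset_card_eq (s := best.1) (n := 2) (by rw [best.2]; omega)
  have hT0 := half_pow_pos k
  have hT1 : ((1 : ℝ) / 2) ^ k ≤ 1 / 16 := (half_pow_le hk4).trans (by norm_num)
  obtain ⟨h2T, h4T⟩ : ((1 : ℝ) / 2) ^ (k - 1) = 2 * (1 / 2) ^ k ∧ ((1 : ℝ) / 2) ^ (k - 2) = 4 * (1 / 2) ^ k := by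
    obtain ⟨r, rfl⟩ : ∃ r, k = r + 2 := ⟨k - 2, by omega⟩
    rw [show r + 2 - 1 = r + 1 by omega, Nat.add_sub_cancel, pow_succ, pow_succ]
    constructor <;> ring
  -- Mass `1 / 2` goes to the modulated bits, `1 / 16` to the single vectors evenly, and `2 * T`
  -- more to each of the two common arms.
  set α : ℝ := 1 / 2 - 1 / 16 - 4 * (1 / 2) ^ k with hα
  have haα : 3 / 16 ≤ α := by linarith
  have hsum : α + n * (1 / (16 * n)) + G.card * (1 / 2 * (1 / 2) ^ (k - G.card)) + 1 / 2 = 1 := by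
    have e : (n : ℝ) * (1 / (16 * n)) = 1 / 16 := by field_simp
    rw [hG1, h4T, e, hα]
    push_cast
    ring
  have hGk : G.card < k := by omega
  have hs : (0 : ℝ) < 1 / (16 * n) := by positivity
  have hD2 : 0 < D / 2 := by positivity
  have hα0 : 0 ≤ α := by linarith
  set d := Design.ofSingles hkn best hG hGk (1 / (16 * n)) (1 / 2) (D / 2) α hs.le hα0 (by norm_num)
    hD2 (by linarith) hsum with hd
  have hdG : d.G.card = 2 := hG1
  have hdw : d.w = 1 / 2 := rfl
  have hde : d.e = D / 2 := rfl
  have hdz : d.z = α + 1 / (16 * n) * (n - k) := rfl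
  obtain ⟨ν, hν⟩ := d.exists_isMain
  obtain ⟨hbest, hgap⟩ := d.isBest_and_gap hν
  have hgap' : gap ν best = D * (1 / 2) ^ k := by
    refine hgap.trans ?_
    rw [hdG, hdw, hde, h4T]
    ring
  have hr : k - d.G.card = k - 2 := by rw [hdG]
  have hr1 : k - 2 + 1 = k - 1 := by omega
  have hr2 : k - 2 + 2 = k := by omega
  refine ⟨ν, best, hbest, hgap', fun B hB hB1 hB2 => ?_, ?_⟩
  · set T : ℝ := (1 / 2) ^ k with hT
    have hB3 := hB2 (largeDesign_cond hT0 (by linarith) (by linarith))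
    have hDT2 : 0 < (D * T) ^ 2 := by positivity
    have hk1 : 0 < (k : ℝ) - 1 := by linarith
    have hkk : 12 ≤ (k : ℝ) * (k - 1) := by nlinarith
    -- In units of `(D * T) ^ 2`, a query with both common arms costs at most `4`, one that misses
    -- one of them at most `(k - 1) * (5 / 3)`, and one that misses both at most `k * (k - 1) * (19
    -- / 48)`; for `k ≥ 4` the constant `5 / 12` covers all three.
    refine d.banditHardFor_of_partial rfl (by rw [hde]; linarith) (α := 3 / 16) (by norm_num) (fun S' => haα.trans
      (Design.le_obsSum_ofSingles hkn best hG hGk _ _ _ _ hs.le hα0 (by norm_num) hD2 (by linarith)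
        hsum S')) ?_ hν (K := k * (k - 1) * (5 / 12) * (D * T) ^ 2) (by positivity) (by positivity) ?_ ?_ ?_
    · intro i hi hi2
      obtain rfl | rfl : i = 1 ∨ i = 2 := by omega
      · rw [d.markLower_one hr, hr1, h2T, hdw]
        have : 0 < 1 - 2 * (2 * T) := by linarith
        positivity
      · refine lt_of_lt_of_le ?_ (d.markLower_two_ge hr (by omega))
        rw [hdw]
        positivity
    · rw [Design.ownBound, hr, h4T, hdw, hde]
      have hz : 3 / 16 ≤ d.z := by
        rw [hdz]
        have := mul_nonneg hs.le (show 0 ≤ (n : ℝ) - k by linarith)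
        linarith
      have i1 : 1 / (d.z + 1 / 2 * (4 * T) * (1 - D / 2)) ≤ 16 / 3 := by
        have : 0 ≤ 1 / 2 * (4 * T) * (1 - D / 2) := mul_nonneg (by positivity) (by linarith)
        rw [div_le_iff₀ (by linarith)]
        linarith
      have i2 : 1 / (1 / 2 * (1 - 4 * T)) ≤ 8 / 3 := by
        rw [div_le_iff₀ (by linarith)]
        linarith
      have e : 1 / 2 * (1 / 2 * (D / 2) * (4 * T)) ^ 2 = 1 / 2 * (D * T) ^ 2 := by ring
      rw [e]
      calc _ ≤ 1 / 2 * (D * T) ^ 2 * 8 := mul_le_mul_of_nonneg_left (by linarith) (by positivity)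
        _ ≤ _ := by nlinarith
    · intro i hi hi2
      obtain rfl | rfl : i = 1 ∨ i = 2 := by omega
      · rw [d.partialBound_one hr (by omega) (by rw [hr1, h2T]; linarith), hr, hr1, hdw, hde, h2T,
          Nat.choose_symm_of_eq_add hr1.symm, Nat.choose_one_right, Nat.cast_sub (show 1 ≤ k by omega), Nat.cast_one]
        have hr3 : (2 : ℝ) ≤ (k - 2 : ℕ) := by exact_mod_cast (show 2 ≤ k - 2 by omega)
        have i2 : (((k - 2 : ℕ) : ℝ) + 4) / ((k - 2 : ℕ) * (1 / 2 * (1 - 2 * (2 * T)))) ≤ 8 := by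
          have h2 : 0 < 1 - 2 * (2 * T) := by linarith
          rw [div_le_iff₀ (by positivity)]
          have : ((k - 2 : ℕ) : ℝ) * (3 / 4) ≤ (k - 2 : ℕ) * (1 - 2 * (2 * T)) :=
            mul_le_mul_of_nonneg_left (by linarith) (by linarith)
          linarith
        have e : 1 / 2 * (1 / 2 * (D / 2) * (2 * T)) ^ 2 = 1 / 8 * (D * T) ^ 2 := by ring
        rw [e]
        calc _ ≤ ((k : ℝ) - 1) * (1 / 8 * (D * T) ^ 2 * (40 / 3)) := by
              refine mul_le_mul_of_nonneg_left (mul_le_mul_of_nonneg_left ?_ (by positivity)) hk1.le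
              linarith
          _ = 4 * ((k - 1) * (5 / 12) * (D * T) ^ 2) := by ring
          _ ≤ k * ((k - 1) * (5 / 12) * (D * T) ^ 2) := mul_le_mul_of_nonneg_right hk4' (by positivity)
          _ = _ := by ring
      · have h := d.partialBound_two_le hr (by omega) (3 / 16)
        rw [hr2, hdw, hde] at h
        have hch : ((k.choose (k - 2) : ℕ) : ℝ) = k * (k - 1) / 2 := by
          rw [Nat.choose_symm_of_eq_add hr2.symm, Nat.cast_choose_two]
        rw [hr, hr2, hch]
        calc _ ≤ (k : ℝ) * (k - 1) / 2 * (1 / 2 * (1 / 2 * (D / 2) * T) ^ 2 * (1 / (3 / 16) + 10 / (1 / 2))) :=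
              mul_le_mul_of_nonneg_left h (by positivity)
          _ = k * (k - 1) * (19 / 48) * (D * T) ^ 2 := by ring
          _ ≤ _ := by
            have : 0 ≤ (k : ℝ) * (k - 1) * (D * T) ^ 2 := by positivity
            linarith
    · have hn1 : 0 < (n : ℝ) - 1 := by linarith
      have hch := mul_choose_sub_two (n := n) (k := k) (by omega) hkn.le
      rw [hdG]
      refine le_of_mul_le_mul_left ?_ (mul_pos hn0 hn1)
      rw [mul_assoc (n : ℝ) _ ((n - 2).choose (k - 2) : ℝ), hch]
      have h8 := two_common_arms_mul_le hk4 hkn hn hD hD1 hB3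
      have hDT : D * T ≠ 0 := by positivity
      calc _ = (n.choose k * k * (k - 1) : ℝ) * (5 / 9 * (n * (n - 1) * B)) := by
            field_simp
            ring
        _ ≤ n.choose k * k * (k - 1) := mul_le_of_le_one_right (by positivity) h8
  · have e : (1 / 2 * (D / 2) * (1 / 2) ^ (k - G.card)) ^ 2 = (D * (1 / 2) ^ k) ^ 2 := by
      rw [hG1, h4T]
      ring
    -- Half of the arms outside `best` suffice because `(1 - D) * (16 / 9) ≤ 4 / 9`, and they leave
    -- room for the two common arms.
    have hm : 0 < (n - k + 1) / 2 := by omega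
    refine Design.semiHardFor_ofSingles hkn best hG hGk _ _ _ _ hs hα0 (by norm_num) hD2 (by linarith) hsum hν
      hm (by omega) (by omega) (by positivity) ?_
    rw [e]
    refine semi_mul_le_one hk4 hkn hn hD0 hD1 hm ?_
    have h2 : ((n - k : ℕ) : ℝ) ≤ 2 * ((n - k + 1) / 2 : ℕ) := by
      exact_mod_cast (show n - k ≤ 2 * ((n - k + 1) / 2) by omega)
    have h3 : (0 : ℝ) ≤ (n - k : ℕ) := Nat.cast_nonneg _
    nlinarith

end CommonArmNumerics

/-! ### Assembly -/

section Assembly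

variable {n k : ℕ}

lemma HardFor.mono {F : Feedback n k} {ν : PMF (Rewards n)} {M M' : ℝ} (h : HardFor F ν M) (h0 : 0 ≤ M')
    (hle : M' ≤ M) : HardFor F ν M' := by
  intro δ hδ
  by_cases hL : 0 ≤ Real.log (1 / (2 * δ))
  · exact fun A hA => (ENNReal.ofReal_le_ofReal (mul_le_mul_of_nonneg_right hle hL)).trans (h δ hδ A hA)
  · exact requiresObs_of_nonpos (mul_nonpos_of_nonneg_of_nonpos h0 (not_le.1 hL).le)

lemma hasHard_of_lt_one (hk : 2 ≤ k) (hkn : k < n) {D : ℝ} (hD : 0 < D) (hD1 : D < 1) : HasHard n k D := by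
  rcases le_total D (3 / 8) with h1 | h1
  · obtain ⟨ν, S, hS, hgap, hb, hs⟩ := exists_hard_small (n := n) hk hkn hD h1
    refine ⟨ν, S, hS, hgap, fun B hB hB1 _ => hb B hB (hB1.trans ?_), hs⟩
    have hT0 := half_pow_pos k
    have hT1 : ((1 : ℝ) / 2) ^ k ≤ 1 := pow_le_one₀ (by norm_num) (by norm_num)
    have : 0 < D * (1 / 2) ^ k := by positivity
    have : D * (1 / 2) ^ k ≤ 1 := by nlinarith
    nlinarith
  rcases le_total D (9 / 20) with h2 | h2
  · exact hasHard_moderate hk hkn h1 h2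
  by_cases hk3 : k ≤ 3
  · exact hasHard_large_of_le_three (by omega) hkn h2 hD1
  by_cases hn : 2 * k ≤ n
  · exact hasHard_large_of_two_mul_le (by omega) hn hkn h2 hD1
  rcases le_total D (3 / 4) with h3 | h3
  · exact hasHard_of_common_arm (by omega) hkn (by omega) h2 h3
  · exact hasHard_of_two_common_arms (by omega) hkn (by omega) h3 hD1

lemma exists_isBest_and_gap (hk : 0 < k) (hkn : k < n) :
    ∃ (ν : PMF (Rewards n)) (S : KSet n k), IsBest ν S ∧ gap ν S = (1 / 2) ^ k := by
  obtain ⟨best⟩ := exists_kSet (n := n) hkn.le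
  obtain ⟨ν, hν⟩ := (Design.ofEmpty hk hkn best 1 1 1 one_pos le_rfl one_pos le_rfl zero_le_one le_rfl
    (by norm_num)).exists_isMain
  obtain ⟨h1, h2⟩ := Design.ofEmpty_isBest_and_gap _ _ _ _ _ _ _ _ _ _ _ _ _ hν
  exact ⟨ν, best, h1, by rw [h2]; ring⟩

/-- Distributions with gap `ε μ ^ k` that are hard for all three kinds of feedback. -/
lemma exists_hard_of_mul_pow (hk : 2 ≤ k) (hkn : k < n) {ε μ : ℝ} (hε : 0 < ε) (hε1 : ε ≤ 1) (hμ : 0 < μ)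
    (hμ1 : μ ≤ 1 / 2) : ∃ (ν : PMF (Rewards n)) (S : KSet n k), IsBest ν S ∧ gap ν S = ε * μ ^ k ∧
      BanditHardFor n k ν (4 * (1 - ε * (μ / (1 - μ)) ^ k) / 3 * (1 - (1 - μ) ^ k) * (1 - μ) ^ k *
        (n.choose k : ℝ) * ((ε * μ ^ k) ^ 2)⁻¹) ∧
      HardFor (semiBandit n k) ν
        (2 / 3 * μ ^ (2 * k) * (1 - ε) * (n.choose k : ℝ) * ((ε * μ ^ k) ^ 2)⁻¹) := by
  have h2μ : (2 * μ) ^ k ≤ 1 := pow_le_one₀ (by positivity) (by linarith)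
  have hμk : 0 < μ ^ k := by positivity
  by_cases hD : ε * (2 * μ) ^ k < 1
  · set D : ℝ := ε * (2 * μ) ^ k with hDdef
    have hD0 : 0 < D := by positivity
    have hDε : D ≤ ε := mul_le_of_le_one_right hε.le h2μ
    obtain ⟨ν, S, hS, hgap, hb, hs⟩ := hasHard_of_lt_one (n := n) hk hkn hD0 hD
    have hT0 := half_pow_pos k
    have hΔ : D * (1 / 2) ^ k = ε * μ ^ k := by
      rw [hDdef, mul_assoc, ← mul_pow]
      congr 2
      ring
    have hz0 : 0 < (1 - μ) ^ k := pow_pos (by linarith) k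
    have hz1 : (1 - μ) ^ k ≤ 1 := pow_le_one₀ (by linarith) (by linarith)
    have hzμ : μ ^ k ≤ (1 - μ) ^ k := pow_le_pow_left₀ hμ.le (by linarith) k
    -- This amounts to `4 * μ * (1 - μ) ≤ 1` and `ε ≤ 1`.
    have hzD : (1 - μ) ^ k * D ≤ (1 / 2) ^ k := by
      have e : (1 - μ) ^ k * D = ε * (4 * (μ * (1 - μ))) ^ k * (1 / 2) ^ k := by
        rw [hDdef, mul_assoc ε, ← mul_pow, mul_left_comm, ← mul_pow]
        congr 2
        ring
      rw [e]
      refine mul_le_of_le_one_left hT0.le (mul_le_one₀ hε1 ?_ (pow_le_one₀ ?_ ?_))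
      · exact pow_nonneg (mul_nonneg (by norm_num) (mul_nonneg hμ.le (by linarith))) k
      · exact mul_nonneg (by norm_num) (mul_nonneg hμ.le (by linarith))
      · nlinarith [sq_nonneg (2 * μ - 1)]
    rw [hΔ] at hgap hb
    refine ⟨ν, S, hS, hgap, ?_, hs.mono ?_ ?_⟩
    · have hΔz : ε * μ ^ k ≤ (1 - μ) ^ k := (mul_le_of_le_one_left hμk.le hε1).trans hzμ
      -- As a function of `z = (1 - μ) ^ k`, this `B` is a concave parabola with roots at the gap
      -- and at `1`. Its maximum gives the first condition of `HasHard`; for the second, `z ≤ (1 /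
      -- 2) ^ k / D`, and the parabola increases up to that point when the point is left of the
      -- vertex.
      have hB := hb (((1 - μ) ^ k - ε * μ ^ k) * (1 - (1 - μ) ^ k))
        (mul_nonneg (by linarith) (by linarith)) (by
          nlinarith [sq_nonneg ((1 - μ) ^ k - ε * μ ^ k - (1 - (1 - μ) ^ k))]) (fun hT => by
          rw [hΔ] at *
          have hy : (1 - μ) ^ k ≤ (1 / 2) ^ k / D := by rwa [le_div_iff₀ hD0]
          have hy1 : (1 / 2) ^ k / D ≤ (1 + ε * μ ^ k) / 2 := by
            rw [div_le_iff₀ hD0]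
            linarith
          nlinarith [mul_nonneg (sub_nonneg.2 hy)
            (show 0 ≤ 1 + ε * μ ^ k - (1 / 2) ^ k / D - (1 - μ) ^ k by linarith)])
      have e : 4 * (1 - ε * (μ / (1 - μ)) ^ k) / 3 * (1 - (1 - μ) ^ k) * (1 - μ) ^ k =
          4 / 3 * (((1 - μ) ^ k - ε * μ ^ k) * (1 - (1 - μ) ^ k)) := by
        rw [div_pow]
        field_simp
      rw [e]
      exact hB
    · have : 0 ≤ 1 - ε := by linarith
      positivity
    · have e : 2 / 3 * μ ^ (2 * k) * (1 - ε) * (n.choose k : ℝ) * ((ε * μ ^ k) ^ 2)⁻¹ =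
          2 / 3 * (1 - ε) / ε ^ 2 * n.choose k := by
        rw [mul_comm 2 k, pow_mul]
        field_simp
      rw [e]
      have : 0 ≤ 1 - ε := by linarith
      gcongr
  -- The extreme case `ε = 1`, `μ = 1 / 2`: all the claimed bounds contain a vanishing factor, and
  -- only the gap has to be realized.
  · have h1 : ε = 1 := le_antisymm hε1 (by nlinarith)
    subst h1
    rw [one_mul] at hD
    have h2 : μ = 1 / 2 := by
      by_contra h
      exact hD (pow_lt_one₀ (by positivity) (by linarith [lt_of_le_of_ne hμ1 h]) (by omega))
    subst h2
    obtain ⟨ν, S, hS, hgap⟩ := exists_isBest_and_gap (n := n) (k := k) (by omega) hkn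
    have e : (1 : ℝ) - 1 * (1 / 2 / (1 - 1 / 2)) ^ k = 0 := by norm_num
    refine ⟨ν, S, hS, by rw [hgap, one_mul], ⟨fun δ _ => requiresObs_of_nonpos ?_,
      fun δ _ => requiresObs_of_nonpos ?_⟩, fun δ _ => requiresObs_of_nonpos ?_⟩
    · rw [e]
      simp
    · rw [e]
      simp
    · simp

/-- Distributions with a small gap `ξ` that are hard for bandit feedback. -/
lemma exists_hard_of_le_inv_pow (hk : 2 ≤ k) (hkn : k < n) {ξ : ℝ} (hξ : 0 < ξ)
    (hξ1 : ξ ≤ ((2 * (k : ℝ)) ^ k)⁻¹) : ∃ (ν : PMF (Rewards n)) (S : KSet n k), IsBest ν S ∧ gap ν S = ξ ∧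
      BanditHardFor n k ν (1 / 3 * (n.choose k : ℝ) * (ξ ^ 2)⁻¹) := by
  have hk' : (2 : ℝ) ≤ k := by exact_mod_cast hk
  have hkk : (4 : ℝ) ≤ k ^ k := by
    calc (4 : ℝ) = 2 ^ 2 := by norm_num
      _ ≤ k ^ 2 := by gcongr
      _ ≤ k ^ k := pow_le_pow_right₀ (by linarith) hk
  -- Indeed `ξ * 2 ^ k` is at most the reciprocal of `k ^ k`, hence at most `1 / 4`.
  have hD : ξ * 2 ^ k ≤ 3 / 8 := by
    have h1 : ξ * 2 ^ k ≤ ((2 * (k : ℝ)) ^ k)⁻¹ * 2 ^ k := mul_le_mul_of_nonneg_right hξ1 (by positivity)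
    have h2 : ((2 * (k : ℝ)) ^ k)⁻¹ * 2 ^ k = 1 / k ^ k := by
      rw [mul_pow]
      field_simp
    have h3 : 1 / (k : ℝ) ^ k ≤ 1 / 4 := one_div_le_one_div_of_le (by norm_num) hkk
    linarith
  obtain ⟨ν, S, hS, hgap, hb, -⟩ := exists_hard_small (n := n) hk hkn (by positivity) hD
  have e : ξ * 2 ^ k * (1 / 2) ^ k = ξ := by
    rw [mul_assoc, ← mul_pow]
    norm_num
  rw [e] at hgap hb
  refine ⟨ν, S, hS, hgap, ?_⟩
  have := hb (1 / 4) (by norm_num) le_rfl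
  norm_num at this ⊢
  exact this

/-- Distributions with gap `ξ` that are hard for semi-bandit feedback. -/
lemma exists_hard_of_le_inv_two_pow (hk : 2 ≤ k) (hkn : k < n) {ξ : ℝ} (hξ : 0 < ξ)
    (hξ1 : ξ ≤ ((2 : ℝ) ^ (k + 1))⁻¹) : ∃ (ν : PMF (Rewards n)) (S : KSet n k), IsBest ν S ∧ gap ν S = ξ ∧
      HardFor (semiBandit n k) ν (1 / 3 * ((2 : ℝ) ^ (2 * k))⁻¹ * (n.choose k : ℝ) * (ξ ^ 2)⁻¹) := by
  have hD : ξ * 2 ^ k ≤ 1 / 2 := by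
    have h1 : ξ * 2 ^ k ≤ ((2 : ℝ) ^ (k + 1))⁻¹ * 2 ^ k := mul_le_mul_of_nonneg_right hξ1 (by positivity)
    have h2 : ((2 : ℝ) ^ (k + 1))⁻¹ * 2 ^ k = 1 / 2 := by
      rw [pow_succ]
      field_simp
    linarith
  obtain ⟨ν, S, hS, hgap, hs⟩ := exists_hard_semi (n := n) hk hkn (by positivity) hD
  have e : ξ * 2 ^ k * (1 / 2) ^ k = ξ := by
    rw [mul_assoc, ← mul_pow]
    norm_num
  rw [e] at hgap
  refine ⟨ν, S, hS, hgap, ?_⟩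
  have e2 : 1 / 3 * ((2 : ℝ) ^ (2 * k))⁻¹ * (n.choose k : ℝ) * (ξ ^ 2)⁻¹ =
      1 / 3 * ((ξ * 2 ^ k) ^ 2)⁻¹ * n.choose k := by
    rw [mul_comm 2 k, pow_mul, mul_pow]
    field_simp
  rw [e2]
  exact hs

end Assembly

end BestOfK

end

theorem theorem1 (n k : ℕ) (hk : 2 ≤ k) (hkn : k < n) :
    (∀ ε μ : ℝ, 0 < ε → ε ≤ 1 → 0 < μ → μ ≤ 1 / 2 →
      ∃ (ν : PMF (BestOfK.Rewards n)) (S : BestOfK.KSet n k) (Δ : ℝ),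
        BestOfK.IsBest ν S ∧ BestOfK.gap ν S = Δ ∧ Δ = ε * μ ^ k ∧
        ∀ δ : ℝ, 0 < δ → δ < 1 →
          (BestOfK.RequiresObs (BestOfK.bandit n k) ν δ
            (4 * (1 - ε * (μ / (1 - μ)) ^ k) / 3 * (1 - (1 - μ) ^ k) * (1 - μ) ^ k *
              (n.choose k : ℝ) * (Δ ^ 2)⁻¹ * Real.log (1 / (2 * δ)))) ∧
          (BestOfK.RequiresObs (BestOfK.markedBandit n k) ν δ
            (4 * (1 - ε * (μ / (1 - μ)) ^ k) / 3 * (1 - (1 - μ) ^ k) * (1 - μ) ^ k *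
              (n.choose k : ℝ) * (Δ ^ 2)⁻¹ * Real.log (1 / (2 * δ)))) ∧
          (BestOfK.RequiresObs (BestOfK.semiBandit n k) ν δ
            (2 / 3 * μ ^ (2 * k) * (1 - ε) *
              (n.choose k : ℝ) * (Δ ^ 2)⁻¹ * Real.log (1 / (2 * δ))))) ∧
    (∀ ξ : ℝ, 0 < ξ → ξ ≤ ((2 * (k : ℝ)) ^ k)⁻¹ →
      ∃ (ν : PMF (BestOfK.Rewards n)) (S : BestOfK.KSet n k) (Δ : ℝ),
        BestOfK.IsBest ν S ∧ BestOfK.gap ν S = Δ ∧ Δ = ξ ∧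
        ∀ δ : ℝ, 0 < δ → δ < 1 →
          (BestOfK.RequiresObs (BestOfK.bandit n k) ν δ
            (1 / 3 * (n.choose k : ℝ) * (Δ ^ 2)⁻¹ * Real.log (1 / (2 * δ)))) ∧
          (BestOfK.RequiresObs (BestOfK.markedBandit n k) ν δ
            (1 / 3 * (n.choose k : ℝ) * (Δ ^ 2)⁻¹ * Real.log (1 / (2 * δ))))) ∧
    (∀ ξ : ℝ, 0 < ξ → ξ ≤ ((2 : ℝ) ^ (k + 1))⁻¹ →
      ∃ (ν : PMF (BestOfK.Rewards n)) (S : BestOfK.KSet n k) (Δ : ℝ),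
        BestOfK.IsBest ν S ∧ BestOfK.gap ν S = Δ ∧ Δ = ξ ∧
        ∀ δ : ℝ, 0 < δ → δ < 1 →
          (BestOfK.RequiresObs (BestOfK.semiBandit n k) ν δ
            (1 / 3 * ((2 : ℝ) ^ (2 * k))⁻¹ *
              (n.choose k : ℝ) * (Δ ^ 2)⁻¹ * Real.log (1 / (2 * δ))))) := by
  refine ⟨fun ε μ hε hε1 hμ hμ1 => ?_, fun ξ hξ hξ1 => ?_, fun ξ hξ hξ1 => ?_⟩
  · obtain ⟨ν, S, hS, hgap, hb, hs⟩ := BestOfK.exists_hard_of_mul_pow hk hkn hε hε1 hμ hμ1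
    exact ⟨ν, S, _, hS, hgap, rfl, fun δ hδ _ => ⟨hb.1 δ hδ, hb.2 δ hδ, hs δ hδ⟩⟩
  · obtain ⟨ν, S, hS, hgap, hb⟩ := BestOfK.exists_hard_of_le_inv_pow hk hkn hξ hξ1
    exact ⟨ν, S, _, hS, hgap, rfl, fun δ hδ _ => ⟨hb.1 δ hδ, hb.2 δ hδ⟩⟩
  · obtain ⟨ν, S, hS, hgap, hs⟩ := BestOfK.exists_hard_of_le_inv_two_pow hk hkn hξ hξ1
    exact ⟨ν, S, _, hS, hgap, rfl, fun δ hδ _ => hs δ hδ⟩
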